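/- **Setting.** For $g:\mathbb R^2\to\mathbb R$ write $d^2g=(g^{(2,0)},g^{(1,1)},g^{(0,2)})^T$ and let $V_g(x)=G(d^2g(x))$, $\lambda_{2,g}(x)=J(d^2g(x))$, where $$G(u,v,w)=\begin{pmatrix}2u-2w+2v-2\sqrt{(w-u)^2+4v^2}\\ w-u+4v-\sqrt{(w-u)^2+4v^2}\end{pmatrix},\qquad J(u,v,w)=\tfrac12\Big(u+w-\sqrt{(u-w)^2+4v^2}\Big);$$ thus $V_g$ is a second eigenvector field of the Hessian $\nabla^2 g$ with (smaller) eigenvalue $\lambda_{2,g}$. Let $\mathfrak X_{g,x_0}:\mathbb R\to\mathbb R^2$ solve $\frac{d}{dt}\mathfrak X_{g,x_0}(t)=V_g(\mathfrak X_{g,x_0}(t))$, $\mathfrak X_{g,x_0}(0)=x_0$, and put $$\Theta_{g,x_0}=\{t:\ \langle\nabla g,V_g\rangle(\mathfrak X_{g,x_0}(t))=0,\ \lambda_{2,g}(\mathfrak X_{g,x_0}(t))<0\}.$$ A filament point of $g$ is a point $x$ with $\langle\nabla g(x),V_g(x)\rangle=0$ and $\lambda_{2,g}(x)<0$. Let $f$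 be a probability density on $\mathbb R^2$, $X_1,X_2,\dots$ i.i.d. with density $f$, $h=h_n>0$, and $\hat f(x)=\frac1{nh^2}\sum_{i=1}^nK\big(\frac{x-X_i}h\big)$. Write $V,\lambda_2,\mathfrak X_{x_0},\Theta_{x_0}$ for the above objects with $g=f$ and $\hat V,\hat\lambda_2,\hat{\mathfrak X}_{x_0},\hat\Theta_{x_0}$ for those with $g=\hat f$. Let $\theta_{x_0}=\arg\min\{|t|:t\in\Theta_{x_0}\}$, and let $\hat\theta_{x_0}$ be a random variable that is a minimizer of $|t|$ over $\hat\Theta_{x_0}$ (any one, if there are several) whenever a minimizer exists, and $0$ if $\hat\Theta_{x_0}=\emptyset$. For $a^*>0$ and a set $\mathcal L\subset\mathbb R^2$ let $\mathcal G=\{\mathfrak X_{y}(t):y\in\mathcal L,\ |t|\le a^*\}$. **Assumptions.** - (F1) $f$ is four times continuously differentiable with bounded partial derivatives of orders $1$ to $4$. - (F2) $\mathcal H\subset\mathbb R^2$ is compact, $f>0$ on the open $\varepsilon_0$-neighbourhood of $\mathcal H$ for some $\varepsilon_0>0$, and $\nabla^2f(x)$ has two distinct eigenvalues for all $x\in\mathcal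 H$. - (F3) $\mathcal L\subset\mathcal H$ is compact and consists of filament points of $f$, $\mathcal G\subset\mathcal H$, $\theta_{x_0}$ exists and is unique for every $x_0\in\mathcal G$, and $\mathcal L=\{\mathfrak X_{x_0}(\theta_{x_0}):x_0\in\mathcal G\}$. - (F4) For some $\gamma>0$, $\big\|\frac1{u-s}\int_s^uV(\mathfrak X_{y}(r))\,dr\big\|\ge\gamma$ for all $y\in\mathcal L$, $-a^*\le s<u\le a^*$. - (F5) $\langle\nabla\langle\nabla f,V\rangle(x),V(x)\rangle\ne0$ for all $x\in\mathcal L$. - (F6) There is no $x\in\mathcal H$ with $\lambda_2(x)=0$ and $\langle\nabla f(x),V(x)\rangle=0$. - (K1) $K$ is a four times differentiable probability density with $K(-z)=K(z)$, whose support is the closed unit ball, with bounded partial derivatives of orders $1$ to $4$ and $\int K(x)xx^T\,dx=\mu_2I_{2\times2}$ for some $\mu_2<\infty$. - (K2) $\mathbf R=\int d^2K(z)\,d^2K(z)^T\,dz\in\mathbb R^{3\times3}$ is finite. - (H1) As $n\to\infty$: $h_n\to0$, $nh_n^8/(\log n)^3\to\infty$ and $nh_n^9\to\beta$ for some $\beta\ge0$.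 **Claim.** Let $x_0\in\mathcal G$ be such that there is no $t$ with $|t|\le|\theta_{x_0}|$, $\lambda_2(\mathfrak X_{x_0}(t))=0$ and $\langle\nabla f,V\rangle(\mathfrak X_{x_0}(t))=0$ (by (F6), this holds if $\mathfrak X_{x_0}(t)\in\mathcal H$ for $|t|\le|\theta_{x_0}|$). Write $x^*=\mathfrak X_{x_0}(\theta_{x_0})$. Then, as $n\to\infty$, $$\sqrt{nh^6}\,\big[\hat{\mathfrak X}_{x_0}(\hat\theta_{x_0})-\mathfrak X_{x_0}(\theta_{x_0})\big]\ \longrightarrow\ Z\,V(x^*)\quad\text{in distribution},$$ where $Z$ is a centred normal variable with variance $f(x^*)\,W(x^*)^T\mathbf R\,W(x^*)$ (the point mass at $0$ if this is zero). Here $$W(x)=\tilde a'(x)^{-1}\,\tilde G(x)^T\nabla f(x)\in\mathbb R^3,\qquad \tilde G(x)=\nabla G(d^2f(x))\in\mathbb R^{2\times3},$$ $$\tilde a'(x)=\nabla f(x)^T\,\nabla V(x)\,V(x)+\lambda_2(x)\|V(x)\|^2 .$$ In particular the limit law is concentrated on the line spanned by the eigenvector $V(x^*)$. -/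

import Mathlib

open MeasureTheory ProbabilityTheory Filter Topology

noncomputable section

namespace Ridge

/-- The Euclidean plane. -/
abbrev Plane : Type := EuclideanSpace ℝ (Fin 2)

/-! ### Ridges of a function of two variables

Everything below is a functional of a function `g : Plane → ℝ`. It is applied to the
density `f` and, for the plug-in estimators, to the kernel density estimator. -/

/-- The partial derivative of `g` with respect to the `i`-th coordinate. -/
def partialDeriv (i : Fin 2) (g : Plane → ℝ) (x : Plane) : ℝ :=
  fderiv ℝ g x (EuclideanSpace.single i 1)

/-- The vector `d²g = (g^(2,0), g^(1,1), g^(0,2))` of second order partial derivatives. -/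
def d2 (g : Plane → ℝ) (x : Plane) : EuclideanSpace ℝ (Fin 3) :=
  !₂[partialDeriv 0 (partialDeriv 0 g) x, partialDeriv 0 (partialDeriv 1 g) x,
    partialDeriv 1 (partialDeriv 1 g) x]

/-- The Hessian matrix of `g` at `x`. -/
def hessian (g : Plane → ℝ) (x : Plane) : Matrix (Fin 2) (Fin 2) ℝ :=
  !![d2 g x 0, d2 g x 1; d2 g x 1, d2 g x 2]

/-- The map `(u, v, w) ↦ G(u, v, w)`, an eigenvector for the smaller eigenvalue of the
symmetric matrix with rows `(u, v)` and `(v, w)`. -/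
def eigVecMap (p : EuclideanSpace ℝ (Fin 3)) : Plane :=
  !₂[2 * p 0 - 2 * p 2 + 2 * p 1 - 2 * √((p 2 - p 0) ^ 2 + 4 * p 1 ^ 2),
    p 2 - p 0 + 4 * p 1 - √((p 2 - p 0) ^ 2 + 4 * p 1 ^ 2)]

/-- The map `(u, v, w) ↦ J(u, v, w)`, the smaller eigenvalue of the same matrix. -/
def eigValMap (p : EuclideanSpace ℝ (Fin 3)) : ℝ :=
  (p 0 + p 2 - √((p 0 - p 2) ^ 2 + 4 * p 1 ^ 2)) / 2

/-- The vector field `V = G(d²g)` of second eigenvectors of the Hessian. -/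
def eigVec (g : Plane → ℝ) (x : Plane) : Plane := eigVecMap (d2 g x)

/-- The second (smaller) eigenvalue `λ₂ = J(d²g)` of the Hessian. -/
def eigVal (g : Plane → ℝ) (x : Plane) : ℝ := eigValMap (d2 g x)

/-- The directional derivative `⟨∇g(x), V(x)⟩`. -/
def slope (g : Plane → ℝ) (x : Plane) : ℝ := inner ℝ (gradient g x) (eigVec g x)

/-- Filament (ridge) points of `g`. -/
def IsFilamentPoint (g : Plane → ℝ) (x : Plane) : Prop := slope g x = 0 ∧ eigVal g x < 0

/-- `γ` is the integral curve of the field `U` started at `x₀`, in both time directions. -/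
def IsCurveFrom (U : Plane → Plane) (x₀ : Plane) (γ : ℝ → Plane) : Prop :=
  γ 0 = x₀ ∧ ∀ t, HasDerivAt γ (U (γ t)) t

open Classical in
/-- The integral curve `𝔛_{x₀}` of the second eigenvector field of `g`. The curve exists and is
unique as soon as `V` is Lipschitz; otherwise a constant curve is used as a default. -/
def curve (g : Plane → ℝ) (x₀ : Plane) : ℝ → Plane :=
  if h : ∃ γ, IsCurveFrom (eigVec g) x₀ γ then h.choose else fun _ => x₀

/-- The set `Θ_{x₀}` of times at which the integral curve is at a filament point. -/
def hitTimes (g : Plane → ℝ) (x₀ : Plane) : Set ℝ :=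
  {t | slope g (curve g x₀ t) = 0 ∧ eigVal g (curve g x₀ t) < 0}

/-- `t` minimizes `|t|` over `Θ_{x₀}`. -/
def IsFirstHit (g : Plane → ℝ) (x₀ : Plane) (t : ℝ) : Prop :=
  t ∈ hitTimes g x₀ ∧ ∀ s ∈ hitTimes g x₀, |t| ≤ |s|

open Classical in
/-- The time `θ_{x₀}`, the minimizer of `|t|` over `Θ_{x₀}`. -/
def firstHit (g : Plane → ℝ) (x₀ : Plane) : ℝ :=
  if h : ∃ t, IsFirstHit g x₀ t then h.choose else 0

/-- `t` is an admissible choice of the estimated time: some minimizer of `|t|` over the estimated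
`Θ_{x₀}` if there is one, and `0` if that set is empty. -/
def IsHitEstimate (g : Plane → ℝ) (x₀ : Plane) (t : ℝ) : Prop :=
  ((∃ s, IsFirstHit g x₀ s) → IsFirstHit g x₀ t) ∧ (hitTimes g x₀ = ∅ → t = 0)

/-- The set `𝒢(L, a)` of starting points. -/
def startSet (g : Plane → ℝ) (L : Set Plane) (a : ℝ) : Set Plane :=
  {x | ∃ y ∈ L, ∃ t ∈ Set.Icc (-a) a, x = curve g y t}

/-- `ã'(x) = ⟨∇g, V⟩_{∇V} + λ₂ ‖V‖²`, where `⟨v, w⟩_M = vᵀ M w`. -/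
def slopeDeriv (g : Plane → ℝ) (x : Plane) : ℝ :=
  inner ℝ (gradient g x) (fderiv ℝ (eigVec g) x (eigVec g x)) + eigVal g x * ‖eigVec g x‖ ^ 2

/-- `W(x) = ã'(x)⁻¹ G̃(x)ᵀ ∇g(x) ∈ ℝ³`, where `G̃(x)` is the Jacobian of `G` at `d²g(x)`. -/
def weight (g : Plane → ℝ) (x : Plane) : EuclideanSpace ℝ (Fin 3) :=
  (slopeDeriv g x)⁻¹ •
    ContinuousLinearMap.adjoint (fderiv ℝ eigVecMap (d2 g x)) (gradient g x)

/-- The matrix `R = ∫ d²K(z) d²K(z)ᵀ dz`. -/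
def roughness (K : Plane → ℝ) : Matrix (Fin 3) (Fin 3) ℝ :=
  Matrix.of fun i j => ∫ z, d2 K z i * d2 K z j

/-- `‖w‖²_M = wᵀ M w`. -/
def quadForm (M : Matrix (Fin 3) (Fin 3) ℝ) (w : EuclideanSpace ℝ (Fin 3)) : ℝ :=
  w.ofLp ⬝ᵥ M.mulVec w.ofLp

/-- The kernel density estimator `f̂(x) = (n b²)⁻¹ ∑_{i ≤ n} K((x - Xᵢ) / b)` at bandwidth `b`,
as a function of the (realized) observations `X 0, X 1, …`. -/
def kde (K : Plane → ℝ) (b : ℝ) (n : ℕ) (X : ℕ → Plane) (x : Plane) : ℝ :=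
  1 / ((n : ℝ) * b ^ 2) * ∑ i ∈ Finset.range n, K (b⁻¹ • (x - X i))

/-! ### Assumptions -/

/-- All partial derivatives of `g` of orders one to four are bounded. -/
def BoundedDerivs (g : Plane → ℝ) : Prop :=
  ∀ k ∈ Finset.Icc 1 4, ∃ C : ℝ, ∀ x, ‖iteratedFDeriv ℝ k g x‖ ≤ C

/-- `g` is a probability density. -/
def IsDensity (g : Plane → ℝ) : Prop :=
  (∀ x, 0 ≤ g x) ∧ Integrable g ∧ ∫ x, g x = 1

/-- Assumptions on the density `f`, the compact set `H`, the filament `L` and the constant `a`. -/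
structure FilamentModel (f : Plane → ℝ) (H L : Set Plane) (a : ℝ) : Prop where
  density : IsDensity f
  smooth : ContDiff ℝ 4 f
  boundedDerivs : BoundedDerivs f
  compact_H : IsCompact H
  pos_near_H : ∃ ε > 0, ∀ x ∈ Metric.thickening ε H, 0 < f x
  /-- the Hessian has two distinct eigenvalues on `H` -/
  distinct : ∀ x ∈ H, ∃ l₁ l₂ : ℝ, l₁ ≠ l₂ ∧
    Module.End.HasEigenvalue (Matrix.toLin' (hessian f x)) l₁ ∧
    Module.End.HasEigenvalue (Matrix.toLin' (hessian f x)) l₂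
  a_pos : 0 < a
  compact_L : IsCompact L
  L_subset : L ⊆ H
  L_filament : ∀ x ∈ L, IsFilamentPoint f x
  start_subset : startSet f L a ⊆ H
  unique_hit : ∀ x₀ ∈ startSet f L a, ∃! t, IsFirstHit f x₀ t
  L_eq : L = (fun x₀ => curve f x₀ (firstHit f x₀)) '' startSet f L a
  /-- the averages of `V` along the curves through `L` are bounded away from zero -/
  averages : ∃ γ > 0, ∀ x₀ ∈ L, ∀ s u : ℝ, -a ≤ s → s < u → u ≤ a →
    γ ≤ ‖(u - s)⁻¹ • ∫ r in s..u, eigVec f (curve f x₀ r)‖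
  transversal : ∀ x ∈ L, inner ℝ (gradient (slope f) x) (eigVec f x) ≠ 0
  nondegenerate : ∀ x ∈ H, ¬ (eigVal f x = 0 ∧ slope f x = 0)

/-- Assumptions on the kernel. The fields `contDiff` and `differentiable` say that `K` is four
times differentiable. -/
structure KernelAssumptions (K : Plane → ℝ) : Prop where
  density : IsDensity K
  symmetric : ∀ z, K (-z) = K z
  tsupport_eq : tsupport K = Metric.closedBall 0 1
  contDiff : ContDiff ℝ 3 K
  differentiable : Differentiable ℝ (iteratedFDeriv ℝ 3 K)
  boundedDerivs : BoundedDerivs K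
  second_moment : ∃ μ₂ : ℝ, ∀ i j : Fin 2,
    Integrable (fun z : Plane => K z * (z i * z j)) ∧
      ∫ z : Plane, K z * (z i * z j) = if i = j then μ₂ else 0
  roughness_finite : ∀ i j : Fin 3, Integrable fun z => d2 K z i * d2 K z j

/-- Assumptions on the bandwidths. -/
structure BandwidthAssumptions (h : ℕ → ℝ) : Prop where
  pos : ∀ n, 0 < h n
  tendsto_zero : Tendsto h atTop (𝓝 0)
  lower : Tendsto (fun n : ℕ => (n : ℝ) * h n ^ 8 / Real.log n ^ 3) atTop atTop
  upper : ∃ β : ℝ, 0 ≤ β ∧ Tendsto (fun n : ℕ => (n : ℝ) * h n ^ 9) atTop (𝓝 β)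

end Ridge

end

open MeasureTheory ProbabilityTheory Filter Topology

noncomputable section

namespace Ridge

/-! ### The eigenvector and eigenvalue maps -/

/-! Write x* for the first filament point, reached at time θ, and ξ = d²f̂(x*) − d²f(x*), which is
of order (nh⁶)^(-1/2) in probability. Along the estimated curve the slope s(t) = ⟨∇f̂, V̂⟩(X̂(t))
has derivative close to ã'(x*) ≠ 0 near θ as soon as f̂ is C³-close to f. Hence θ̂ is its unique
zero near θ, and θ̂ − θ ≈ −s(θ)/ã'(x*). To first order s(θ) is ⟨∇f(x*), G̃ξ⟩: the zeroth order term
vanishes because x* is a filament point, the stochastic error of the gradient has the faster rate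
(nh⁴)^(-1/2), and the displacement X̂(θ) − x* is negligible. So X̂(θ̂) − x* ≈ (θ̂ − θ)V(x*) ≈ −⟨W,
ξ⟩V(x*). This is `FirstHitModel.exists_expansion`, a deterministic statement; a central limit
theorem for ⟨W, ξ⟩ then gives the limit, which lies on the line of V(x*) because only the hitting
time fluctuates at this rate.

The crux is that the displacement of the curve is negligible although V̂ − V has pointwise the same
order as ξ. An integral form of Grönwall's inequality (`norm_sub_le_drift`) bounds the displacement
by the time integral of V̂ − V along the fixed curve of f. In the second moment of the linear part
of that integral, only pairs of times count at which the curve is at two points of distance at most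
2h. The powers of n and h cancel, and what is left is the measure of these pairs, which tends to
zero because the curve never stops (`tendsto_volume_closePairs`); no rate is needed. The quadratic
part of V̂ − V has variance contribution of order (nh⁶)⁻¹. Together this is
`IsSample.negligible_driftSize`.

G is smooth only where the eigenvalues differ. Now ã'(x*) ≠ 0 forces V(x*) ≠ 0, uniqueness for the
differential equation propagates V ≠ 0 along the whole curve (`eigVec_curve_ne_zero`), and V ≠ 0
implies a positive gap.

The remaining ingredients: far from θ no estimated hit can occur, since |slope| and λ₂ are not
simultaneously small and nonpositive there (`FirstHitModel.exists_separation`); C³ consistency on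
compact sets follows from an exponential inequality on a grid of mesh 1/n
(`IsSample.tendsto_closeAt`); the bias of second derivatives is O(h²), and √(nh⁶)h² → 0 because nh⁹
stays bounded; the central limit theorem is proved with characteristic functions
(`IsSample.tendstoInDistribution_sum`). -/

/-- The linear map `(u, v, w) ↦ (w - u, 2 v)`, whose norm is the gap between the eigenvalues. -/
def gapMap : EuclideanSpace ℝ (Fin 3) →L[ℝ] Plane :=
  LinearMap.toContinuousLinearMap
    { toFun := fun p => !₂[p 2 - p 0, 2 * p 1]
      map_add' := fun p q => by
        ext i; fin_cases i <;> simp <;> ring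
      map_smul' := fun c p => by
        ext i; fin_cases i <;> simp <;> ring }

/-- The linear part of `eigVecMap`. -/
def eigVecLin : EuclideanSpace ℝ (Fin 3) →L[ℝ] Plane :=
  LinearMap.toContinuousLinearMap
    { toFun := fun p => !₂[2 * p 0 - 2 * p 2 + 2 * p 1, p 2 - p 0 + 4 * p 1]
      map_add' := fun p q => by
        ext i; fin_cases i <;> simp <;> ring
      map_smul' := fun c p => by
        ext i; fin_cases i <;> simp <;> ring }

lemma gapMap_apply (p : EuclideanSpace ℝ (Fin 3)) : gapMap p = !₂[p 2 - p 0, 2 * p 1] := rfl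

lemma norm_gapMap (p : EuclideanSpace ℝ (Fin 3)) :
    ‖gapMap p‖ = √((p 2 - p 0) ^ 2 + 4 * p 1 ^ 2) := by
  rw [gapMap_apply, EuclideanSpace.norm_eq]
  simp only [Fin.sum_univ_two, Real.norm_eq_abs, sq_abs]
  congr 1
  simp
  ring

/-- All the nonsmoothness of `eigVecMap` sits in one norm of a linear map. Global Lipschitz bounds,
the derivative and the second order remainder therefore reduce to facts about the norm of a
Euclidean space. -/
lemma eigVecMap_eq (p : EuclideanSpace ℝ (Fin 3)) :
    eigVecMap p = eigVecLin p - ‖gapMap p‖ • (!₂[2, 1] : Plane) := by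
  rw [norm_gapMap]
  ext i
  fin_cases i
  · simp [eigVecMap, eigVecLin]
    ring
  · simp [eigVecMap, eigVecLin]

lemma eigValMap_eq (p : EuclideanSpace ℝ (Fin 3)) :
    eigValMap p = (p 0 + p 2 - ‖gapMap p‖) / 2 := by
  rw [norm_gapMap, eigValMap]
  congr 4
  ring

lemma eigVecMap_zero : eigVecMap 0 = 0 := by
  rw [eigVecMap_eq]; simp

/-- A Lipschitz constant of `eigVecMap`. -/
def eigVecLip : ℝ := ‖eigVecLin‖ + ‖gapMap‖ * ‖(!₂[2, 1] : Plane)‖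

lemma eigVecLip_nonneg : 0 ≤ eigVecLip := by unfold eigVecLip; positivity

lemma norm_eigVecMap_sub_le (p q : EuclideanSpace ℝ (Fin 3)) :
    ‖eigVecMap p - eigVecMap q‖ ≤ eigVecLip * ‖p - q‖ := by
  have h1 : eigVecMap p - eigVecMap q =
      eigVecLin (p - q) - (‖gapMap p‖ - ‖gapMap q‖) • (!₂[2, 1] : Plane) := by
    rw [eigVecMap_eq, eigVecMap_eq, map_sub, sub_smul]; abel
  have h2 : |‖gapMap p‖ - ‖gapMap q‖| ≤ ‖gapMap‖ * ‖p - q‖ :=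
    (abs_norm_sub_norm_le _ _).trans (by rw [← map_sub]; exact gapMap.le_opNorm _)
  rw [h1, eigVecLip, add_mul]
  refine (norm_sub_le _ _).trans (add_le_add (eigVecLin.le_opNorm _) ?_)
  rw [norm_smul, Real.norm_eq_abs]
  nlinarith [norm_nonneg (!₂[2, 1] : Plane)]

lemma norm_eigVecMap_le (p : EuclideanSpace ℝ (Fin 3)) : ‖eigVecMap p‖ ≤ eigVecLip * ‖p‖ := by
  simpa [eigVecMap_zero] using norm_eigVecMap_sub_le p 0

lemma continuous_eigVecMap : Continuous eigVecMap := by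
  have : eigVecMap = fun p => eigVecLin p - ‖gapMap p‖ • (!₂[2, 1] : Plane) :=
    funext eigVecMap_eq
  rw [this]; fun_prop

lemma continuous_eigValMap : Continuous eigValMap := by
  have : eigValMap = fun p : EuclideanSpace ℝ (Fin 3) => (p 0 + p 2 - ‖gapMap p‖) / 2 :=
    funext eigValMap_eq
  rw [this]; fun_prop

/-- The derivative of `eigVecMap` where the two eigenvalues are distinct. -/
def eigVecDeriv (q : EuclideanSpace ℝ (Fin 3)) : EuclideanSpace ℝ (Fin 3) →L[ℝ] Plane :=
  eigVecLin - (((‖gapMap q‖⁻¹ • innerSL ℝ (gapMap q)) ∘L gapMap).smulRight (!₂[2, 1] : Plane))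

lemma eigVecDeriv_apply (q s : EuclideanSpace ℝ (Fin 3)) :
    eigVecDeriv q s =
      eigVecLin s - (‖gapMap q‖⁻¹ * inner ℝ (gapMap q) (gapMap s)) • (!₂[2, 1] : Plane) := by
  simp [eigVecDeriv]

/-- After multiplication by ‖p‖ the error becomes ‖p + s‖‖p‖ − ‖p‖² − ⟨p, s⟩. It is nonnegative by
Cauchy–Schwarz and at most ‖s‖²/2 because (‖p + s‖ − ‖p‖)² ≥ 0. -/
lemma abs_norm_add_sub_le {E : Type*} [NormedAddCommGroup E] [InnerProductSpace ℝ E]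
    {p : E} (hp : p ≠ 0) (s : E) :
    |‖p + s‖ - ‖p‖ - ‖p‖⁻¹ * inner ℝ p s| ≤ ‖p‖⁻¹ * ‖s‖ ^ 2 := by
  have hp' : 0 < ‖p‖ := norm_pos_iff.2 hp
  set a := ‖p‖
  set c := inner ℝ p s
  have hsq : ‖p + s‖ ^ 2 = a ^ 2 + 2 * c + ‖s‖ ^ 2 := norm_add_sq_real p s
  have hlow : a ^ 2 + c ≤ ‖p + s‖ * a := by
    have h := real_inner_le_norm (p + s) p
    rw [inner_add_left, real_inner_self_eq_norm_sq, real_inner_comm] at h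
    exact h
  have e : ‖p + s‖ - a - a⁻¹ * c = a⁻¹ * (‖p + s‖ * a - a ^ 2 - c) := by
    field_simp
  rw [e, abs_mul, abs_of_pos (inv_pos.2 hp'), abs_of_nonneg (by linarith)]
  refine mul_le_mul_of_nonneg_left ?_ (inv_pos.2 hp').le
  nlinarith [sq_nonneg (‖p + s‖ - a)]

/-- The remainder constant in the first order expansion of `eigVecMap`. -/
def eigVecRem : ℝ := ‖gapMap‖ ^ 2 * ‖(!₂[2, 1] : Plane)‖

lemma eigVecRem_nonneg : 0 ≤ eigVecRem := by unfold eigVecRem; positivity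

/-- The linear part cancels, so only the remainder of the norm is left. The explicit dependence on
the gap makes the bound uniform on compact pieces of a curve with nonzero gap. -/
lemma norm_eigVecMap_add_sub_le {q : EuclideanSpace ℝ (Fin 3)} (hq : gapMap q ≠ 0)
    (s : EuclideanSpace ℝ (Fin 3)) :
    ‖eigVecMap (q + s) - eigVecMap q - eigVecDeriv q s‖ ≤
      eigVecRem * ‖gapMap q‖⁻¹ * ‖s‖ ^ 2 := by
  have h1 : eigVecMap (q + s) - eigVecMap q - eigVecDeriv q s =
      -(‖gapMap q + gapMap s‖ - ‖gapMap q‖ - ‖gapMap q‖⁻¹ * inner ℝ (gapMap q) (gapMap s)) •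
        (!₂[2, 1] : Plane) := by
    rw [eigVecMap_eq, eigVecMap_eq, eigVecDeriv_apply, map_add, map_add]
    module
  rw [h1, norm_smul, norm_neg, Real.norm_eq_abs]
  have h2 := abs_norm_add_sub_le hq (gapMap s)
  have h3 : ‖gapMap s‖ ^ 2 ≤ ‖gapMap‖ ^ 2 * ‖s‖ ^ 2 := by
    rw [← mul_pow]; gcongr; exact gapMap.le_opNorm s
  calc _ ≤ ‖gapMap q‖⁻¹ * (‖gapMap‖ ^ 2 * ‖s‖ ^ 2) * ‖(!₂[2, 1] : Plane)‖ := by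
        gcongr; exact h2.trans (by gcongr)
    _ = _ := by unfold eigVecRem; ring

lemma hasFDerivAt_eigVecMap {q : EuclideanSpace ℝ (Fin 3)} (hq : gapMap q ≠ 0) :
    HasFDerivAt eigVecMap (eigVecDeriv q) q := by
  refine HasFDerivAt.of_isLittleO ?_
  have h : (fun p => eigVecMap p - eigVecMap q - eigVecDeriv q (p - q)) =O[𝓝 q]
      fun p => ‖p - q‖ ^ 2 := by
    refine Asymptotics.IsBigO.of_bound (eigVecRem * ‖gapMap q‖⁻¹) (Eventually.of_forall fun p => ?_)
    have := norm_eigVecMap_add_sub_le hq (p - q)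
    simpa using this
  refine h.trans_isLittleO ?_
  rw [← Asymptotics.isLittleO_norm_right]
  have h0 : Tendsto (fun p => ‖p - q‖) (𝓝 q) (𝓝 0) := by
    have : Continuous fun p => ‖p - q‖ := by fun_prop
    simpa using this.tendsto q
  exact (Asymptotics.isLittleO_pow_id one_lt_two).comp_tendsto h0

lemma fderiv_eigVecMap {q : EuclideanSpace ℝ (Fin 3)} (hq : gapMap q ≠ 0) :
    fderiv ℝ eigVecMap q = eigVecDeriv q := (hasFDerivAt_eigVecMap hq).fderiv

lemma continuousAt_eigVecDeriv {q : EuclideanSpace ℝ (Fin 3)} (hq : gapMap q ≠ 0) :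
    ContinuousAt eigVecDeriv q := by
  unfold eigVecDeriv
  have : ‖gapMap q‖ ≠ 0 := norm_ne_zero_iff.2 hq
  have h1 : ContinuousAt (fun q => ‖gapMap q‖⁻¹) q :=
    ContinuousAt.inv₀ (by fun_prop) this
  have h2 : ContinuousAt (fun q => ‖gapMap q‖⁻¹ • innerSL ℝ (gapMap q)) q := by
    refine h1.smul ?_
    fun_prop
  have h3 : ContinuousAt (fun q => (‖gapMap q‖⁻¹ • innerSL ℝ (gapMap q)) ∘L gapMap) q := by
    fun_prop
  have h4 : Continuous fun l : EuclideanSpace ℝ (Fin 3) →L[ℝ] ℝ =>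
      l.smulRight (!₂[2, 1] : Plane) :=
    ((ContinuousLinearMap.smulRightL ℝ (EuclideanSpace ℝ (Fin 3)) Plane).flip
      (!₂[2, 1] : Plane)).continuous
  exact continuousAt_const.sub (h4.continuousAt.comp h3)

/-- The bound includes points of zero gap, where the inverse of zero removes the second term. It
supplies a global bound for the weights in the time integrals below. -/
lemma norm_eigVecDeriv_le (q : EuclideanSpace ℝ (Fin 3)) : ‖eigVecDeriv q‖ ≤ eigVecLip := by
  refine ContinuousLinearMap.opNorm_le_bound _ eigVecLip_nonneg fun s => ?_
  rw [eigVecDeriv_apply, eigVecLip, add_mul]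
  refine (norm_sub_le _ _).trans (add_le_add (eigVecLin.le_opNorm _) ?_)
  rw [norm_smul]
  have h1 : ‖‖gapMap q‖⁻¹ * inner ℝ (gapMap q) (gapMap s)‖ ≤ ‖gapMap‖ * ‖s‖ := by
    rcases eq_or_ne (gapMap q) 0 with h0 | h0
    · simp [h0]; positivity
    · have : 0 < ‖gapMap q‖ := norm_pos_iff.2 h0
      rw [norm_mul, norm_inv, norm_norm]
      have h2 := norm_inner_le_norm (𝕜 := ℝ) (gapMap q) (gapMap s)
      calc _ ≤ ‖gapMap q‖⁻¹ * (‖gapMap q‖ * ‖gapMap s‖) := by gcongr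
        _ = ‖gapMap s‖ := by field_simp
        _ ≤ _ := gapMap.le_opNorm s
  calc _ ≤ ‖gapMap‖ * ‖s‖ * ‖(!₂[2, 1] : Plane)‖ := by gcongr
    _ = _ := by ring

/-- If the eigenvalues coincide the matrix is scalar and the formula for the eigenvector gives zero.
Thus nonvanishing of the field is a sufficient test for smoothness of `eigVecMap`. -/
lemma gapMap_ne_zero_of_eigVecMap_ne_zero {q : EuclideanSpace ℝ (Fin 3)}
    (hq : eigVecMap q ≠ 0) : gapMap q ≠ 0 := by
  intro h
  apply hq
  have h0 : q 2 - q 0 = 0 := by simpa [gapMap_apply] using congrArg (fun v : Plane => v 0) h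
  have h1 : q 1 = 0 := by simpa [gapMap_apply] using congrArg (fun v : Plane => v 1) h
  rw [eigVecMap_eq, h]
  ext i
  fin_cases i <;> simp [eigVecLin] <;> linarith

/-- `eigVecMap` is an eigenvector for the eigenvalue `eigValMap`. -/
lemma eigVecMap_eigen (q : EuclideanSpace ℝ (Fin 3)) :
    q 0 * eigVecMap q 0 + q 1 * eigVecMap q 1 = eigValMap q * eigVecMap q 0 ∧
    q 1 * eigVecMap q 0 + q 2 * eigVecMap q 1 = eigValMap q * eigVecMap q 1 := by
  have hs : ‖gapMap q‖ ^ 2 = (q 2 - q 0) ^ 2 + 4 * q 1 ^ 2 := by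
    rw [norm_gapMap, Real.sq_sqrt (by positivity)]
  rw [eigValMap_eq, eigVecMap_eq]
  set D := ‖gapMap q‖
  simp [eigVecLin]
  constructor <;> nlinarith

/-! ### Integral curves of bounded Lipschitz fields -/

section Curves

variable {U V : Plane → Plane} {x₀ : Plane} {γ δ : ℝ → Plane}

lemma IsCurveFrom.continuous (h : IsCurveFrom U x₀ γ) : Continuous γ :=
  continuous_iff_continuousAt.2 fun t => (h.2 t).continuousAt

lemma IsCurveFrom.neg (h : IsCurveFrom U x₀ γ) :
    IsCurveFrom (fun x => -U x) x₀ (fun t => γ (-t)) := by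
  refine ⟨by simpa using h.1, fun t => ?_⟩
  have := (h.2 (-t)).scomp t (hasDerivAt_neg t)
  simpa [Function.comp_def] using this

/-- Since the field is bounded and Lipschitz on the whole plane, Picard–Lindelöf applies on every
interval [−n−1, n+1]. Uniqueness makes these solutions agree and they are glued. -/
lemma exists_isCurveFrom {K : NNReal} {M : ℝ} (hU : LipschitzWith K U) (hM : ∀ x, ‖U x‖ ≤ M)
    (x₀ : Plane) : ∃ γ, IsCurveFrom U x₀ γ := by
  have hM0 : 0 ≤ M := (norm_nonneg _).trans (hM x₀)
  have key : ∀ n : ℕ, ∃ γ : ℝ → Plane, γ 0 = x₀ ∧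
      ∀ t ∈ Set.Ioo (-((n : ℝ) + 1)) ((n : ℝ) + 1), HasDerivAt γ (U (γ t)) t := by
    intro n
    have h0 : (0 : ℝ) ∈ Set.Icc (-((n : ℝ) + 1)) ((n : ℝ) + 1) := by
      constructor <;> linarith [n.cast_nonneg (α := ℝ)]
    have hp : IsPicardLindelof (fun _ => U) (⟨0, h0⟩ : Set.Icc (-((n : ℝ) + 1)) ((n : ℝ) + 1)) x₀
        (⟨M * (n + 1), by positivity⟩) 0 ⟨M, hM0⟩ K :=
      { lipschitzOnWith := fun _ _ => hU.lipschitzOnWith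
        continuousOn := fun _ _ => continuousOn_const
        norm_le := fun _ _ x _ => hM x
        mul_max_le := by simp; rfl }
    obtain ⟨γ, h1, h2⟩ := hp.exists_eq_forall_mem_Icc_hasDerivWithinAt₀
    exact ⟨γ, h1, fun t ht => (h2 t (Set.Ioo_subset_Icc_self ht)).hasDerivAt
      (Icc_mem_nhds ht.1 ht.2)⟩
  choose c hc0 hc using key
  have agree : ∀ m n : ℕ, m ≤ n →
      Set.EqOn (c m) (c n) (Set.Ioo (-((m : ℝ) + 1)) ((m : ℝ) + 1)) := by
    intro m n hmn
    have hmn' : (m : ℝ) ≤ n := by exact_mod_cast hmn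
    refine ODE_solution_unique_of_mem_Ioo (v := fun _ => U) (s := fun _ => Set.univ) (t₀ := 0)
      (fun _ _ => hU.lipschitzOnWith) ?_ (fun t ht => ⟨hc m t ht, trivial⟩)
      (fun t ht => ⟨hc n t ⟨by linarith [ht.1], by linarith [ht.2]⟩, trivial⟩)
      ((hc0 m).trans (hc0 n).symm)
    constructor <;> linarith [m.cast_nonneg (α := ℝ)]
  have mem : ∀ t : ℝ, t ∈ Set.Ioo (-((⌈|t|⌉₊ : ℝ) + 1)) ((⌈|t|⌉₊ : ℝ) + 1) := fun t => by
    have := Nat.le_ceil |t|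
    exact ⟨by linarith [neg_abs_le t], by linarith [le_abs_self t]⟩
  -- The solution with index ⌈|t|⌉ lives on an open interval that contains t strictly inside, thanks
  -- to the extra 1. Hence the glued function agrees with it near t.
  refine ⟨fun t => c ⌈|t|⌉₊ t, hc0 _, fun t => ?_⟩
  refine (hc _ t (mem t)).congr_of_eventuallyEq ?_
  filter_upwards [isOpen_Ioo.mem_nhds (mem t)] with s hs
  rcases le_total ⌈|s|⌉₊ ⌈|t|⌉₊ with h | h
  · exact agree _ _ h (mem s)
  · exact (agree _ _ h hs).symm

/-- Confinement of an integral curve to a ball on which the field is bounded. -/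
lemma IsCurveFrom.mem_closedBall {M T R : ℝ} (h : IsCurveFrom U x₀ γ)
    (hM : ∀ x ∈ Metric.closedBall x₀ R, ‖U x‖ ≤ M) (hM0 : 0 ≤ M) (hR : (M + 1) * T ≤ R)
    {t : ℝ} (ht : |t| ≤ T) : γ t ∈ Metric.closedBall x₀ R := by
  have fwd : ∀ {U : Plane → Plane} {γ : ℝ → Plane}, IsCurveFrom U x₀ γ →
      (∀ x ∈ Metric.closedBall x₀ R, ‖U x‖ ≤ M) → ∀ t ∈ Set.Icc 0 T,
      γ t ∈ Metric.closedBall x₀ R := by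
    intro U γ h hM t ht
    -- The barrier has slope `M + 1` rather than `M`, because the comparison principle asks for a
    -- strict inequality where the distance touches the barrier. At such a time the curve is still
    -- in the ball, so the bound on the field is available.
    have hb := image_norm_le_of_norm_deriv_right_lt_deriv_boundary (f := fun t => γ t - x₀)
      (f' := fun t => U (γ t)) (a := 0) (b := T) (B := fun t => (M + 1) * t)
      (B' := fun _ => M + 1) (h.continuous.sub continuous_const).continuousOn
      (fun s _ => ((h.2 s).sub_const x₀).hasDerivWithinAt) (by simp [h.1])
      (fun s => by simpa using (hasDerivAt_id s).const_mul (M + 1)) ?_ ht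
    · rw [mem_closedBall_iff_norm]
      exact hb.trans ((mul_le_mul_of_nonneg_left ht.2 (by positivity)).trans hR)
    · intro s hs he
      have hs' : γ s ∈ Metric.closedBall x₀ R := by
        rw [mem_closedBall_iff_norm, he]
        exact (mul_le_mul_of_nonneg_left hs.2.le (by positivity)).trans hR
      linarith [hM _ hs']
  rcases le_total 0 t with h0 | h0
  · exact fwd h hM t ⟨h0, (le_abs_self t).trans ht⟩
  · have := fwd h.neg (fun x hx => by simpa using hM x hx) (-t)
      ⟨by linarith, (neg_le_abs t).trans ht⟩
    simpa using this

/-- The accumulated discrepancy of two fields along a path. -/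
def drift (U V : Plane → Plane) (γ : ℝ → Plane) (t : ℝ) : Plane :=
  ∫ r in (0 : ℝ)..t, (U (γ r) - V (γ r))

lemma hasDerivAt_drift (hU : Continuous U) (hV : Continuous V) (hγ : Continuous γ) (t : ℝ) :
    HasDerivAt (drift U V γ) (U (γ t) - V (γ t)) t := by
  have hc : Continuous fun r => U (γ r) - V (γ r) := by fun_prop
  exact intervalIntegral.integral_hasDerivAt_right (hc.intervalIntegrable _ _)
    hc.aestronglyMeasurable.stronglyMeasurableAtFilter hc.continuousAt

lemma continuous_drift (hU : Continuous U) (hV : Continuous V) (hγ : Continuous γ) :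
    Continuous (drift U V γ) :=
  continuous_iff_continuousAt.2 fun t => (hasDerivAt_drift hU hV hγ t).continuousAt

/-- With E the drift, δ − γ − E vanishes at 0 and has derivative U(δ) − U(γ), of norm at most L(‖δ −
γ − E‖ + ‖E‖). Only the integrated difference of the fields enters, never its supremum; this is what
makes the bound sharp enough for the estimator. -/
lemma norm_sub_le_drift_of_nonneg {L T : ℝ} (hU : Continuous U) (hV : Continuous V)
    (hδ : IsCurveFrom U x₀ δ) (hγ : IsCurveFrom V x₀ γ) (hL : 0 ≤ L)
    (hLip : ∀ t ∈ Set.Icc 0 T, ‖U (δ t) - U (γ t)‖ ≤ L * ‖δ t - γ t‖)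
    {t : ℝ} (ht : t ∈ Set.Icc 0 T) :
    ‖δ t - γ t‖ ≤ ‖drift U V γ t‖ +
      L * Real.exp (L * T) * ∫ r in (0 : ℝ)..t, ‖drift U V γ r‖ := by
  set E := drift U V γ
  have hE : ∀ t, HasDerivAt E (U (γ t) - V (γ t)) t := hasDerivAt_drift hU hV hγ.continuous
  have hEc : Continuous E := continuous_drift hU hV hγ.continuous
  set Φ : ℝ → ℝ := fun t => ∫ r in (0 : ℝ)..t, ‖E r‖
  have hΦ : ∀ t, HasDerivAt Φ ‖E t‖ t := fun t =>
    intervalIntegral.integral_hasDerivAt_right (hEc.norm.intervalIntegrable _ _)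
      hEc.norm.aestronglyMeasurable.stronglyMeasurableAtFilter hEc.norm.continuousAt
  have hΦ0 : ∀ s, 0 ≤ s → 0 ≤ Φ s := fun s hs =>
    intervalIntegral.integral_nonneg hs fun _ _ => norm_nonneg _
  -- The two terms in ε make the comparison with the barrier strict; afterwards ε tends to zero.
  have main : ∀ ε > 0, ‖δ t - γ t - E t‖ ≤ (L * Φ t + ε + ε * t) * Real.exp (L * t) := by
    intro ε hε
    refine image_norm_le_of_norm_deriv_right_lt_deriv_boundary
      (f := fun t => δ t - γ t - E t) (f' := fun t => U (δ t) - U (γ t)) (a := 0) (b := T)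
      (B := fun t => (L * Φ t + ε + ε * t) * Real.exp (L * t))
      (B' := fun t => (L * ‖E t‖ + ε) * Real.exp (L * t) +
        (L * Φ t + ε + ε * t) * (Real.exp (L * t) * L))
      ((hδ.continuous.sub hγ.continuous).sub hEc).continuousOn ?_ ?_ ?_ ?_ ht
    · intro s _
      have := ((hδ.2 s).sub (hγ.2 s)).sub (hE s)
      refine (this.congr_deriv ?_).hasDerivWithinAt
      abel
    · simp [hδ.1, hγ.1, E, drift, Φ, hε.le]
    · intro s
      have h1 : HasDerivAt (fun t => L * Φ t + ε + ε * t) (L * ‖E s‖ + ε) s := by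
        have := (((hΦ s).const_mul L).add_const ε).add ((hasDerivAt_id s).const_mul ε)
        rw [mul_one] at this
        exact this
      have h2 : HasDerivAt (fun t => Real.exp (L * t)) (Real.exp (L * s) * L) s := by
        have := ((hasDerivAt_id s).const_mul L).exp
        simpa using this
      exact h1.mul h2
    · intro s hs he
      have h1 := hLip s ⟨hs.1, hs.2.le⟩
      have h2 : ‖δ s - γ s‖ ≤ ‖δ s - γ s - E s‖ + ‖E s‖ := by
        simpa using norm_add_le (δ s - γ s - E s) (E s)
      rw [he] at h2
      have h3 : 1 ≤ Real.exp (L * s) := Real.one_le_exp (mul_nonneg hL hs.1)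
      have h4 : L * ‖δ s - γ s‖ ≤
          L * ((L * Φ s + ε + ε * s) * Real.exp (L * s) + ‖E s‖) := by gcongr
      have h5 : L * ‖E s‖ ≤ L * ‖E s‖ * Real.exp (L * s) :=
        le_mul_of_one_le_right (by positivity) h3
      nlinarith
  have lim : ‖δ t - γ t - E t‖ ≤ L * Φ t * Real.exp (L * t) := by
    have hc : Tendsto (fun ε => (L * Φ t + ε + ε * t) * Real.exp (L * t)) (𝓝[>] 0)
        (𝓝 ((L * Φ t + 0 + 0 * t) * Real.exp (L * t))) := by
      refine Tendsto.mono_left ?_ nhdsWithin_le_nhds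
      exact Continuous.tendsto (by fun_prop) 0
    have := ge_of_tendsto hc (eventually_mem_nhdsWithin.mono fun ε hε => main ε hε)
    simpa using this
  have h2 : ‖δ t - γ t‖ ≤ ‖δ t - γ t - E t‖ + ‖E t‖ := by
    simpa using norm_add_le (δ t - γ t - E t) (E t)
  have h3 : Real.exp (L * t) ≤ Real.exp (L * T) := by
    gcongr; exact ht.2
  have h4 : L * Φ t * Real.exp (L * t) ≤ L * Φ t * Real.exp (L * T) :=
    mul_le_mul_of_nonneg_left h3 (mul_nonneg hL (hΦ0 t ht.1))
  calc _ ≤ L * Φ t * Real.exp (L * T) + ‖E t‖ := by linarith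
    _ = _ := by ring

/-- Integral form of Grönwall's inequality for the distance of the integral curves of two fields. -/
lemma norm_sub_le_drift {L T : ℝ} (hU : Continuous U) (hV : Continuous V)
    (hδ : IsCurveFrom U x₀ δ) (hγ : IsCurveFrom V x₀ γ) (hL : 0 ≤ L)
    (hLip : ∀ t, |t| ≤ T → ‖U (δ t) - U (γ t)‖ ≤ L * ‖δ t - γ t‖)
    {t : ℝ} (ht : |t| ≤ T) :
    ‖δ t - γ t‖ ≤ ‖drift U V γ t‖ +
      L * Real.exp (L * T) * |∫ r in (0 : ℝ)..t, ‖drift U V γ r‖| := by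
  rcases le_total 0 t with h0 | h0
  · rw [abs_of_nonneg (intervalIntegral.integral_nonneg h0 fun _ _ => norm_nonneg _)]
    exact norm_sub_le_drift_of_nonneg hU hV hδ hγ hL
      (fun s hs => hLip s (abs_le.2 ⟨by linarith [hs.1, hs.2], hs.2⟩))
      ⟨h0, (le_abs_self t).trans ht⟩
  -- Negative times follow from the forward estimate for the reversed curves, which solve the
  -- equations with fields −U and −V.
  · have hd : ∀ s, drift (fun x => -U x) (fun x => -V x) (fun t => γ (-t)) s = drift U V γ (-s) := by
      intro s
      have := intervalIntegral.integral_comp_neg (a := 0) (b := s) fun r => U (γ r) - V (γ r)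
      simp only [drift]
      rw [neg_zero] at this
      rw [intervalIntegral.integral_symm (-s) 0, ← this, ← intervalIntegral.integral_neg]
      congr 1; ext1 r; abel
    have := norm_sub_le_drift_of_nonneg (U := fun x => -U x) (V := fun x => -V x) (L := L) (T := T)
      hU.neg hV.neg hδ.neg hγ.neg hL
      (fun s hs => by
        have := hLip (-s) (by rw [abs_neg]; exact abs_le.2 ⟨by linarith [hs.1, hs.2], hs.2⟩)
        rw [← neg_sub_neg, norm_sub_rev]
        simpa [norm_sub_rev] using this)
      (t := -t) ⟨by linarith, (neg_le_abs t).trans ht⟩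
    simp only [hd, neg_neg] at this
    refine this.trans (le_of_eq ?_)
    congr 2
    have h1 := intervalIntegral.integral_comp_neg (a := 0) (b := -t) fun r => ‖drift U V γ r‖
    have h2 : 0 ≤ ∫ r in t..(0 : ℝ), ‖drift U V γ r‖ :=
      intervalIntegral.integral_nonneg h0 fun _ _ => norm_nonneg _
    rw [h1, neg_neg, neg_zero, intervalIntegral.integral_symm t 0, abs_neg, abs_of_nonneg h2]

lemma norm_sub_le_of_field_close {L T η : ℝ} (hU : Continuous U) (hV : Continuous V)
    (hδ : IsCurveFrom U x₀ δ) (hγ : IsCurveFrom V x₀ γ) (hL : 0 ≤ L)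
    (hLip : ∀ t, |t| ≤ T → ‖U (δ t) - U (γ t)‖ ≤ L * ‖δ t - γ t‖)
    (hη : ∀ t, |t| ≤ T → ‖U (γ t) - V (γ t)‖ ≤ η) {t : ℝ} (ht : |t| ≤ T) :
    ‖δ t - γ t‖ ≤ η * (T + L * Real.exp (L * T) * T ^ 2) := by
  have hT : 0 ≤ T := (abs_nonneg t).trans ht
  have hη0 : 0 ≤ η := (norm_nonneg _).trans (hη 0 (by simpa using hT))
  have hsub : ∀ s, |s| ≤ T → ∀ r ∈ Set.uIoc 0 s, |r| ≤ T := by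
    intro s hs r hr
    have := Set.abs_sub_left_of_mem_uIcc (Set.uIoc_subset_uIcc hr)
    simp only [sub_zero] at this
    exact this.trans hs
  have hE : ∀ s, |s| ≤ T → ‖drift U V γ s‖ ≤ η * T := by
    intro s hs
    have := intervalIntegral.norm_integral_le_of_norm_le_const (a := 0) (b := s) (C := η)
      (f := fun r => U (γ r) - V (γ r)) fun r hr => hη r (hsub s hs r hr)
    rw [sub_zero] at this
    exact this.trans (by gcongr)
  have h1 := norm_sub_le_drift hU hV hδ hγ hL hLip ht
  have h2 : |∫ r in (0 : ℝ)..t, ‖drift U V γ r‖| ≤ η * T * T := by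
    have := intervalIntegral.norm_integral_le_of_norm_le_const (a := 0) (b := t) (C := η * T)
      (f := fun r => ‖drift U V γ r‖) fun r hr => by
        rw [norm_norm]; exact hE r (hsub t ht r hr)
    rw [sub_zero] at this
    exact this.trans (by gcongr)
  calc _ ≤ η * T + L * Real.exp (L * T) * (η * T * T) := h1.trans (by gcongr; exact hE t ht)
    _ = _ := by ring

end Curves

/-! ### Iterated partial derivatives -/

/-- The iterated partial derivative of `g` along a list of coordinates. -/
def pd (l : List (Fin 2)) (g : Plane → ℝ) : Plane → ℝ := l.foldr partialDeriv g

@[simp] lemma pd_nil (g : Plane → ℝ) : pd [] g = g := rfl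

@[simp] lemma pd_cons (i : Fin 2) (l : List (Fin 2)) (g : Plane → ℝ) :
    pd (i :: l) g = partialDeriv i (pd l g) := rfl

lemma d2_eq_pd (g : Plane → ℝ) (x : Plane) :
    d2 g x = !₂[pd [0, 0] g x, pd [0, 1] g x, pd [1, 1] g x] := rfl

lemma plane_eq (v : Plane) :
    v = v 0 • EuclideanSpace.single 0 (1 : ℝ) + v 1 • EuclideanSpace.single 1 (1 : ℝ) := by
  ext i; fin_cases i <;> simp

lemma fderiv_apply_eq (φ : Plane → ℝ) (x v : Plane) :
    fderiv ℝ φ x v = v 0 * partialDeriv 0 φ x + v 1 * partialDeriv 1 φ x := by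
  conv_lhs => rw [plane_eq v]
  simp [partialDeriv]

lemma abs_coord_le {ι : Type*} [Fintype ι] (v : EuclideanSpace ℝ ι) (i : ι) : |v i| ≤ ‖v‖ := by
  simpa using PiLp.norm_apply_le v i

lemma norm_fderiv_le_of_partialDeriv {φ : Plane → ℝ} {x : Plane} {C : ℝ}
    (h : ∀ i, |partialDeriv i φ x| ≤ C) : ‖fderiv ℝ φ x‖ ≤ 2 * C := by
  have hC : 0 ≤ C := (abs_nonneg _).trans (h 0)
  refine ContinuousLinearMap.opNorm_le_bound _ (by positivity) fun v => ?_
  rw [fderiv_apply_eq, Real.norm_eq_abs]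
  have h0 := abs_coord_le v 0
  have h1 := abs_coord_le v 1
  calc _ ≤ |v 0| * |partialDeriv 0 φ x| + |v 1| * |partialDeriv 1 φ x| := by
        rw [← abs_mul, ← abs_mul]; exact abs_add_le _ _
    _ ≤ ‖v‖ * C + ‖v‖ * C := by gcongr <;> exact h _
    _ = _ := by ring

lemma partialDeriv_sub {φ ψ : Plane → ℝ} {x : Plane} (hφ : DifferentiableAt ℝ φ x)
    (hψ : DifferentiableAt ℝ ψ x) (i : Fin 2) :
    partialDeriv i (fun y => φ y - ψ y) x = partialDeriv i φ x - partialDeriv i ψ x := by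
  simp [partialDeriv, fderiv_fun_sub hφ hψ]

lemma contDiff_partialDeriv {m : ℕ} {g : Plane → ℝ} (hg : ContDiff ℝ (m + 1 : ℕ) g) (i : Fin 2) :
    ContDiff ℝ m (partialDeriv i g) := by
  have h : ContDiff ℝ m (fderiv ℝ g) := hg.fderiv_right (by norm_cast)
  exact h.clm_apply contDiff_const

lemma contDiff_pd {m : ℕ} (l : List (Fin 2)) {g : Plane → ℝ}
    (hg : ContDiff ℝ (m + l.length : ℕ) g) : ContDiff ℝ m (pd l g) := by
  induction l generalizing m with
  | nil => simpa using hg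
  | cons i l ih =>
    refine contDiff_partialDeriv (ih ?_) i
    convert hg using 2
    simp; ring

lemma pd_eq_iteratedFDeriv (l : List (Fin 2)) {g : Plane → ℝ}
    (hg : ∀ k < l.length, Differentiable ℝ (iteratedFDeriv ℝ k g)) (x : Plane) :
    pd l g x = iteratedFDeriv ℝ l.length g x
      fun j => EuclideanSpace.single (l.get j) (1 : ℝ) := by
  induction l generalizing x with
  | nil => simp
  | cons i l ih =>
    have h1 : pd l g = fun x => iteratedFDeriv ℝ l.length g x
        fun j => EuclideanSpace.single (l.get j) (1 : ℝ) :=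
      funext fun x => ih (fun k hk => hg k (by simp; omega)) x
    have h2 : DifferentiableAt ℝ (iteratedFDeriv ℝ l.length g) x := hg l.length (by simp) x
    rw [pd_cons, partialDeriv, h1]
    have h3 := (h2.hasFDerivAt.continuousMultilinear_apply_const
      (fun j => EuclideanSpace.single (l.get j) (1 : ℝ))).fderiv
    rw [h3]
    rfl

lemma differentiable_pd (l : List (Fin 2)) {g : Plane → ℝ}
    (hg : ∀ k ≤ l.length, Differentiable ℝ (iteratedFDeriv ℝ k g)) :
    Differentiable ℝ (pd l g) := by
  have h1 : pd l g = fun x => iteratedFDeriv ℝ l.length g x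
      fun j => EuclideanSpace.single (l.get j) (1 : ℝ) :=
    funext fun x => pd_eq_iteratedFDeriv l (fun k hk => hg k hk.le) x
  rw [h1]
  exact fun x => ((hg l.length le_rfl x).hasFDerivAt.continuousMultilinear_apply_const
    _).differentiableAt

lemma abs_pd_le (l : List (Fin 2)) {g : Plane → ℝ}
    (hg : ∀ k < l.length, Differentiable ℝ (iteratedFDeriv ℝ k g)) (x : Plane) :
    |pd l g x| ≤ ‖iteratedFDeriv ℝ l.length g x‖ := by
  rw [pd_eq_iteratedFDeriv l hg, ← Real.norm_eq_abs]
  refine (ContinuousMultilinearMap.le_opNorm _ _).trans ?_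
  simp

/-- Three times continuously differentiable functions with differentiable third order partial
derivatives, all of whose partial derivatives of orders one to four are bounded. -/
structure Regular (g : Plane → ℝ) : Prop where
  contDiff : ContDiff ℝ 3 g
  differentiable : ∀ l : List (Fin 2), l.length ≤ 3 → Differentiable ℝ (pd l g)
  bounded : ∃ C : ℝ, ∀ l : List (Fin 2), 1 ≤ l.length → l.length ≤ 4 → ∀ x, |pd l g x| ≤ C

lemma Regular.of_iteratedFDeriv {g : Plane → ℝ} (h3 : ContDiff ℝ 3 g)
    (hd : Differentiable ℝ (iteratedFDeriv ℝ 3 g)) (hb : BoundedDerivs g) : Regular g := by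
  have hk : ∀ k ≤ 3, Differentiable ℝ (iteratedFDeriv ℝ k g) := by
    intro k hk
    rcases hk.lt_or_eq with h | rfl
    · exact h3.differentiable_iteratedFDeriv (by exact_mod_cast h)
    · exact hd
  refine ⟨h3, fun l hl => differentiable_pd l fun k hk' => hk k (hk'.trans hl), ?_⟩
  choose! C hC using hb
  refine ⟨max (max (C 1) (C 2)) (max (C 3) (C 4)), fun l h1 h4 x => ?_⟩
  have h := (abs_pd_le l (fun k hk' => hk k (by omega)) x).trans
    (hC l.length (Finset.mem_Icc.2 ⟨h1, h4⟩) x)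
  refine h.trans ?_
  generalize l.length = m at h1 h4
  interval_cases m <;> simp

lemma FilamentModel.regular {f : Plane → ℝ} {H L : Set Plane} {a : ℝ}
    (hf : FilamentModel f H L a) : Regular f :=
  .of_iteratedFDeriv (hf.smooth.of_le (by norm_num))
    (hf.smooth.differentiable_iteratedFDeriv (by norm_num)) hf.boundedDerivs

lemma KernelAssumptions.regular {K : Plane → ℝ} (hK : KernelAssumptions K) : Regular K :=
  .of_iteratedFDeriv hK.contDiff hK.differentiable hK.boundedDerivs

/-! ### Lipschitz bounds for partial derivatives -/

section Regular

variable {g : Plane → ℝ}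

lemma Regular.continuous_pd (hg : Regular g) (l : List (Fin 2)) (hl : l.length ≤ 3) :
    Continuous (pd l g) := (hg.differentiable l hl).continuous

lemma Regular.lipschitz (hg : Regular g) : ∃ C : ℝ, 0 ≤ C ∧ ∀ l : List (Fin 2), l.length ≤ 3 →
    ∀ x y, |pd l g x - pd l g y| ≤ C * ‖x - y‖ := by
  obtain ⟨C, hC⟩ := hg.bounded
  have hC0 : 0 ≤ C := (abs_nonneg _).trans (hC [0] (by simp) (by simp) 0)
  refine ⟨2 * C, by positivity, fun l hl x y => ?_⟩
  exact Convex.norm_image_sub_le_of_norm_fderiv_le (f := pd l g) (s := Set.univ)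
    (fun z _ => hg.differentiable l hl z)
    (fun z _ => norm_fderiv_le_of_partialDeriv fun i => hC (i :: l) (by simp) (by simp; omega) z)
    convex_univ trivial trivial

end Regular

/-! ### Gradient and second derivatives in terms of partial derivatives -/

lemma norm_le_sum_abs {n : ℕ} (v : EuclideanSpace ℝ (Fin n)) : ‖v‖ ≤ ∑ i, |v i| := by
  rw [EuclideanSpace.norm_eq]
  refine Real.sqrt_le_iff.2 ⟨Finset.sum_nonneg fun _ _ => abs_nonneg _, ?_⟩
  simpa using Finset.sum_sq_le_sq_sum_of_nonneg (s := Finset.univ) (f := fun i => |v i|)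
    fun _ _ => abs_nonneg _

lemma gradient_apply (g : Plane → ℝ) (x : Plane) (i : Fin 2) :
    gradient g x i = partialDeriv i g x := by
  have : inner ℝ (gradient g x) (EuclideanSpace.single i (1 : ℝ)) = partialDeriv i g x := by
    simp [gradient, partialDeriv]
  rw [← this, EuclideanSpace.inner_single_right]; simp

lemma gradient_eq (g : Plane → ℝ) (x : Plane) :
    gradient g x = !₂[pd [0] g x, pd [1] g x] := by
  ext i; fin_cases i <;> simp [gradient_apply]

lemma inner_gradient (g : Plane → ℝ) (x v : Plane) :
    inner ℝ (gradient g x) v = fderiv ℝ g x v := by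
  simp [gradient]

lemma norm_gradient_sub_le {g f : Plane → ℝ} {x : Plane} {η : ℝ}
    (h : ∀ i, |pd [i] g x - pd [i] f x| ≤ η) : ‖gradient g x - gradient f x‖ ≤ 2 * η := by
  refine (norm_le_sum_abs _).trans ?_
  rw [Fin.sum_univ_two, gradient_eq, gradient_eq]
  have h0 := h 0
  have h1 := h 1
  simp at h0 h1 ⊢
  linarith

lemma norm_d2_sub_le {g f : Plane → ℝ} {x : Plane} {η : ℝ}
    (h : ∀ i j, |pd [i, j] g x - pd [i, j] f x| ≤ η) : ‖d2 g x - d2 f x‖ ≤ 3 * η := by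
  refine (norm_le_sum_abs _).trans ?_
  rw [Fin.sum_univ_three, d2_eq_pd, d2_eq_pd]
  have h0 := h 0 0
  have h1 := h 0 1
  have h2 := h 1 1
  simp at h0 h1 h2 ⊢
  linarith

/-- The index lists of the coordinates of `d2`. -/
def d2Index : Fin 3 → List (Fin 2) := ![[0, 0], [0, 1], [1, 1]]

lemma length_d2Index (i : Fin 3) : (d2Index i).length = 2 := by
  fin_cases i <;> rfl

lemma d2_apply (g : Plane → ℝ) (x : Plane) (i : Fin 3) : d2 g x i = pd (d2Index i) g x := by
  fin_cases i <;> rfl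

lemma hasFDerivAt_d2 {g : Plane → ℝ} (hg : Regular g) (x : Plane) :
    HasFDerivAt (d2 g) (fderiv ℝ (d2 g) x) x := by
  refine DifferentiableAt.hasFDerivAt ?_
  rw [differentiableAt_piLp]
  intro i
  simp only [d2_apply]
  exact hg.differentiable _ (by simp [length_d2Index]) x

lemma fderiv_d2_apply {g : Plane → ℝ} (hg : Regular g) (x v : Plane) (i : Fin 3) :
    fderiv ℝ (d2 g) x v i = fderiv ℝ (pd (d2Index i) g) x v := by
  have h := (EuclideanSpace.proj (𝕜 := ℝ) i).hasFDerivAt.comp x (hasFDerivAt_d2 hg x)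
  have h2 : HasFDerivAt (pd (d2Index i) g) ((EuclideanSpace.proj (𝕜 := ℝ) i).comp
      (fderiv ℝ (d2 g) x)) x := by
    refine h.congr_of_eventuallyEq (Eventually.of_forall fun y => ?_)
    simp [d2_apply]
  rw [h2.fderiv]; simp

lemma norm_fderiv_d2_sub_le {g f : Plane → ℝ} (hg : Regular g) (hf : Regular f) {x : Plane} {η : ℝ}
    (h : ∀ i j k, |pd [i, j, k] g x - pd [i, j, k] f x| ≤ η) :
    ‖fderiv ℝ (d2 g) x - fderiv ℝ (d2 f) x‖ ≤ 6 * η := by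
  have hη : 0 ≤ η := (abs_nonneg _).trans (h 0 0 0)
  refine ContinuousLinearMap.opNorm_le_bound _ (by positivity) fun v => ?_
  refine (norm_le_sum_abs _).trans ?_
  have key : ∀ i, |(fderiv ℝ (d2 g) x - fderiv ℝ (d2 f) x) v i| ≤ 2 * η * ‖v‖ := by
    intro i
    have e : (fderiv ℝ (d2 g) x - fderiv ℝ (d2 f) x) v i =
        fderiv ℝ (fun y => pd (d2Index i) g y - pd (d2Index i) f y) x v := by
      have hl : (d2Index i).length ≤ 3 := by simp [length_d2Index]
      rw [fderiv_fun_sub (hg.differentiable _ hl x) (hf.differentiable _ hl x)]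
      simp [fderiv_d2_apply hg, fderiv_d2_apply hf]
    rw [e]
    rw [← Real.norm_eq_abs]
    refine (ContinuousLinearMap.le_opNorm _ v).trans ?_
    gcongr
    refine norm_fderiv_le_of_partialDeriv fun k => ?_
    have hl : (d2Index i).length ≤ 3 := by simp [length_d2Index]
    rw [partialDeriv_sub (hg.differentiable _ hl x) (hf.differentiable _ hl x)]
    fin_cases i <;> exact h _ _ _
  rw [Fin.sum_univ_three]
  linarith [key 0, key 1, key 2]

lemma Regular.d2_bounds {g : Plane → ℝ} (hg : Regular g) :
    ∃ C : ℝ, 0 ≤ C ∧ (∀ x, ‖d2 g x‖ ≤ C) ∧ ∀ x y, ‖d2 g x - d2 g y‖ ≤ C * ‖x - y‖ := by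
  obtain ⟨C, hC⟩ := hg.bounded
  obtain ⟨C', hC0', hC'⟩ := hg.lipschitz
  have hC0 : 0 ≤ C := (abs_nonneg _).trans (hC [0] (by simp) (by simp) 0)
  refine ⟨3 * (C + C'), by positivity, fun x => ?_, fun x y => ?_⟩
  · refine (norm_le_sum_abs _).trans ?_
    rw [Fin.sum_univ_three]
    simp only [d2_apply]
    have := fun i : Fin 3 => hC (d2Index i) (by simp [length_d2Index]) (by simp [length_d2Index]) x
    linarith [this 0, this 1, this 2]
  · refine (norm_le_sum_abs _).trans ?_
    rw [Fin.sum_univ_three]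
    simp only [PiLp.sub_apply, d2_apply]
    have := fun i : Fin 3 => hC' (d2Index i) (by simp [length_d2Index]) x y
    nlinarith [this 0, this 1, this 2, norm_nonneg (x - y)]

lemma Regular.continuous_d2 {g : Plane → ℝ} (hg : Regular g) : Continuous (d2 g) :=
  continuous_iff_continuousAt.2 fun x => (hasFDerivAt_d2 hg x).continuousAt

lemma Regular.eigVec_bounds {g : Plane → ℝ} (hg : Regular g) :
    ∃ C : ℝ, 0 ≤ C ∧ (∀ x, ‖eigVec g x‖ ≤ C) ∧
      ∀ x y, ‖eigVec g x - eigVec g y‖ ≤ C * ‖x - y‖ := by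
  obtain ⟨C, hC, h1, h2⟩ := hg.d2_bounds
  refine ⟨eigVecLip * C, mul_nonneg eigVecLip_nonneg hC, fun x => ?_, fun x y => ?_⟩
  · exact (norm_eigVecMap_le _).trans (mul_le_mul_of_nonneg_left (h1 x) eigVecLip_nonneg)
  · refine (norm_eigVecMap_sub_le _ _).trans ?_
    rw [mul_assoc]
    exact mul_le_mul_of_nonneg_left (h2 x y) eigVecLip_nonneg

lemma Regular.continuous_eigVec {g : Plane → ℝ} (hg : Regular g) : Continuous (eigVec g) :=
  continuous_eigVecMap.comp hg.continuous_d2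

lemma Regular.lipschitzWith_eigVec {g : Plane → ℝ} (hg : Regular g) :
    ∃ C : NNReal, LipschitzWith C (eigVec g) := by
  obtain ⟨C, hC, -, h⟩ := hg.eigVec_bounds
  exact ⟨⟨C, hC⟩, LipschitzWith.of_dist_le_mul fun x y => by
    rw [dist_eq_norm, dist_eq_norm]; exact h x y⟩

/-- For a regular function the default value in `curve` is never used. This covers the density and
every realization of the estimator. -/
lemma Regular.isCurveFrom {g : Plane → ℝ} (hg : Regular g) (x₀ : Plane) :
    IsCurveFrom (eigVec g) x₀ (curve g x₀) := by
  obtain ⟨C, -, hM, -⟩ := hg.eigVec_bounds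
  obtain ⟨K, hK⟩ := hg.lipschitzWith_eigVec
  have h := exists_isCurveFrom hK hM x₀
  rw [curve, dif_pos h]
  exact h.choose_spec

/-! ### The kernel density estimator -/

lemma partialDeriv_sum {φ : Plane → ℝ} (hφ : Differentiable ℝ φ) (c a : ℝ) (n : ℕ) (y : ℕ → Plane)
    (i : Fin 2) :
    partialDeriv i (fun x => c * ∑ j ∈ Finset.range n, φ (a • (x - y j))) =
      fun x => c * a * ∑ j ∈ Finset.range n, partialDeriv i φ (a • (x - y j)) := by
  funext x
  have h1 : ∀ j, HasFDerivAt (fun x => φ (a • (x - y j)))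
      (a • fderiv ℝ φ (a • (x - y j))) x := by
    intro j
    have h2 : HasFDerivAt (fun x => a • (x - y j)) (a • ContinuousLinearMap.id ℝ Plane) x :=
      ((hasFDerivAt_id x).sub_const (y j)).const_smul a
    refine ((hφ _).hasFDerivAt.comp x h2).congr_fderiv ?_
    ext v; simp
  have h3 : HasFDerivAt (fun x => c * ∑ j ∈ Finset.range n, φ (a • (x - y j)))
      (c • ∑ j ∈ Finset.range n, a • fderiv ℝ φ (a • (x - y j))) x :=
    (HasFDerivAt.fun_sum fun j _ => h1 j).const_mul c
  rw [partialDeriv, h3.fderiv]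
  simp [partialDeriv, Finset.mul_sum, mul_assoc]

variable {K : Plane → ℝ}

lemma pd_kde (hK : Regular K) (b : ℝ) (n : ℕ) (X : ℕ → Plane) (l : List (Fin 2))
    (hl : l.length ≤ 4) :
    pd l (kde K b n X) = fun x => 1 / ((n : ℝ) * b ^ 2) * b⁻¹ ^ l.length *
      ∑ i ∈ Finset.range n, pd l K (b⁻¹ • (x - X i)) := by
  induction l with
  | nil => simp [kde, funext_iff]
  | cons i l ih =>
    have hl' : l.length ≤ 3 := by simp at hl; omega
    rw [pd_cons, ih (by omega), partialDeriv_sum (hK.differentiable l hl')]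
    funext x
    rw [List.length_cons, pow_succ b⁻¹, pd_cons, ← mul_assoc]

lemma Regular.kde (hK : Regular K) (b : ℝ) (n : ℕ) (X : ℕ → Plane) : Regular (kde K b n X) := by
  refine ⟨?_, fun l hl => ?_, ?_⟩
  · have : ContDiff ℝ 3 fun x => ∑ i ∈ Finset.range n, K (b⁻¹ • (x - X i)) :=
      ContDiff.sum fun i _ => hK.contDiff.comp (by fun_prop)
    exact contDiff_const.mul this
  · rw [pd_kde hK b n X l (by omega)]
    have := hK.differentiable l hl
    have h2 : ∀ i, Differentiable ℝ fun x => pd l K (b⁻¹ • (x - X i)) :=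
      fun i => this.comp (by fun_prop)
    exact (Differentiable.fun_sum fun i _ => h2 i).const_mul _
  · obtain ⟨C, hC⟩ := hK.bounded
    have hC0 : 0 ≤ C := (abs_nonneg _).trans (hC [0] (by simp) (by simp) 0)
    refine ⟨|1 / ((n : ℝ) * b ^ 2)| * (max 1 |b⁻¹|) ^ 4 * (n * C), fun l h1 h4 x => ?_⟩
    rw [pd_kde hK b n X l h4, abs_mul, abs_mul, abs_pow]
    have e1 : |∑ i ∈ Finset.range n, pd l K (b⁻¹ • (x - X i))| ≤ n * C := by
      refine (Finset.abs_sum_le_sum_abs _ _).trans ?_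
      refine (Finset.sum_le_sum fun i _ => hC l h1 h4 _).trans ?_
      simp
    have e2 : |b⁻¹| ^ l.length ≤ (max 1 |b⁻¹|) ^ 4 := by
      refine (pow_le_pow_left₀ (abs_nonneg _) (le_max_right 1 _) _).trans ?_
      exact pow_le_pow_right₀ (le_max_left _ _) h4
    gcongr

/-- A Lipschitz constant for the dependence of the second derivatives of the estimator on the
observations and on the point. -/
lemma exists_d2_kde_lipschitz (hK : Regular K) (b : ℝ) (n : ℕ) : ∃ C : ℝ, 0 ≤ C ∧
    (∀ X Y : ℕ → Plane, ∀ x, ‖d2 (kde K b n X) x - d2 (kde K b n Y) x‖ ≤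
      C * ∑ i ∈ Finset.range n, ‖X i - Y i‖) ∧
    ∀ X : ℕ → Plane, ∀ x y, ‖d2 (kde K b n X) x - d2 (kde K b n X) y‖ ≤ C * ‖x - y‖ := by
  obtain ⟨C, hC0, hC⟩ := hK.lipschitz
  set A : ℝ := |1 / ((n : ℝ) * b ^ 2) * b⁻¹ ^ 2| * (C * |b⁻¹|)
  have hA : 0 ≤ A := by positivity
  have key : ∀ X Y : ℕ → Plane, ∀ x y, ∀ k : Fin 3,
      |(d2 (kde K b n X) x - d2 (kde K b n Y) y) k| ≤
        A * ∑ i ∈ Finset.range n, ‖(x - y) - (X i - Y i)‖ := by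
    intro X Y x y k
    have hl : (d2Index k).length ≤ 4 := by simp [length_d2Index]
    rw [PiLp.sub_apply, d2_apply, d2_apply, pd_kde hK b n X _ hl, pd_kde hK b n Y _ hl,
      length_d2Index, ← mul_sub, abs_mul, ← Finset.sum_sub_distrib]
    simp only [A]
    rw [mul_assoc]
    refine mul_le_mul_of_nonneg_left ?_ (abs_nonneg _)
    rw [Finset.mul_sum]
    refine (Finset.abs_sum_le_sum_abs _ _).trans (Finset.sum_le_sum fun i _ => ?_)
    refine (hC _ (by simp [length_d2Index]) _ _).trans (le_of_eq ?_)
    rw [← smul_sub, norm_smul, Real.norm_eq_abs, mul_assoc]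
    congr 3
    abel
  refine ⟨3 * A * (n + 1), by positivity, fun X Y x => ?_, fun X x y => ?_⟩
  · have h := key X Y x x
    simp only [sub_self, zero_sub, norm_neg] at h
    refine (norm_le_sum_abs _).trans ?_
    rw [Fin.sum_univ_three]
    have hS : 0 ≤ ∑ i ∈ Finset.range n, ‖X i - Y i‖ := Finset.sum_nonneg fun _ _ => norm_nonneg _
    have hn : (0 : ℝ) ≤ n := n.cast_nonneg
    have h3 : A * ∑ i ∈ Finset.range n, ‖X i - Y i‖ ≤
      A * (n + 1) * ∑ i ∈ Finset.range n, ‖X i - Y i‖ := by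
      refine mul_le_mul_of_nonneg_right ?_ hS
      nlinarith
    linarith [h 0, h 1, h 2]
  · have h := key X X x y
    simp only [sub_self, sub_zero, Finset.sum_const, Finset.card_range, nsmul_eq_mul] at h
    refine (norm_le_sum_abs _).trans ?_
    rw [Fin.sum_univ_three]
    have : 0 ≤ A * ‖x - y‖ := by positivity
    nlinarith [h 0, h 1, h 2]

/-- The estimated curve depends continuously on the observations and on time. -/
lemma continuous_curve_kde (hK : Regular K) (b : ℝ) (n : ℕ) (x₀ : Plane) :
    Continuous fun p : (ℕ → Plane) × ℝ => curve (kde K b n p.1) x₀ p.2 := by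
  obtain ⟨C, hC0, hC1, hC2⟩ := exists_d2_kde_lipschitz hK b n
  refine continuous_iff_continuousAt.2 fun ⟨Y, s⟩ => ?_
  set T := |s| + 1
  set L := eigVecLip * C
  have hL : 0 ≤ L := mul_nonneg eigVecLip_nonneg hC0
  have hcurve : ∀ X, IsCurveFrom (eigVec (kde K b n X)) x₀ (curve (kde K b n X) x₀) :=
    fun X => (hK.kde b n X).isCurveFrom x₀
  -- The fields of two samples differ uniformly by a multiple of the distance of their first n
  -- observations, so Grönwall gives a Lipschitz bound in the sample, uniform for times up to T.
  have bound : ∀ X t, |t| ≤ T → ‖curve (kde K b n X) x₀ t - curve (kde K b n Y) x₀ t‖ ≤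
      (L * ∑ i ∈ Finset.range n, ‖X i - Y i‖) * (T + L * Real.exp (L * T) * T ^ 2) := by
    intro X t ht
    refine norm_sub_le_of_field_close (hK.kde b n X).continuous_eigVec
      (hK.kde b n Y).continuous_eigVec (hcurve X) (hcurve Y) hL ?_ ?_ ht
    · intro r _
      refine (norm_eigVecMap_sub_le _ _).trans ?_
      rw [mul_assoc]
      exact mul_le_mul_of_nonneg_left (hC2 X _ _) eigVecLip_nonneg
    · intro r _
      refine (norm_eigVecMap_sub_le _ _).trans ?_
      rw [mul_assoc]
      exact mul_le_mul_of_nonneg_left (hC1 X Y _) eigVecLip_nonneg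
  rw [ContinuousAt, tendsto_iff_norm_sub_tendsto_zero]
  have lim : Tendsto (fun p : (ℕ → Plane) × ℝ =>
      (L * ∑ i ∈ Finset.range n, ‖p.1 i - Y i‖) * (T + L * Real.exp (L * T) * T ^ 2) +
        ‖curve (kde K b n Y) x₀ p.2 - curve (kde K b n Y) x₀ s‖) (𝓝 (Y, s)) (𝓝 0) := by
    have hc := (hcurve Y).continuous
    have : Continuous fun p : (ℕ → Plane) × ℝ =>
      (L * ∑ i ∈ Finset.range n, ‖p.1 i - Y i‖) * (T + L * Real.exp (L * T) * T ^ 2) +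
        ‖curve (kde K b n Y) x₀ p.2 - curve (kde K b n Y) x₀ s‖ := by fun_prop
    simpa using this.tendsto (Y, s)
  refine squeeze_zero' (Eventually.of_forall fun _ => norm_nonneg _) ?_ lim
  have hev : ∀ᶠ p : (ℕ → Plane) × ℝ in 𝓝 (Y, s), |p.2| < T := by
    have : Continuous fun p : (ℕ → Plane) × ℝ => |p.2| := by fun_prop
    exact this.continuousAt.eventually_lt continuousAt_const (by simp [T])
  filter_upwards [hev] with p hp
  have e : curve (kde K b n p.1) x₀ p.2 - curve (kde K b n Y) x₀ s =
      (curve (kde K b n p.1) x₀ p.2 - curve (kde K b n Y) x₀ p.2) +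
      (curve (kde K b n Y) x₀ p.2 - curve (kde K b n Y) x₀ s) := by abel
  rw [e]
  exact (norm_add_le _ _).trans (add_le_add_left (bound p.1 p.2 hp.le) _)

lemma aemeasurable_comp_sample {Ω : Type*} [MeasurableSpace Ω] {P : Measure Ω}
    {F : (ℕ → Plane) × ℝ → Plane} (hF : Measurable F) {X : ℕ → Ω → Plane}
    (hX : ∀ i, AEMeasurable (X i) P) {θ : Ω → ℝ} (hθ : AEMeasurable θ P) :
    AEMeasurable (fun ω => F ((fun i => X i ω), θ ω)) P :=
  hF.comp_aemeasurable ((aemeasurable_pi_lambda (fun ω i => X i ω) hX).prodMk hθ)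

/-- The curve is defined by choice, so measurability of the estimated point is obtained from its
joint continuity in the sample and in time. -/
lemma aemeasurable_curve_kde {Ω : Type*} [MeasurableSpace Ω] {P : Measure Ω} (hK : Regular K)
    (b : ℝ) (n : ℕ) (x₀ : Plane) {X : ℕ → Ω → Plane} (hX : ∀ i, AEMeasurable (X i) P)
    {θ : Ω → ℝ} (hθ : AEMeasurable θ P) :
    AEMeasurable (fun ω => curve (kde K b n fun i => X i ω) x₀ (θ ω)) P :=
  aemeasurable_comp_sample (F := fun p => curve (kde K b n p.1) x₀ p.2)
    (continuous_curve_kde hK b n x₀).measurable hX hθ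

/-! ### The derivative of the slope along an integral curve -/

lemma hasFDerivAt_eigVec {g : Plane → ℝ} (hg : Regular g) {x : Plane} (hx : gapMap (d2 g x) ≠ 0) :
    HasFDerivAt (eigVec g) (eigVecDeriv (d2 g x) ∘L fderiv ℝ (d2 g) x) x :=
  (hasFDerivAt_eigVecMap hx).comp x (hasFDerivAt_d2 hg x)

lemma pd_comm {g : Plane → ℝ} (hg : ContDiff ℝ 2 g) (x : Plane) : pd [1, 0] g x = pd [0, 1] g x := by
  have hd : ∀ y, DifferentiableAt ℝ (fderiv ℝ g) y := fun y =>
    (hg.fderiv_right (m := 1) (by norm_num)).differentiable (by norm_num) y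
  have e : ∀ i j : Fin 2, pd [i, j] g x =
      fderiv ℝ (fderiv ℝ g) x (EuclideanSpace.single i 1) (EuclideanSpace.single j 1) := by
    intro i j
    have h : HasFDerivAt (partialDeriv j g)
        ((fderiv ℝ (fderiv ℝ g) x).flip (EuclideanSpace.single j 1)) x := by
      have := (hd x).hasFDerivAt.clm_apply (hasFDerivAt_const (EuclideanSpace.single j (1 : ℝ)) x)
      refine this.congr_fderiv ?_
      ext v; simp
    rw [pd_cons, pd_cons, pd_nil, partialDeriv, h.fderiv]
    rfl
  rw [e, e]
  exact second_derivative_symmetric (f := g) (f' := fderiv ℝ g) (x := x)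
    (fun y => (hg.differentiable (by norm_num) y).hasFDerivAt) (hd x).hasFDerivAt _ _

/-- The derivative is the Hessian applied to the velocity, and the velocity is an eigenvector. This
is the source of the term λ₂‖V‖² in ã'. -/
lemma hasDerivAt_gradient_comp {g : Plane → ℝ} (hg : Regular g) {γ : ℝ → Plane} {t : ℝ}
    (hγ : HasDerivAt γ (eigVec g (γ t)) t) :
    HasDerivAt (fun s => gradient g (γ s)) (eigVal g (γ t) • eigVec g (γ t)) t := by
  rw [hasDerivAt_iff_hasFDerivAt, ← hasFDerivWithinAt_univ, hasFDerivWithinAt_euclidean]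
  intro i
  have h1 : HasDerivAt (fun s => pd [i] g (γ s))
      (fderiv ℝ (pd [i] g) (γ t) (eigVec g (γ t))) t :=
    (hg.differentiable [i] (by simp) (γ t)).hasFDerivAt.comp_hasDerivAt t hγ
  have h2 : (fun s => gradient g (γ s) i) = fun s => pd [i] g (γ s) :=
    funext fun s => gradient_apply g _ i
  have h3 : fderiv ℝ (pd [i] g) (γ t) (eigVec g (γ t)) =
      (eigVal g (γ t) • eigVec g (γ t)) i := ?_
  · rw [h2]
    refine (h1.congr_deriv h3).hasFDerivAt.hasFDerivWithinAt.congr_fderiv ?_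
    ext; simp
  have hE := eigVecMap_eigen (d2 g (γ t))
  have hc := pd_comm (hg.contDiff.of_le (by norm_num)) (γ t)
  rw [fderiv_apply_eq]
  have e00 : d2 g (γ t) 0 = partialDeriv 0 (pd [0] g) (γ t) := rfl
  have e01 : d2 g (γ t) 1 = partialDeriv 0 (pd [1] g) (γ t) := rfl
  have e10 : d2 g (γ t) 1 = partialDeriv 1 (pd [0] g) (γ t) := by rw [e01]; exact hc.symm
  have e11 : d2 g (γ t) 2 = partialDeriv 1 (pd [1] g) (γ t) := rfl
  simp only [PiLp.smul_apply, smul_eq_mul, eigVec, eigVal]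
  fin_cases i
  · simp only [Fin.zero_eta]
    rw [← e00, ← e10, ← hE.1]; ring
  · simp only [Fin.mk_one]
    rw [← e01, ← e11, ← hE.2]; ring

lemma hasDerivAt_slope_comp {g : Plane → ℝ} (hg : Regular g) {γ : ℝ → Plane} {t : ℝ}
    (hγ : HasDerivAt γ (eigVec g (γ t)) t) (hx : gapMap (d2 g (γ t)) ≠ 0) :
    HasDerivAt (fun s => slope g (γ s)) (slopeDeriv g (γ t)) t := by
  have h1 := hasDerivAt_gradient_comp hg hγ
  have hV := hasFDerivAt_eigVec hg hx
  have h2 : HasDerivAt (fun s => eigVec g (γ s)) (fderiv ℝ (eigVec g) (γ t) (eigVec g (γ t))) t := by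
    rw [hV.fderiv]; exact hV.comp_hasDerivAt t hγ
  refine (h1.inner ℝ h2).congr_deriv ?_
  rw [slopeDeriv, real_inner_smul_left, real_inner_self_eq_norm_sq]

/-- This form exhibits ã' as an explicit function of the gradient, the second derivatives and the
third derivatives. Hence C³-closeness controls it. -/
lemma slopeDeriv_eq {g : Plane → ℝ} (hg : Regular g) {x : Plane} (hx : gapMap (d2 g x) ≠ 0) :
    slopeDeriv g x = inner ℝ (gradient g x)
      (eigVecDeriv (d2 g x) (fderiv ℝ (d2 g) x (eigVecMap (d2 g x)))) +
        eigValMap (d2 g x) * ‖eigVecMap (d2 g x)‖ ^ 2 := by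
  rw [slopeDeriv, (hasFDerivAt_eigVec hg hx).fderiv]
  rfl

lemma eigVec_ne_zero_of_slopeDeriv {g : Plane → ℝ} {x : Plane} (h : slopeDeriv g x ≠ 0) :
    eigVec g x ≠ 0 := by
  intro h0
  simp [slopeDeriv, h0] at h

/-- If the slope is differentiable at x, both quantities are its derivative along the curve from x.
If it is not, its gradient is zero by convention and the hypothesis fails. -/
lemma slopeDeriv_ne_zero_of_transversal {g : Plane → ℝ} (hg : Regular g) {x : Plane}
    (h : inner ℝ (gradient (slope g) x) (eigVec g x) ≠ 0) : slopeDeriv g x ≠ 0 := by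
  rw [inner_gradient] at h
  have hV : eigVec g x ≠ 0 := by rintro h0; simp [h0] at h
  have hd : DifferentiableAt ℝ (slope g) x := by
    by_contra hd
    simp [fderiv_zero_of_not_differentiableAt hd] at h
  have hc := hg.isCurveFrom x
  have h1 := hasDerivAt_slope_comp hg (hc.2 0)
    (gapMap_ne_zero_of_eigVecMap_ne_zero (by rw [hc.1]; exact hV))
  have hd' : HasFDerivAt (slope g) (fderiv ℝ (slope g) x) (curve g x 0) := by
    rw [hc.1]; exact hd.hasFDerivAt
  have h2 := hd'.comp_hasDerivAt 0 (hc.2 0)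
  have := h1.unique h2
  rw [hc.1] at this
  rwa [this]

/-- Along the curve of a regular function the field does not vanish unless it vanishes everywhere
on the curve. -/
lemma eigVec_curve_ne_zero {g : Plane → ℝ} (hg : Regular g) {x₀ : Plane} {s : ℝ}
    (hs : eigVec g (curve g x₀ s) ≠ 0) (t : ℝ) : eigVec g (curve g x₀ t) ≠ 0 := by
  intro h0
  obtain ⟨K, hK⟩ := hg.lipschitzWith_eigVec
  have hc := hg.isCurveFrom x₀
  -- A zero of the field is an equilibrium, so by uniqueness the whole curve would be constant.
  have h : curve g x₀ = fun _ => curve g x₀ t :=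
    ODE_solution_unique_univ (v := fun _ => eigVec g) (s := fun _ => Set.univ) (t₀ := t)
      (fun _ => hK.lipschitzOnWith) (fun r => ⟨hc.2 r, trivial⟩)
      (fun r => ⟨by simpa [h0] using hasDerivAt_const r (curve g x₀ t), trivial⟩) rfl
  exact hs (by rw [h]; exact h0)

/-! ### Closeness of functions in `C³` -/

/-- The partial derivatives of `f` and `g` of orders one to three differ by at most `η` at `x`. -/
def CloseAt (f g : Plane → ℝ) (η : ℝ) (x : Plane) : Prop :=
  ∀ l : List (Fin 2), 1 ≤ l.length → l.length ≤ 3 → |pd l g x - pd l f x| ≤ η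

lemma CloseAt.mono {f g : Plane → ℝ} {η η' : ℝ} {x : Plane} (h : CloseAt f g η x) (hη : η ≤ η') :
    CloseAt f g η' x := fun l h1 h3 => (h l h1 h3).trans hη

lemma CloseAt.nonneg {f g : Plane → ℝ} {η : ℝ} {x : Plane} (h : CloseAt f g η x) : 0 ≤ η :=
  (abs_nonneg _).trans (h [0] (by simp) (by simp))

lemma CloseAt.gradient {f g : Plane → ℝ} {η : ℝ} {x : Plane} (h : CloseAt f g η x) :
    ‖gradient g x - gradient f x‖ ≤ 2 * η :=
  norm_gradient_sub_le fun _ => h _ (by simp) (by simp)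

lemma CloseAt.d2 {f g : Plane → ℝ} {η : ℝ} {x : Plane} (h : CloseAt f g η x) :
    ‖d2 g x - d2 f x‖ ≤ 3 * η :=
  norm_d2_sub_le fun _ _ => h _ (by simp) (by simp)

lemma CloseAt.fderiv_d2 {f g : Plane → ℝ} (hg : Regular g) (hf : Regular f) {η : ℝ} {x : Plane}
    (h : CloseAt f g η x) : ‖fderiv ℝ (Ridge.d2 g) x - fderiv ℝ (Ridge.d2 f) x‖ ≤ 6 * η :=
  norm_fderiv_d2_sub_le hg hf fun _ _ _ => h _ (by simp) (by simp)

lemma Regular.continuous_fderiv_d2 {f : Plane → ℝ} (hf : Regular f) :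
    Continuous (fderiv ℝ (d2 f)) := by
  have : ContDiff ℝ 1 (d2 f) := by
    rw [contDiff_euclidean]
    intro i
    simp only [d2_apply]
    have h : ContDiff ℝ ((1 : ℕ) + (d2Index i).length : ℕ) f := by
      rw [length_d2Index]; exact hf.contDiff
    exact_mod_cast contDiff_pd _ h
  exact this.continuous_fderiv one_ne_zero

lemma Regular.continuous_gradient {f : Plane → ℝ} (hf : Regular f) : Continuous (gradient f) := by
  have : gradient f = fun x => (!₂[pd [0] f x, pd [1] f x] : Plane) := funext (gradient_eq f)
  rw [this]
  have h0 := hf.continuous_pd [0] (by simp)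
  have h1 := hf.continuous_pd [1] (by simp)
  fun_prop

/-- Near a point where the Hessian has distinct eigenvalues, the relevant functionals of a function
that is close to `f` in `C³` are close to those of `f`. -/
lemma exists_close_nhds {f : Plane → ℝ} (hf : Regular f) {z : Plane} (hz : gapMap (d2 f z) ≠ 0)
    (hneg : eigVal f z < 0) {ε : ℝ} (hε : 0 < ε) :
    ∃ ρ > 0, ∃ η > 0, ∀ g, Regular g → ∀ x, ‖x - z‖ < ρ → CloseAt f g η x →
      gapMap (d2 g x) ≠ 0 ∧ |slopeDeriv g x - slopeDeriv f z| ≤ ε ∧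
        ‖eigVec g x - eigVec f z‖ ≤ ε ∧ eigVal g x < 0 := by
  -- All four conclusions are statements about the jet of `g` at x, a point of a finite dimensional
  -- space. Continuity at the single jet of `f` at z then gives constants that serve all `g` at
  -- once.
  let jet : (Plane → ℝ) → Plane →
      Plane × EuclideanSpace ℝ (Fin 3) × (Plane →L[ℝ] EuclideanSpace ℝ (Fin 3)) := fun g x => (gradient g x, d2 g x, fderiv ℝ (d2 g) x)
  let σ : Plane × EuclideanSpace ℝ (Fin 3) × (Plane →L[ℝ] EuclideanSpace ℝ (Fin 3)) → ℝ := fun j => inner ℝ j.1 (eigVecDeriv j.2.1 (j.2.2 (eigVecMap j.2.1))) +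
    eigValMap j.2.1 * ‖eigVecMap j.2.1‖ ^ 2
  have hσ : ContinuousAt σ (jet f z) := by
    have h1 : ContinuousAt (fun j : Plane × EuclideanSpace ℝ (Fin 3) × (Plane →L[ℝ] EuclideanSpace ℝ (Fin 3)) => eigVecDeriv j.2.1) (jet f z) :=
      ContinuousAt.comp (f := fun j : Plane × EuclideanSpace ℝ (Fin 3) × (Plane →L[ℝ] EuclideanSpace ℝ (Fin 3)) => j.2.1) (g := eigVecDeriv) (continuousAt_eigVecDeriv hz)
        (by fun_prop)
    have h2 : ContinuousAt (fun j : Plane × EuclideanSpace ℝ (Fin 3) × (Plane →L[ℝ] EuclideanSpace ℝ (Fin 3)) => eigVecMap j.2.1) (jet f z) :=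
      (continuous_eigVecMap.comp (by fun_prop : Continuous fun j : Plane × EuclideanSpace ℝ (Fin 3) × (Plane →L[ℝ] EuclideanSpace ℝ (Fin 3)) => j.2.1)).continuousAt
    have h3 : ContinuousAt (fun j : Plane × EuclideanSpace ℝ (Fin 3) × (Plane →L[ℝ] EuclideanSpace ℝ (Fin 3)) => eigValMap j.2.1) (jet f z) :=
      (continuous_eigValMap.comp (by fun_prop : Continuous fun j : Plane × EuclideanSpace ℝ (Fin 3) × (Plane →L[ℝ] EuclideanSpace ℝ (Fin 3)) => j.2.1)).continuousAt
    have h4 : ContinuousAt (fun j : Plane × EuclideanSpace ℝ (Fin 3) × (Plane →L[ℝ] EuclideanSpace ℝ (Fin 3)) => j.2.2) (jet f z) := by fun_prop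
    have h5 : ContinuousAt (fun j : Plane × EuclideanSpace ℝ (Fin 3) × (Plane →L[ℝ] EuclideanSpace ℝ (Fin 3)) => j.1) (jet f z) := by fun_prop
    exact (ContinuousAt.inner (𝕜 := ℝ) h5 (h1.clm_apply (h4.clm_apply h2))).add (h3.mul (h2.norm.pow 2))
  have hgap : ∀ᶠ j in 𝓝 (jet f z), gapMap j.2.1 ≠ 0 := by
    have : Continuous fun j : Plane × EuclideanSpace ℝ (Fin 3) × (Plane →L[ℝ] EuclideanSpace ℝ (Fin 3)) => gapMap j.2.1 := by fun_prop
    exact this.continuousAt.eventually_ne hz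
  have hval : ∀ᶠ j in 𝓝 (jet f z), eigValMap j.2.1 < 0 :=
    (continuous_eigValMap.comp (by fun_prop : Continuous fun j : Plane × EuclideanSpace ℝ (Fin 3) × (Plane →L[ℝ] EuclideanSpace ℝ (Fin 3)) => j.2.1)).continuousAt.eventually_lt
      continuousAt_const hneg
  have hvec : ∀ᶠ j in 𝓝 (jet f z), ‖eigVecMap j.2.1 - eigVecMap (d2 f z)‖ < ε := by
    have : Continuous fun j : Plane × EuclideanSpace ℝ (Fin 3) × (Plane →L[ℝ] EuclideanSpace ℝ (Fin 3)) => ‖eigVecMap j.2.1 - eigVecMap (d2 f z)‖ :=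
      ((continuous_eigVecMap.comp (by fun_prop)).sub continuous_const).norm
    exact this.continuousAt.eventually_lt continuousAt_const (by simpa [jet] using hε)
  have hsd : ∀ᶠ j in 𝓝 (jet f z), |σ j - σ (jet f z)| < ε := by
    have : ContinuousAt (fun j => |σ j - σ (jet f z)|) (jet f z) :=
      (hσ.sub continuousAt_const).abs
    exact this.eventually_lt continuousAt_const (by simpa using hε)
  obtain ⟨r, hr, hball⟩ := Metric.eventually_nhds_iff.1 (hgap.and (hval.and (hvec.and hsd)))
  have hjc : ContinuousAt (jet f) z :=
    (hf.continuous_gradient.prodMk (hf.continuous_d2.prodMk hf.continuous_fderiv_d2)).continuousAt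
  obtain ⟨ρ, hρ, hjet⟩ := Metric.continuousAt_iff.1 hjc (r / 2) (by positivity)
  -- The three components of the jet differ by at most 2η, 3η and 6η, all below r/2 for η = r/13.
  refine ⟨ρ, hρ, r / 13, by positivity, fun g hg x hx hc => ?_⟩
  have h1 : dist (jet f x) (jet f z) < r / 2 := hjet (by rwa [dist_eq_norm])
  have h2 : dist (jet g x) (jet f x) < r / 2 := by
    rw [Prod.dist_eq, Prod.dist_eq, max_lt_iff, max_lt_iff, dist_eq_norm, dist_eq_norm, dist_eq_norm]
    refine ⟨hc.gradient.trans_lt ?_, hc.d2.trans_lt ?_, (hc.fderiv_d2 hg hf).trans_lt ?_⟩ <;>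
      linarith
  obtain ⟨c1, c2, c3, c4⟩ := hball ((dist_triangle _ _ _).trans_lt (by linarith) :
    dist (jet g x) (jet f z) < r)
  refine ⟨c1, ?_, c3.le, c2⟩
  rw [slopeDeriv_eq hg c1, slopeDeriv_eq hf hz]
  exact c4.le

lemma abs_eigValMap_sub_le (p q : EuclideanSpace ℝ (Fin 3)) :
    |eigValMap p - eigValMap q| ≤ (2 + ‖gapMap‖) * ‖p - q‖ := by
  have h0 := abs_coord_le (p - q) 0
  have h2 := abs_coord_le (p - q) 2
  have h3 : |‖gapMap p‖ - ‖gapMap q‖| ≤ ‖gapMap‖ * ‖p - q‖ :=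
    (abs_norm_sub_norm_le _ _).trans (by rw [← map_sub]; exact gapMap.le_opNorm _)
  rw [eigValMap_eq, eigValMap_eq]
  simp only [PiLp.sub_apply] at h0 h2
  have h4 := norm_nonneg (p - q)
  have h5 : 0 ≤ ‖gapMap‖ * ‖p - q‖ := by positivity
  rw [abs_le] at *
  constructor <;> nlinarith

/-- Bounds that are uniform over the functions `g` that are `1`-close to `f` on a convex set `B`. -/
lemma Regular.exists_uniform_bounds {f : Plane → ℝ} (hf : Regular f) : ∃ L : ℝ, 1 ≤ L ∧
    ∀ g, Regular g → ∀ B : Set Plane, Convex ℝ B → (∀ x ∈ B, CloseAt f g 1 x) →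
      (∀ x ∈ B, ‖gradient g x‖ ≤ L ∧ ‖eigVec g x‖ ≤ L) ∧
      ∀ x ∈ B, ∀ y ∈ B, ‖eigVec g x - eigVec g y‖ ≤ L * ‖x - y‖ ∧
        |slope g x - slope g y| ≤ L * ‖x - y‖ ∧ |eigVal g x - eigVal g y| ≤ L * ‖x - y‖ := by
  obtain ⟨C, hC⟩ := hf.bounded
  have hC0 : 0 ≤ C := (abs_nonneg _).trans (hC [0] (by simp) (by simp) 0)
  have hΛ := eigVecLip_nonneg
  set M := C + 1
  have hM : 0 < M := by positivity
  -- Here M bounds the partial derivatives of `g` of orders one to three. L₁ bounds the gradient and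
  -- the field, L₂ is a Lipschitz constant for the gradient, the field and the eigenvalue, and 2L₁L₂
  -- is one for the slope, by the product rule.
  set L₁ := 2 * M + eigVecLip * (3 * M)
  set L₂ := 4 * M + eigVecLip * (6 * M) + (2 + ‖gapMap‖) * (6 * M)
  have hL₁ : 0 ≤ L₁ := by positivity
  have hL₂ : 0 ≤ L₂ := by positivity
  refine ⟨1 + L₁ + L₂ + 2 * (L₁ * L₂), by nlinarith [mul_nonneg hL₁ hL₂], fun g hg B hB hclose => ?_⟩
  have hP : 0 ≤ L₁ * L₂ := mul_nonneg hL₁ hL₂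
  have hpd : ∀ l : List (Fin 2), 1 ≤ l.length → l.length ≤ 3 → ∀ x ∈ B, |pd l g x| ≤ M := by
    intro l h1 h3 x hx
    have a1 := hclose x hx l h1 h3
    have a2 := hC l h1 (by omega) x
    have a3 : pd l g x = (pd l g x - pd l f x) + pd l f x := by ring
    rw [a3]
    exact (abs_add_le _ _).trans (by linarith)
  have hlip : ∀ l : List (Fin 2), 1 ≤ l.length → l.length ≤ 2 → ∀ x ∈ B, ∀ y ∈ B,
      |pd l g x - pd l g y| ≤ 2 * M * ‖x - y‖ := by
    intro l h1 h3 x hx y hy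
    exact Convex.norm_image_sub_le_of_norm_fderiv_le (f := pd l g) (s := B)
      (fun z _ => hg.differentiable l (by omega) z)
      (fun z hz => norm_fderiv_le_of_partialDeriv fun i => hpd (i :: l) (by simp) (by simp; omega) z hz)
      hB hy hx
  have hgrad : ∀ x ∈ B, ‖gradient g x‖ ≤ 2 * M := by
    intro x hx
    refine (norm_le_sum_abs _).trans ?_
    rw [Fin.sum_univ_two, gradient_apply, gradient_apply]
    have h0 := hpd [0] (by simp) (by simp) x hx
    have h1 := hpd [1] (by simp) (by simp) x hx
    simp only [pd_cons, pd_nil] at h0 h1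
    linarith
  have hd2 : ∀ x ∈ B, ‖d2 g x‖ ≤ 3 * M := by
    intro x hx
    refine (norm_le_sum_abs _).trans ?_
    rw [Fin.sum_univ_three]
    simp only [d2_apply]
    have := fun i : Fin 3 => hpd (d2Index i) (by simp [length_d2Index]) (by simp [length_d2Index]) x hx
    linarith [this 0, this 1, this 2]
  have hgradL : ∀ x ∈ B, ∀ y ∈ B, ‖gradient g x - gradient g y‖ ≤ 4 * M * ‖x - y‖ := by
    intro x hx y hy
    refine (norm_le_sum_abs _).trans ?_
    rw [Fin.sum_univ_two]
    simp only [PiLp.sub_apply, gradient_apply]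
    have h0 := hlip [0] (by simp) (by simp) x hx y hy
    have h1 := hlip [1] (by simp) (by simp) x hx y hy
    simp only [pd_cons, pd_nil] at h0 h1
    linarith
  have hd2L : ∀ x ∈ B, ∀ y ∈ B, ‖d2 g x - d2 g y‖ ≤ 6 * M * ‖x - y‖ := by
    intro x hx y hy
    refine (norm_le_sum_abs _).trans ?_
    rw [Fin.sum_univ_three]
    simp only [PiLp.sub_apply, d2_apply]
    have := fun i : Fin 3 => hlip (d2Index i) (by simp [length_d2Index]) (by simp [length_d2Index])
      x hx y hy
    linarith [this 0, this 1, this 2]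
  have hV : ∀ x ∈ B, ‖eigVec g x‖ ≤ L₁ := fun x hx =>
    (norm_eigVecMap_le _).trans (by
      have := mul_le_mul_of_nonneg_left (hd2 x hx) hΛ
      simp only [L₁]; linarith)
  have hVL : ∀ x ∈ B, ∀ y ∈ B, ‖eigVec g x - eigVec g y‖ ≤ L₂ * ‖x - y‖ := fun x hx y hy =>
    (norm_eigVecMap_sub_le _ _).trans (by
      have := mul_le_mul_of_nonneg_left (hd2L x hx y hy) hΛ
      have h0 : 0 ≤ (4 * M + (2 + ‖gapMap‖) * (6 * M)) * ‖x - y‖ := by positivity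
      simp only [L₂]; linarith)
  refine ⟨fun x hx => ⟨?_, ?_⟩, fun x hx y hy => ⟨?_, ?_, ?_⟩⟩
  · have : 2 * M ≤ L₁ := by simp only [L₁]; nlinarith
    linarith [hgrad x hx]
  · linarith [hV x hx]
  · refine (hVL x hx y hy).trans ?_
    gcongr
    linarith
  · have e : slope g x - slope g y = inner ℝ (gradient g x - gradient g y) (eigVec g x) +
        inner ℝ (gradient g y) (eigVec g x - eigVec g y) := by
      simp only [slope, inner_sub_left, inner_sub_right]; ring
    have h1 : ‖gradient g x - gradient g y‖ ≤ L₂ * ‖x - y‖ := by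
      refine (hgradL x hx y hy).trans ?_
      gcongr
      have : 0 ≤ eigVecLip * (6 * M) + (2 + ‖gapMap‖) * (6 * M) := by positivity
      simp only [L₂]; linarith
    have h2 : ‖gradient g y‖ ≤ L₁ := by
      have : 2 * M ≤ L₁ := by simp only [L₁]; nlinarith
      linarith [hgrad y hy]
    rw [e]
    calc _ ≤ ‖gradient g x - gradient g y‖ * ‖eigVec g x‖ +
          ‖gradient g y‖ * ‖eigVec g x - eigVec g y‖ :=
        (abs_add_le _ _).trans (add_le_add (abs_real_inner_le_norm _ _) (abs_real_inner_le_norm _ _))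
      _ ≤ L₂ * ‖x - y‖ * L₁ + L₁ * (L₂ * ‖x - y‖) := by
        gcongr
        · exact hV x hx
        · exact hVL x hx y hy
      _ = 2 * (L₁ * L₂) * ‖x - y‖ := by ring
      _ ≤ _ := by gcongr; linarith
  · refine (abs_eigValMap_sub_le _ _).trans ?_
    have h1 := mul_le_mul_of_nonneg_left (hd2L x hx y hy) (by positivity : 0 ≤ 2 + ‖gapMap‖)
    have h2 : (2 + ‖gapMap‖) * (6 * M) ≤ L₂ := by
      have : 0 ≤ 4 * M + eigVecLip * (6 * M) := by positivity
      simp only [L₂]; linarith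
    calc _ ≤ (2 + ‖gapMap‖) * (6 * M) * ‖x - y‖ := by linarith
      _ ≤ _ := by gcongr; linarith

/-! ### Stability of the first hitting point -/

lemma closeAt_self (f : Plane → ℝ) {η : ℝ} (hη : 0 ≤ η) (x : Plane) : CloseAt f f η x := by
  intro l _ _; simpa using hη

/-- The size of the accumulated drift up to time `t`. -/
def driftSize (U V : Plane → Plane) (γ : ℝ → Plane) (t : ℝ) : ℝ :=
  ‖drift U V γ t‖ + |∫ r in (0 : ℝ)..t, ‖drift U V γ r‖|

lemma driftSize_nonneg (U V : Plane → Plane) (γ : ℝ → Plane) (t : ℝ) : 0 ≤ driftSize U V γ t := by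
  unfold driftSize; positivity

/-- Closeness on the ball bounds the field there, and this bound in turn confines the curve of `g`
to the ball up to time T. So `R` and `C` can be fixed before `g`. The bound through `driftSize`
serves for the sharp rate, the bounds through η only for localization. -/
lemma Regular.exists_curve_bounds {f : Plane → ℝ} (hf : Regular f) (x₀ : Plane) {T : ℝ}
    (hT : 0 ≤ T) : ∃ R C : ℝ, 1 ≤ C ∧ (∀ t, |t| ≤ T → curve f x₀ t ∈ Metric.closedBall x₀ R) ∧
    ∀ g, Regular g → (∀ x ∈ Metric.closedBall x₀ R, CloseAt f g 1 x) →
      (∀ x ∈ Metric.closedBall x₀ R, ‖gradient g x‖ ≤ C ∧ ‖eigVec g x‖ ≤ C) ∧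
      (∀ x ∈ Metric.closedBall x₀ R, ∀ y ∈ Metric.closedBall x₀ R,
        |slope g x - slope g y| ≤ C * ‖x - y‖) ∧
      ∀ t, |t| ≤ T → curve g x₀ t ∈ Metric.closedBall x₀ R ∧
        ‖curve g x₀ t - curve f x₀ t‖ ≤
          C * driftSize (eigVec g) (eigVec f) (curve f x₀) t ∧
        ∀ η, (∀ x ∈ Metric.closedBall x₀ R, CloseAt f g η x) →
          ‖curve g x₀ t - curve f x₀ t‖ ≤ C * η ∧
          |slope g (curve g x₀ t) - slope f (curve f x₀ t)| ≤ C * η ∧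
          |eigVal g (curve g x₀ t) - eigVal f (curve f x₀ t)| ≤ C * η := by
  obtain ⟨L, hL1, hL⟩ := hf.exists_uniform_bounds
  have hL0 : 0 ≤ L := by linarith
  have hΛ := eigVecLip_nonneg
  set R := (L + 1) * T
  set B := Metric.closedBall x₀ R
  have hBc : Convex ℝ B := convex_closedBall _ _
  have hmem : ∀ g, Regular g → (∀ x ∈ B, CloseAt f g 1 x) → ∀ t, |t| ≤ T → curve g x₀ t ∈ B :=
    fun g hg hc t ht => (hg.isCurveFrom x₀).mem_closedBall
      (fun x hx => ((hL g hg B hBc hc).1 x hx).2) hL0 le_rfl ht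
  have hself : ∀ x ∈ B, CloseAt f f 1 x := fun x _ => closeAt_self f zero_le_one x
  have hmf := hmem f hf hself
  set A := 1 + L * Real.exp (L * T)
  have hA : 1 ≤ A := by simp only [A]; nlinarith [Real.exp_pos (L * T)]
  set D := 3 * eigVecLip * (T + L * Real.exp (L * T) * T ^ 2)
  have hD : 0 ≤ D := by positivity
  set S := 2 * L + L * (3 * eigVecLip) + 3 * (2 + ‖gapMap‖)
  have hS : 0 ≤ S := by positivity
  refine ⟨R, A + L + D + L * D + S, by nlinarith [mul_nonneg hL0 hD], hmf, fun g hg hc => ?_⟩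
  have hLD := mul_nonneg hL0 hD
  obtain ⟨hb, hl⟩ := hL g hg B hBc hc
  have hmg := hmem g hg hc
  refine ⟨fun x hx => ⟨by linarith [(hb x hx).1], by linarith [(hb x hx).2]⟩,
    fun x hx y hy => ?_, fun t ht => ⟨hmg t ht, ?_, fun η hη => ?_⟩⟩
  · refine (hl x hx y hy).2.1.trans ?_
    gcongr
    linarith
  · have h := norm_sub_le_drift (T := T) hg.continuous_eigVec hf.continuous_eigVec
      (hg.isCurveFrom x₀) (hf.isCurveFrom x₀) hL0
      (fun s hs => (hl _ (hmg s hs) _ (hmf s hs)).1) ht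
    have hd0 := driftSize_nonneg (eigVec g) (eigVec f) (curve f x₀) t
    calc _ ≤ A * driftSize (eigVec g) (eigVec f) (curve f x₀) t := by
          refine h.trans ?_
          simp only [A, driftSize]
          have h1 := norm_nonneg (drift (eigVec g) (eigVec f) (curve f x₀) t)
          have h2 := abs_nonneg (∫ r in (0 : ℝ)..t, ‖drift (eigVec g) (eigVec f) (curve f x₀) r‖)
          have h3 : 0 ≤ L * Real.exp (L * T) := by positivity
          nlinarith
      _ ≤ _ := by gcongr; linarith
  · have hη0 : 0 ≤ η := (hη _ (hmf t ht)).nonneg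
    have hVclose : ∀ x ∈ B, ‖eigVec g x - eigVec f x‖ ≤ 3 * eigVecLip * η := fun x hx =>
      (norm_eigVecMap_sub_le _ _).trans (by nlinarith [(hη x hx).d2])
    have h1 : ‖curve g x₀ t - curve f x₀ t‖ ≤ D * η := by
      have h := norm_sub_le_of_field_close (T := T) hg.continuous_eigVec hf.continuous_eigVec
        (hg.isCurveFrom x₀) (hf.isCurveFrom x₀) hL0
        (fun s hs => (hl _ (hmg s hs) _ (hmf s hs)).1) (fun s hs => hVclose _ (hmf s hs)) ht
      refine h.trans (le_of_eq ?_)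
      simp only [D]; ring
    set x := curve g x₀ t
    set y := curve f x₀ t
    have hx := hmg t ht
    have hy := hmf t ht
    have hsl : |slope g y - slope f y| ≤ (2 * L + L * (3 * eigVecLip)) * η := by
      have e : slope g y - slope f y = inner ℝ (gradient g y - gradient f y) (eigVec g y) +
          inner ℝ (gradient f y) (eigVec g y - eigVec f y) := by
        simp only [slope, inner_sub_left, inner_sub_right]; ring
      have hfb := ((hL f hf B hBc hself).1 y hy).1
      rw [e]
      calc _ ≤ ‖gradient g y - gradient f y‖ * ‖eigVec g y‖ +
            ‖gradient f y‖ * ‖eigVec g y - eigVec f y‖ :=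
          (abs_add_le _ _).trans
            (add_le_add (abs_real_inner_le_norm _ _) (abs_real_inner_le_norm _ _))
        _ ≤ 2 * η * L + L * (3 * eigVecLip * η) := by
          gcongr
          · exact (hη y hy).gradient
          · exact (hb y hy).2
          · exact hVclose y hy
        _ = _ := by ring
    have hev : |eigVal g y - eigVal f y| ≤ 3 * (2 + ‖gapMap‖) * η :=
      (abs_eigValMap_sub_le _ _).trans (by
        have := mul_le_mul_of_nonneg_left (hη y hy).d2 (by positivity : 0 ≤ 2 + ‖gapMap‖)
        linarith)
    have hLx : L * ‖x - y‖ ≤ L * D * η := by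
      rw [mul_assoc]; gcongr
    refine ⟨h1.trans ?_, ?_, ?_⟩
    · gcongr; linarith
    · have h2 := (hl x hx y hy).2.1
      have h3 : |slope g x - slope f y| ≤ |slope g x - slope g y| + |slope g y - slope f y| :=
        abs_sub_le _ _ _
      have h4 : (2 * L + L * (3 * eigVecLip)) * η ≤ S * η := by
        gcongr; simp only [S]; linarith [norm_nonneg gapMap]
      have h5 : 0 ≤ (A + L + D) * η := by positivity
      linarith
    · have h2 := (hl x hx y hy).2.2
      have h3 : |eigVal g x - eigVal f y| ≤ |eigVal g x - eigVal g y| + |eigVal g y - eigVal f y| :=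
        abs_sub_le _ _ _
      have h4 : 3 * (2 + ‖gapMap‖) * η ≤ S * η := by
        gcongr; simp only [S]
        have : 0 ≤ 2 * L + L * (3 * eigVecLip) := by positivity
        linarith
      have h5 : 0 ≤ (A + L + D) * η := by positivity
      linarith

/-- The curve of `f` through `x₀` has a unique first filament point, at time `θ`; it is crossed
transversally and no degenerate point comes before it. -/
structure FirstHitModel (f : Plane → ℝ) (x₀ : Plane) (θ : ℝ) : Prop where
  regular : Regular f
  first : IsFirstHit f x₀ θ
  unique : ∀ t, IsFirstHit f x₀ t → t = θ
  nondegenerate : ∀ t : ℝ, |t| ≤ |θ| →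
    ¬ (eigVal f (curve f x₀ t) = 0 ∧ slope f (curve f x₀ t) = 0)
  transversal : slopeDeriv f (curve f x₀ θ) ≠ 0

variable {f : Plane → ℝ} {x₀ : Plane} {θ : ℝ}

/-- Transversality at the hit forces V ≠ 0 there, hence V ≠ 0 and distinct eigenvalues at all times
of the curve. -/
lemma FirstHitModel.gapMap_ne_zero (hm : FirstHitModel f x₀ θ) (t : ℝ) :
    gapMap (d2 f (curve f x₀ t)) ≠ 0 :=
  gapMap_ne_zero_of_eigVecMap_ne_zero
    (eigVec_curve_ne_zero hm.regular (eigVec_ne_zero_of_slopeDeriv hm.transversal) t)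

/-- Away from `θ` the quantity `max |slope| λ₂` is bounded away from zero within the search range. -/
lemma FirstHitModel.exists_separation (hm : FirstHitModel f x₀ θ) {δ : ℝ} (hδ : 0 < δ) :
    ∃ δ' > 0, δ' ≤ 1 ∧ ∃ c > 0, ∀ t, |t| ≤ |θ| + δ' → δ ≤ |t - θ| →
      c ≤ max |slope f (curve f x₀ t)| (eigVal f (curve f x₀ t)) := by
  have hγ := (hm.regular.isCurveFrom x₀).continuous
  have hs : Continuous fun t => slope f (curve f x₀ t) :=
    (hm.regular.continuous_gradient.comp hγ).inner (hm.regular.continuous_eigVec.comp hγ)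
  have hv : Continuous fun t => eigVal f (curve f x₀ t) :=
    continuous_eigValMap.comp (hm.regular.continuous_d2.comp hγ)
  -- The term |t| − |θ| makes Φ positive also beyond the range |t| ≤ |θ|, where `f` may have further
  -- hits. Compactness then gives Φ ≥ c, and restricting to |t| − |θ| ≤ c/2 shows that the bound
  -- comes from the other two terms.
  set Φ : ℝ → ℝ := fun t =>
    max (max |slope f (curve f x₀ t)| (eigVal f (curve f x₀ t))) (|t| - |θ|)
  have hΦ : Continuous Φ := by fun_prop
  set S : Set ℝ := {t | |t| ≤ |θ| + 1 ∧ δ ≤ |t - θ|}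
  have hScl : IsClosed S := by
    have h1 : IsClosed {t : ℝ | |t| ≤ |θ| + 1} := isClosed_le (by fun_prop) (by fun_prop)
    have h2 : IsClosed {t : ℝ | δ ≤ |t - θ|} := isClosed_le (by fun_prop) (by fun_prop)
    exact h1.inter h2
  have hS : IsCompact S := by
    refine (isCompact_Icc (a := -(|θ| + 1)) (b := |θ| + 1)).of_isClosed_subset hScl fun t ht => ?_
    exact abs_le.1 ht.1
  have hpos : ∀ t ∈ S, 0 < Φ t := by
    intro t ht
    by_contra hneg
    simp only [Φ, not_lt, max_le_iff] at hneg
    obtain ⟨⟨h1, h2⟩, h3⟩ := hneg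
    have h1' : slope f (curve f x₀ t) = 0 := abs_eq_zero.1 (le_antisymm h1 (abs_nonneg _))
    have htθ : |t| ≤ |θ| := by linarith
    -- A zero slope with λ₂ < 0 would be another first hit; a zero slope with λ₂ = 0 is a degenerate
    -- point.
    rcases h2.lt_or_eq with h | h
    · have : t = θ := hm.unique t ⟨⟨h1', h⟩, fun s hs => htθ.trans (hm.first.2 s hs)⟩
      have h5 := ht.2
      simp [this] at h5
      linarith
    · exact hm.nondegenerate t htθ ⟨h, h1'⟩
  obtain ⟨c, hc, hcS⟩ : ∃ c > 0, ∀ t ∈ S, c ≤ Φ t := by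
    rcases S.eq_empty_or_nonempty with he | hne
    · exact ⟨1, one_pos, fun t ht => by simp [he] at ht⟩
    · obtain ⟨t, ht, hmin⟩ := hS.exists_isMinOn hne hΦ.continuousOn
      exact ⟨Φ t, hpos t ht, fun s hs => hmin hs⟩
  refine ⟨min (c / 2) 1, by positivity, min_le_right _ _, c, hc, fun t ht htδ => ?_⟩
  have hle1 := min_le_left (c / 2) 1
  have hle2 := min_le_right (c / 2) 1
  have := hcS t ⟨by linarith, htδ⟩
  rcases le_max_iff.1 this with h | h
  · exact h
  · linarith

/-- A function whose derivative is close to `1` near `θ` and that is small at `θ` has a unique zero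
near `θ`. -/
lemma exists_zero_of_deriv_close {β β' : ℝ → ℝ} {θ δ κ : ℝ} (hδ : 0 < δ) (hκ : κ ≤ 1 / 2)
    (hβ : ∀ t, |t - θ| ≤ δ → HasDerivAt β (β' t) t) (hβ' : ∀ t, |t - θ| ≤ δ → |β' t - 1| ≤ κ)
    (h0 : 2 * |β θ| ≤ δ) :
    ∃ t, |t - θ| ≤ 2 * |β θ| ∧ β t = 0 ∧ |t - θ + β θ| ≤ κ * |t - θ| ∧
      ∀ s, |s - θ| ≤ δ → β s = 0 → s = t := by
  have hκ0 : 0 ≤ κ := (abs_nonneg _).trans (hβ' θ (by simpa using hδ.le))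
  have hset : {t : ℝ | |t - θ| ≤ δ} = Metric.closedBall θ δ := by
    ext t; simp [Metric.mem_closedBall, Real.dist_eq]
  have hconv : Convex ℝ {t : ℝ | |t - θ| ≤ δ} := by rw [hset]; exact convex_closedBall _ _
  have mv : ∀ s t, |s - θ| ≤ δ → |t - θ| ≤ δ → |β t - β s - (t - s)| ≤ κ * |t - s| := by
    intro s t hs ht
    have := hconv.norm_image_sub_le_of_norm_hasDerivWithin_le (f := fun t => β t - t)
      (f' := fun t => β' t - 1) (C := κ)
      (fun r hr => ((hβ r hr).sub (hasDerivAt_id r)).hasDerivWithinAt) hβ' hs ht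
    simp only [Real.norm_eq_abs] at this
    convert this using 2
    ring
  -- Since κ ≤ 1/2, the function increases at rate at least 1/2, so it changes sign within distance
  -- 2|β θ| of θ.
  set s := 2 * |β θ|
  have hs0 : 0 ≤ s := by positivity
  have hθ : |θ - θ| ≤ δ := by simpa using hδ.le
  have hcont : ContinuousOn β (Set.Icc (θ - s) (θ + s)) := fun t ht =>
    (hβ t (abs_le.2 ⟨by linarith [ht.1], by linarith [ht.2]⟩)).continuousAt.continuousWithinAt
  have hlo : β (θ - s) ≤ 0 := by
    have h1 := mv θ (θ - s) hθ (by rw [sub_sub_cancel_left, abs_neg, abs_of_nonneg hs0]; exact h0)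
    rw [sub_sub_cancel_left, abs_neg, abs_of_nonneg hs0] at h1
    have := (abs_le.1 h1).2
    have h3 := le_abs_self (β θ)
    simp only [s] at *
    nlinarith
  have hhi : 0 ≤ β (θ + s) := by
    have h1 := mv θ (θ + s) hθ (by rw [add_sub_cancel_left, abs_of_nonneg hs0]; exact h0)
    rw [add_sub_cancel_left, abs_of_nonneg hs0] at h1
    have := (abs_le.1 h1).1
    have h3 := neg_abs_le (β θ)
    simp only [s] at *
    nlinarith
  obtain ⟨t, ht, ht0⟩ := intermediate_value_Icc (by linarith) hcont ⟨hlo, hhi⟩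
  have hts : |t - θ| ≤ s := abs_le.2 ⟨by linarith [ht.1], by linarith [ht.2]⟩
  refine ⟨t, hts, ht0, ?_, fun r hr hr0 => ?_⟩
  · have := mv θ t hθ (hts.trans h0)
    rw [ht0] at this
    rw [← abs_neg]
    convert this using 2
    ring
  · have := mv t r (hts.trans h0) hr
    rw [ht0, hr0] at this
    simp only [sub_self, zero_sub, abs_neg] at this
    have h2 : |r - t| = 0 := by nlinarith [abs_nonneg (r - t)]
    linarith [abs_eq_zero.1 h2]

/-- If `g` is `C³`-close to `f`, then the estimated first hit is the unique zero near `θ` of the slope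
along the curve of `g`. -/
lemma FirstHitModel.exists_hit_expansion (hm : FirstHitModel f x₀ θ) {R C : ℝ}
    (hC1 : 1 ≤ C)
    (hRC : ∀ g, Regular g → (∀ x ∈ Metric.closedBall x₀ R, CloseAt f g 1 x) →
      ∀ t, |t| ≤ |θ| + 1 → curve g x₀ t ∈ Metric.closedBall x₀ R ∧
        ∀ η, (∀ x ∈ Metric.closedBall x₀ R, CloseAt f g η x) →
          ‖curve g x₀ t - curve f x₀ t‖ ≤ C * η ∧
          |slope g (curve g x₀ t) - slope f (curve f x₀ t)| ≤ C * η ∧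
          |eigVal g (curve g x₀ t) - eigVal f (curve f x₀ t)| ≤ C * η)
    {ε : ℝ} (hε : 0 < ε) :
    ∃ η > 0, η ≤ 1 ∧ ∀ g, Regular g → (∀ x ∈ Metric.closedBall x₀ R, CloseAt f g η x) →
      ∀ t, IsHitEstimate g x₀ t →
        |t - θ| ≤ 2 * |slope g (curve g x₀ θ) / slopeDeriv f (curve f x₀ θ)| ∧
        |t - θ + slope g (curve g x₀ θ) / slopeDeriv f (curve f x₀ θ)| ≤ ε * |t - θ| ∧
        ‖curve g x₀ t - curve g x₀ θ - (t - θ) • eigVec f (curve f x₀ θ)‖ ≤ ε * |t - θ| := by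
  set z := curve f x₀ θ
  set a := slopeDeriv f z
  have ha : 0 < |a| := abs_pos.2 hm.transversal
  have hf := hm.regular
  -- The first entry controls the direction of the field; the second makes the derivative of the
  -- slope divided by a differ from 1 by at most min(1/2, ε).
  set ε₁ := min ε (min (1 / 2) ε * |a|)
  have hε₁ : 0 < ε₁ := by positivity
  obtain ⟨ρ, hρ, η₁, hη₁, hnear⟩ := exists_close_nhds hf (hm.gapMap_ne_zero θ) hm.first.1.2 hε₁
  obtain ⟨δ₀, hδ₀, hδ₀'⟩ := Metric.continuousAt_iff.1
    ((hf.isCurveFrom x₀).continuous.continuousAt (x := θ)) (ρ / 2) (by positivity)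
  set δ := min (δ₀ / 2) 1
  have hδ : 0 < δ := by positivity
  have hδ1 : δ ≤ 1 := min_le_right _ _
  have hδδ₀ : δ < δ₀ := (min_le_left _ _).trans_lt (by linarith)
  obtain ⟨δ', hδ', hδ'1, c, hc, hsep⟩ := hm.exists_separation hδ
  set δ₂ := min δ δ'
  have hδ₂ : 0 < δ₂ := by positivity
  -- The entries ensure in turn: the uniform bounds apply; the jets are close; the curve of `g`
  -- stays within ρ of z; no hit of `g` occurs where `f` is separated by c; the zero near θ lies
  -- within δ₂.
  set η := min (min 1 η₁) (min (ρ / (4 * C)) (min (c / (2 * C)) (δ₂ * |a| / (2 * C))))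
  have hη : 0 < η := by positivity
  have hη1 : η ≤ 1 := (min_le_left _ _).trans (min_le_left _ _)
  have hηη₁ : η ≤ η₁ := (min_le_left _ _).trans (min_le_right _ _)
  have hηρ : C * η ≤ ρ / 4 := by
    have : η ≤ ρ / (4 * C) := (min_le_right _ _).trans (min_le_left _ _)
    rw [le_div_iff₀ (by positivity)] at this
    linarith
  have hηc : C * η ≤ c / 2 := by
    have : η ≤ c / (2 * C) := (min_le_right _ _).trans ((min_le_right _ _).trans (min_le_left _ _))
    rw [le_div_iff₀ (by positivity)] at this
    linarith
  have hηδ : C * η ≤ δ₂ * |a| / 2 := by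
    have : η ≤ δ₂ * |a| / (2 * C) :=
      (min_le_right _ _).trans ((min_le_right _ _).trans (min_le_right _ _))
    rw [le_div_iff₀ (by positivity)] at this
    linarith
  refine ⟨η, hη, hη1, fun g hg hclose t ht => ?_⟩
  have hb := hRC g hg fun x hx => (hclose x hx).mono hη1
  have hT : ∀ t, |t - θ| ≤ δ → |t| ≤ |θ| + 1 := by
    intro t ht
    have := abs_add_le (t - θ) θ
    rw [sub_add_cancel] at this
    linarith
  have hloc : ∀ t, |t - θ| ≤ δ → gapMap (d2 g (curve g x₀ t)) ≠ 0 ∧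
      |slopeDeriv g (curve g x₀ t) - a| ≤ ε₁ ∧ ‖eigVec g (curve g x₀ t) - eigVec f z‖ ≤ ε₁ ∧
      eigVal g (curve g x₀ t) < 0 := by
    intro t ht
    obtain ⟨hB, hcl⟩ := hb t (hT t ht)
    refine hnear g hg _ ?_ ((hclose _ hB).mono hηη₁)
    have h1 := (hcl η hclose).1
    have h2 : dist (curve f x₀ t) z < ρ / 2 := hδ₀' (by
      rw [Real.dist_eq]; exact ht.trans_lt hδδ₀)
    rw [dist_eq_norm] at h2
    calc _ = ‖(curve g x₀ t - curve f x₀ t) + (curve f x₀ t - z)‖ := by congr 1; abel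
      _ ≤ _ := norm_add_le _ _
      _ < ρ := by linarith
  set β : ℝ → ℝ := fun t => slope g (curve g x₀ t) / a
  have hβ : ∀ t, |t - θ| ≤ δ → HasDerivAt β (slopeDeriv g (curve g x₀ t) / a) t := fun t ht =>
    (hasDerivAt_slope_comp hg ((hg.isCurveFrom x₀).2 t) (hloc t ht).1).div_const a
  have hβ' : ∀ t, |t - θ| ≤ δ → |slopeDeriv g (curve g x₀ t) / a - 1| ≤ min (1 / 2) ε := by
    intro t ht
    rw [div_sub_one hm.transversal, abs_div, div_le_iff₀ ha]
    exact (hloc t ht).2.1.trans (min_le_right _ _)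
  have hθT : |θ| ≤ |θ| + 1 := by linarith
  have hβθ : 2 * |β θ| ≤ δ₂ := by
    have h1 := ((hb θ hθT).2 η hclose).2.1
    rw [hm.first.1.1, sub_zero] at h1
    simp only [β]
    rw [abs_div, ← mul_div_assoc, div_le_iff₀ ha]
    linarith
  have hδ₂δ : δ₂ ≤ δ := min_le_left _ _
  have hδ₂δ' : δ₂ ≤ δ' := min_le_right _ _
  obtain ⟨τ, hτ1, hτ0, hτ2, hτu⟩ := exists_zero_of_deriv_close hδ (min_le_left _ _) hβ hβ'
    (hβθ.trans hδ₂δ)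
  have hτδ : |τ - θ| ≤ δ := hτ1.trans (hβθ.trans hδ₂δ)
  have zero_iff : ∀ s, β s = 0 ↔ slope g (curve g x₀ s) = 0 := fun s => by
    simp only [β]
    exact div_eq_zero_iff.trans (or_iff_left hm.transversal)
  have hτhit : τ ∈ hitTimes g x₀ := ⟨(zero_iff τ).1 hτ0, (hloc τ hτδ).2.2.2⟩
  have hτabs : |τ| ≤ |θ| + δ' := by
    have := abs_add_le (τ - θ) θ
    rw [sub_add_cancel] at this
    linarith
  -- Away from θ, either |slope| or λ₂ of `f` is at least c, whereas at a hit of `g` the slope is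
  -- zero and λ₂ is negative; the perturbation is at most c/2. So such a hit lies near θ, where the
  -- zero is unique. This also excludes a hit at −τ different from τ.
  have huniq : ∀ s ∈ hitTimes g x₀, |s| ≤ |θ| + δ' → s = τ := by
    intro s hs hsθ
    refine hτu s ?_ ((zero_iff s).2 hs.1)
    by_contra hlt
    have h1 := hsep s hsθ (not_le.1 hlt).le
    have h2 := ((hb s (by linarith)).2 η hclose).2
    rw [hs.1, zero_sub, abs_neg] at h2
    rcases le_max_iff.1 h1 with h | h
    · linarith [h2.1]
    · have := (abs_le.1 h2.2).1
      linarith [hs.2]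
  have hfirst : IsFirstHit g x₀ τ := ⟨hτhit, fun s hs => by
    rcases le_or_gt |s| (|θ| + δ') with h | h
    · rw [huniq s hs h]
    · linarith⟩
  have htf := ht.1 ⟨τ, hfirst⟩
  obtain rfl : t = τ := huniq t htf.1 ((htf.2 τ hτhit).trans hτabs)
  refine ⟨hτ1, hτ2.trans ?_, ?_⟩
  · gcongr; exact min_le_right _ _
  · have hset : {t : ℝ | |t - θ| ≤ δ} = Metric.closedBall θ δ := by
      ext t; simp [Metric.mem_closedBall, Real.dist_eq]
    have hconv : Convex ℝ {t : ℝ | |t - θ| ≤ δ} := by rw [hset]; exact convex_closedBall _ _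
    -- Between θ and t the velocity of the curve of `g` differs from V(z) by at most ε, so the mean
    -- value inequality applies to the curve minus its linear approximation.
    have := hconv.norm_image_sub_le_of_norm_hasDerivWithin_le
      (f := fun s => curve g x₀ s - s • eigVec f z)
      (f' := fun s => eigVec g (curve g x₀ s) - eigVec f z) (C := ε)
      (fun r hr => by
        have h1 := ((hasDerivAt_id r).smul_const (eigVec f z))
        rw [one_smul] at h1
        exact (((hg.isCurveFrom x₀).2 r).sub h1).hasDerivWithinAt)
      (fun r hr => (hloc r hr).2.2.1.trans (min_le_left _ _))
      (show |θ - θ| ≤ δ by simpa using hδ.le) (show |t - θ| ≤ δ from hτδ)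
    rw [Real.norm_eq_abs] at this
    refine le_trans (le_of_eq ?_) this
    congr 1
    rw [sub_smul]; abel

/-- First order expansion of the estimated filament point. -/
theorem FirstHitModel.exists_expansion (hm : FirstHitModel f x₀ θ) :
    ∃ R C : ℝ, (∀ t, |t| ≤ |θ| → curve f x₀ t ∈ Metric.closedBall x₀ R) ∧ 0 ≤ C ∧
    ∀ ε > 0, ∃ η > 0, ∀ g, Regular g → (∀ x ∈ Metric.closedBall x₀ R, CloseAt f g η x) →
      ∀ t, IsHitEstimate g x₀ t →
        ‖curve g x₀ t - curve f x₀ θ +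
          inner ℝ (weight f (curve f x₀ θ)) (d2 g (curve f x₀ θ) - d2 f (curve f x₀ θ)) •
            eigVec f (curve f x₀ θ)‖ ≤
          ε * ‖d2 g (curve f x₀ θ) - d2 f (curve f x₀ θ)‖ +
          C * (‖gradient g (curve f x₀ θ) - gradient f (curve f x₀ θ)‖ +
            driftSize (eigVec g) (eigVec f) (curve f x₀) θ) := by
  have hf := hm.regular
  have hT0 : 0 ≤ |θ| + 1 := by positivity
  obtain ⟨R, C, hC1, hRf, hRC⟩ := hf.exists_curve_bounds x₀ hT0
  set z := curve f x₀ θ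
  set a := slopeDeriv f z
  set v := ‖eigVec f z‖
  have ha : 0 < |a| := abs_pos.2 hm.transversal
  have hθT : |θ| ≤ |θ| + 1 := by linarith
  have hzB := hRf θ hθT
  have hC0 : 0 ≤ C := by linarith
  have hΛ := eigVecLip_nonneg
  set q := eigVecRem * ‖gapMap (d2 f z)‖⁻¹
  have hq : 0 ≤ q := mul_nonneg eigVecRem_nonneg (by positivity)
  set A := |a|⁻¹
  have hA : 0 ≤ A := by positivity
  -- `k` bounds the coefficients of all the remainder terms
  set k := A * C * C + A * C + A * C * q * 3 + A * C * eigVecLip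
  have hk : 0 ≤ k := by positivity
  set m := 4 + 2 * v
  have hmpos : 0 < m := by positivity
  refine ⟨R, C + (m + v) * k, fun t ht => hRf t (by linarith), by positivity, fun ε hε => ?_⟩
  set ε₁ := min 1 (ε / (2 * m * k + 1))
  have hε₁ : 0 < ε₁ := by positivity
  have hε₁1 : ε₁ ≤ 1 := min_le_left _ _
  have hε₁ε : ε₁ * (m * k) ≤ ε / 2 := by
    have h1 : ε₁ ≤ ε / (2 * m * k + 1) := min_le_right _ _
    rw [le_div_iff₀ (by positivity)] at h1
    nlinarith
  obtain ⟨η₁, hη₁, hη₁1, hexp⟩ := hm.exists_hit_expansion hC1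
    (fun g hg hc t ht => ⟨((hRC g hg hc).2.2 t ht).1, ((hRC g hg hc).2.2 t ht).2.2⟩) hε₁
  set η := min η₁ (ε / (2 * (m + v) * k + 1))
  have hη : 0 < η := by positivity
  have hηε : (m + v) * k * η ≤ ε / 2 := by
    have h1 : η ≤ ε / (2 * (m + v) * k + 1) := min_le_right _ _
    rw [le_div_iff₀ (by positivity)] at h1
    nlinarith
  refine ⟨η, hη, fun g hg hclose t ht => ?_⟩
  have hη1 : η ≤ 1 := (min_le_left _ _).trans hη₁1
  obtain ⟨hb1, hb2, hb3⟩ := hRC g hg fun x hx => (hclose x hx).mono hη1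
  obtain ⟨hbf1, -, -⟩ := hRC f hf fun x _ => closeAt_self f zero_le_one x
  obtain ⟨e1, e2, e3⟩ := hexp g hg (fun x hx => (hclose x hx).mono (min_le_left _ _)) t ht
  set D := driftSize (eigVec g) (eigVec f) (curve f x₀) θ
  have hD : 0 ≤ D := driftSize_nonneg _ _ _ _
  set N := ‖gradient g z - gradient f z‖
  have hN : 0 ≤ N := norm_nonneg _
  set ξ := d2 g z - d2 f z
  set S := ‖ξ‖
  have hS : 0 ≤ S := norm_nonneg _
  have hSη : S ≤ 3 * η := (hclose z hzB).d2
  set b := slope g (curve g x₀ θ) / a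
  have hw : inner ℝ (weight f z) ξ = a⁻¹ * inner ℝ (gradient f z) (eigVecDeriv (d2 f z) ξ) := by
    rw [weight, real_inner_smul_left, ContinuousLinearMap.adjoint_inner_left,
      fderiv_eigVecMap (hm.gapMap_ne_zero θ)]
  set κ := inner ℝ (weight f z) ξ
  obtain ⟨hgB, hcd, -⟩ := hb3 θ hθT
  have hκ : |κ| ≤ A * C * eigVecLip * S := by
    rw [hw, abs_mul, abs_inv, mul_assoc, mul_assoc]
    refine mul_le_mul_of_nonneg_left ?_ hA
    refine (abs_real_inner_le_norm _ _).trans ?_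
    refine mul_le_mul (hbf1 z hzB).1 ?_ (norm_nonneg _) hC0
    exact (ContinuousLinearMap.le_opNorm _ _).trans
      (mul_le_mul_of_nonneg_right (norm_eigVecDeriv_le _) (norm_nonneg _))
  have hbκ : |b - κ| ≤ A * C * C * D + A * C * N + A * C * q * 3 * (η * S) := by
    -- Three errors separate the slope of `g` on its own curve at time θ from the linear term: the
    -- displacement of the curve, the error of the gradient, and the second order remainder of the
    -- eigenvector map. The zeroth order term vanishes because z is a filament point.
    have h1 : b - κ = a⁻¹ * ((slope g (curve g x₀ θ) - slope g z) +
        (inner ℝ (gradient g z - gradient f z) (eigVec g z) +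
        inner ℝ (gradient f z) (eigVecMap (d2 f z + ξ) - eigVecMap (d2 f z) -
          eigVecDeriv (d2 f z) ξ))) := by
      have hs0 : inner ℝ (gradient f z) (eigVecMap (d2 f z)) = 0 := hm.first.1.1
      have hx : d2 f z + ξ = d2 g z := by simp [ξ]
      rw [hx, hw]
      simp only [b, slope, inner_sub_left, inner_sub_right, hs0, eigVec]
      ring
    rw [h1, abs_mul, abs_inv]
    have t1 : |slope g (curve g x₀ θ) - slope g z| ≤ C * (C * D) :=
      (hb2 _ hgB _ hzB).trans (by gcongr)
    have t2 : |inner ℝ (gradient g z - gradient f z) (eigVec g z)| ≤ N * C :=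
      (abs_real_inner_le_norm _ _).trans (by gcongr; exact (hb1 z hzB).2)
    have t3 : |inner ℝ (gradient f z) (eigVecMap (d2 f z + ξ) - eigVecMap (d2 f z) -
          eigVecDeriv (d2 f z) ξ)| ≤ C * (q * (3 * η * S)) := by
      refine (abs_real_inner_le_norm _ _).trans ?_
      have h2 := norm_eigVecMap_add_sub_le (hm.gapMap_ne_zero θ) ξ
      refine mul_le_mul (hbf1 z hzB).1 (h2.trans ?_) (norm_nonneg _) hC0
      refine mul_le_mul_of_nonneg_left ?_ hq
      rw [sq]
      exact mul_le_mul_of_nonneg_right hSη hS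
    calc _ ≤ A * (C * (C * D) + (N * C + C * (q * (3 * η * S)))) := by
          refine mul_le_mul_of_nonneg_left ?_ hA
          exact (abs_add_le _ _).trans (add_le_add t1 ((abs_add_le _ _).trans (add_le_add t2 t3)))
      _ = _ := by ring
  have hbκ' : |b - κ| ≤ k * (D + N + η * S) := by
    have h1 : A * C * C ≤ k := by simp only [k]; linarith [show 0 ≤ A * C + A * C * q * 3 + A * C * eigVecLip by positivity]
    have h2 : A * C ≤ k := by simp only [k]; linarith [show 0 ≤ A * C * C + A * C * q * 3 + A * C * eigVecLip by positivity]
    have h3 : A * C * q * 3 ≤ k := by simp only [k]; linarith [show 0 ≤ A * C * C + A * C + A * C * eigVecLip by positivity]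
    have h4 := mul_le_mul_of_nonneg_right h1 hD
    have h5 := mul_le_mul_of_nonneg_right h2 hN
    have h6 := mul_le_mul_of_nonneg_right h3 (mul_nonneg hη.le hS)
    linarith
  have hκ' : |κ| ≤ k * S := by
    refine hκ.trans (mul_le_mul_of_nonneg_right ?_ hS)
    simp only [k]; linarith [show 0 ≤ A * C * C + A * C + A * C * q * 3 by positivity]
  have hb : |b| ≤ k * S + k * (D + N + η * S) := by
    have : b = κ + (b - κ) := by ring
    rw [this]
    exact (abs_add_le _ _).trans (add_le_add hκ' hbκ')
  -- The three pieces are the travel from θ to t minus its linear approximation, the displacement at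
  -- time θ, and the error of the hitting time along V.
  have hdec : curve g x₀ t - z + κ • eigVec f z =
      (curve g x₀ t - curve g x₀ θ - (t - θ) • eigVec f z) + (curve g x₀ θ - z) +
      ((t - θ + b) - (b - κ)) • eigVec f z := by
    module
  have hE : 0 ≤ D + N + η * S := by positivity
  calc ‖curve g x₀ t - z + κ • eigVec f z‖
      ≤ ε₁ * |t - θ| + C * D + (ε₁ * |t - θ| + |b - κ|) * v := by
        rw [hdec]
        refine (norm_add_le _ _).trans (add_le_add ((norm_add_le _ _).trans (add_le_add e3 hcd)) ?_)
        rw [norm_smul]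
        refine mul_le_mul_of_nonneg_right ?_ (norm_nonneg _)
        exact (norm_sub_le _ _).trans (add_le_add_left e2 _)
    _ ≤ ε₁ * (2 * |b|) + C * D + (ε₁ * (2 * |b|) + k * (D + N + η * S)) * v := by gcongr
    _ ≤ ε₁ * m * |b| + C * D + v * k * (D + N + η * S) := by
        have : 0 ≤ ε₁ * |b| := by positivity
        simp only [m]; nlinarith
    _ ≤ ε₁ * m * (k * S + k * (D + N + η * S)) + C * D + v * k * (D + N + η * S) := by
        gcongr
    _ = ε₁ * (m * k) * S + ε₁ * (m * k * (D + N + η * S)) + C * D + v * k * (D + N + η * S) := by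
        ring
    _ ≤ ε / 2 * S + 1 * (m * k * (D + N + η * S)) + C * D + v * k * (D + N + η * S) := by
        gcongr
    _ = ε / 2 * S + C * D + (m + v) * k * (D + N) + (m + v) * k * η * S := by ring
    _ ≤ ε / 2 * S + C * (N + D) + (m + v) * k * (D + N) + ε / 2 * S := by
        gcongr; linarith
    _ = _ := by ring

/-! ### Symmetry of iterated partial derivatives -/

lemma partialDeriv_comm {g : Plane → ℝ} (hg : ContDiff ℝ 2 g) (i j : Fin 2) :
    partialDeriv i (partialDeriv j g) = partialDeriv j (partialDeriv i g) := by
  funext x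
  have h := pd_comm hg x
  simp only [pd_cons, pd_nil] at h
  fin_cases i <;> fin_cases j <;> first | rfl | exact h | exact h.symm

lemma pd_perm {l l' : List (Fin 2)} (h : l.Perm l') {g : Plane → ℝ}
    (hg : ContDiff ℝ (l.length : ℕ) g) : pd l g = pd l' g := by
  induction h with
  | nil => rfl
  | cons i _ ih => rw [pd_cons, pd_cons, ih (hg.of_le (by simp))]
  | swap i j l =>
    rw [pd_cons, pd_cons, pd_cons, pd_cons]
    refine partialDeriv_comm (contDiff_pd (m := 2) l (hg.of_le ?_)) _ _
    simp only [List.length_cons]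
    exact_mod_cast (by omega)
  | trans h1 h2 ih1 ih2 =>
    rw [ih1 hg, ih2 (by rwa [← h1.length_eq])]

/-! ### Properties of densities and kernels used below -/

/-- Bounded densities. -/
structure BoundedDensity (f : Plane → ℝ) (M : ℝ) : Prop where
  regular : Regular f
  nonneg : ∀ x, 0 ≤ f x
  integrable : Integrable f
  integral : ∫ x, f x = 1
  le : ∀ x, f x ≤ M

/-- A Lipschitz density is at least f(x) − C on the unit ball around x, and its integral there is at
most 1. So f(x) exceeds C by at most the inverse area of the ball. -/
lemma exists_boundedDensity {f : Plane → ℝ} (hr : Regular f) (hd : IsDensity f) :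
    ∃ M, BoundedDensity f M := by
  obtain ⟨C, hC0, hC⟩ := hr.lipschitz
  set v := (volume (Metric.ball (0 : Plane) 1)).toReal
  have hv : 0 < v := ENNReal.toReal_pos (Metric.measure_ball_pos volume _ one_pos).ne'
    measure_ball_lt_top.ne
  refine ⟨v⁻¹ + C, hr, hd.1, hd.2.1, hd.2.2, fun x => ?_⟩
  have hvx : (volume (Metric.ball x 1)).toReal = v := by
    simp only [v]; rw [Measure.addHaar_ball_center]
  have h1 : ∫ y in Metric.ball x 1, (f x - C) ≤ ∫ y in Metric.ball x 1, f y := by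
    refine setIntegral_mono_on (by simp [integrableOn_const_iff])
      hd.2.1.integrableOn measurableSet_ball fun y hy => ?_
    have h2 := (abs_le.1 (hC [] (by simp) x y)).2
    have h3 : ‖x - y‖ ≤ 1 := by
      rw [Metric.mem_ball, dist_comm, dist_eq_norm] at hy; exact hy.le
    simp only [pd_nil] at h2
    nlinarith
  have h2 : ∫ y in Metric.ball x 1, f y ≤ 1 := by
    rw [← hd.2.2]
    exact setIntegral_le_integral hd.2.1 (Eventually.of_forall hd.1)
  rw [setIntegral_const, measureReal_def, hvx, smul_eq_mul] at h1
  have h3 : f x - C ≤ v⁻¹ := by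
    rw [← mul_le_mul_iff_right₀ hv, mul_inv_cancel₀ hv.ne']
    linarith
  linarith

/-- Kernels: regular symmetric probability densities supported in the unit ball, with bounds on the
partial derivatives of orders zero to four. -/
structure BoundedKernel (K : Plane → ℝ) (c : ℝ) : Prop where
  regular : Regular K
  nonneg : ∀ x, 0 ≤ K x
  integral : ∫ x, K x = 1
  symmetric : ∀ z, K (-z) = K z
  zero : ∀ l z, 1 < ‖z‖ → pd l K z = 0
  le : ∀ l : List (Fin 2), l.length ≤ 4 → ∀ z, |pd l K z| ≤ c

lemma exists_boundedKernel {K : Plane → ℝ} (hK : KernelAssumptions K) :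
    ∃ c, BoundedKernel K c := by
  have hopen : IsOpen {z : Plane | 1 < ‖z‖} := isOpen_lt continuous_const continuous_norm
  have hzero : ∀ l : List (Fin 2), ∀ z, 1 < ‖z‖ → pd l K z = 0 := by
    intro l
    induction l with
    | nil =>
      intro z hz
      refine image_eq_zero_of_notMem_tsupport ?_
      rw [pd_nil, hK.tsupport_eq]
      simpa using hz
    | cons i l ih =>
      intro z hz
      have : pd l K =ᶠ[𝓝 z] fun _ => 0 := by
        filter_upwards [hopen.mem_nhds hz] with y hy using ih y hy
      rw [pd_cons, partialDeriv, this.fderiv_eq]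
      simp
  obtain ⟨C, hC⟩ := hK.regular.bounded
  have hcs : HasCompactSupport K := by
    rw [HasCompactSupport, hK.tsupport_eq]; exact isCompact_closedBall _ _
  obtain ⟨C', hC'⟩ := hcs.exists_bound_of_continuous hK.contDiff.continuous
  refine ⟨max C C', hK.regular, hK.density.1, hK.density.2.2, hK.symmetric, hzero, fun l hl z => ?_⟩
  rcases Nat.eq_zero_or_pos l.length with h | h
  · rw [List.length_eq_zero_iff] at h
    subst h
    exact (hC' z).trans (le_max_right _ _)
  · exact (hC l h hl z).trans (le_max_left _ _)

variable {K f : Plane → ℝ} {c M : ℝ}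

lemma BoundedKernel.c_nonneg (hK : BoundedKernel K c) : 0 ≤ c :=
  (abs_nonneg _).trans (hK.le [] (by simp) 0)

lemma BoundedDensity.M_nonneg (hf : BoundedDensity f M) : 0 ≤ M := (hf.nonneg 0).trans (hf.le 0)

lemma BoundedKernel.hasCompactSupport (hK : BoundedKernel K c) (l : List (Fin 2)) :
    HasCompactSupport (pd l K) := by
  refine HasCompactSupport.intro (isCompact_closedBall (0 : Plane) 1) fun x hx => ?_
  exact hK.zero l x (by simpa using hx)

lemma BoundedKernel.integrable_mul (hK : BoundedKernel K c) (l : List (Fin 2)) (hl : l.length ≤ 3)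
    {φ : Plane → ℝ} (hφ : Continuous φ) : Integrable fun z => pd l K z * φ z :=
  ((hK.regular.continuous_pd l hl).mul hφ).integrable_of_hasCompactSupport
    ((hK.hasCompactSupport l).mul_right)

/-! ### Kernel averages -/

/-- The average of `φ` with respect to the kernel of bandwidth `b` centred at `x`. -/
def smooth (K : Plane → ℝ) (b : ℝ) (φ : Plane → ℝ) (x : Plane) : ℝ := ∫ z, K z * φ (x - b • z)

lemma integral_partialDeriv_mul {ψ φ : Plane → ℝ} (hψ : Differentiable ℝ ψ)
    (hφ : Differentiable ℝ φ) {i : Fin 2}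
    (h1 : Integrable fun z => partialDeriv i ψ z * φ z)
    (h2 : Integrable fun z => ψ z * partialDeriv i φ z) (h3 : Integrable fun z => ψ z * φ z) :
    ∫ z, partialDeriv i ψ z * φ z = -∫ z, ψ z * partialDeriv i φ z := by
  have := integral_mul_fderiv_eq_neg_fderiv_mul_of_integrable (μ := volume) (f := ψ) (g := φ)
    (v := EuclideanSpace.single i 1) h1 h2 h3 (fun x _ => hψ x) (fun x _ => hφ x)
  unfold partialDeriv
  linarith

lemma partialDeriv_comp_sub_smul {φ : Plane → ℝ} (hφ : Differentiable ℝ φ) (b : ℝ) (x : Plane)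
    (i : Fin 2) :
    partialDeriv i (fun z => φ (x - b • z)) = fun z => -b * partialDeriv i φ (x - b • z) := by
  funext z
  have h2 : HasFDerivAt (fun z => x - b • z) (-(b • ContinuousLinearMap.id ℝ Plane)) z := by
    exact ((hasFDerivAt_id z).const_smul b).const_sub x
  have h := (hφ _).hasFDerivAt.comp z h2
  have h' : HasFDerivAt (fun z => φ (x - b • z))
    ((fderiv ℝ φ (x - b • z)).comp (-(b • ContinuousLinearMap.id ℝ Plane))) z := h
  rw [partialDeriv, h'.fderiv]
  simp [partialDeriv]

/-- Each integration by parts moves one derivative from the kernel to φ(x − bz) and produces a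
factor b. The derivatives arrive in reverse order, which symmetry of mixed partials undoes. -/
lemma integral_pd_kernel_mul (hK : BoundedKernel K c) (l : List (Fin 2)) (hl : l.length ≤ 3)
    {φ : Plane → ℝ} (hφ : ContDiff ℝ (l.length : ℕ) φ) (b : ℝ) (x : Plane) :
    ∫ z, pd l K z * φ (x - b • z) = b ^ l.length * smooth K b (pd l φ) x := by
  have key : ∀ l : List (Fin 2), l.length ≤ 3 → ∀ φ : Plane → ℝ, ContDiff ℝ (l.length : ℕ) φ →
      ∫ z, pd l K z * φ (x - b • z) = b ^ l.length * smooth K b (pd l.reverse φ) x := by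
    intro l
    induction l with
    | nil => intro _ φ _; simp [smooth]
    | cons i l ih =>
      intro hl φ hφ
      have hl' : l.length ≤ 3 := by simp at hl; omega
      have hφ1 : ContDiff ℝ (l.length : ℕ) (partialDeriv i φ) := contDiff_partialDeriv hφ i
      have hd : Differentiable ℝ φ := hφ.differentiable (by simp)
      have hcomp : Continuous fun z => φ (x - b • z) := hd.continuous.comp (by fun_prop)
      have hcomp1 : Continuous fun z => partialDeriv i φ (x - b • z) :=
        hφ1.continuous.comp (by fun_prop)
      have hd' : Differentiable ℝ fun z => φ (x - b • z) := hd.comp (by fun_prop)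
      have hp := partialDeriv_comp_sub_smul hd b x i
      have h := integral_partialDeriv_mul (hK.regular.differentiable l hl') hd' (i := i)
        (hK.integrable_mul (i :: l) hl hcomp)
        (by rw [hp]; exact hK.integrable_mul l hl' (hcomp1.const_mul (-b)))
        (hK.integrable_mul l hl' hcomp)
      rw [pd_cons, h, hp]
      have e : ∀ z, pd l K z * (-b * partialDeriv i φ (x - b • z)) =
          -b * (pd l K z * partialDeriv i φ (x - b • z)) := fun z => by ring
      simp only [e]
      rw [integral_const_mul, ih hl' _ hφ1, List.reverse_cons, List.length_cons, pow_succ]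
      have : pd (l.reverse ++ [i]) φ = pd l.reverse (partialDeriv i φ) := by
        simp [pd, List.foldr_append]
      rw [this]
      ring
  rw [key l hl φ hφ, pd_perm (List.reverse_perm l) (by simpa using hφ)]

/-- The summands of the estimator of the partial derivative `pd l f x`. -/
def kern (K : Plane → ℝ) (b : ℝ) (l : List (Fin 2)) (x y : Plane) : ℝ :=
  b⁻¹ ^ (2 + l.length) * pd l K (b⁻¹ • (x - y))

/-- The empirical mean of `G` over the first `n` observations. -/
def emp (X : ℕ → Plane) (n : ℕ) (G : Plane → ℝ) : ℝ := (n : ℝ)⁻¹ * ∑ i ∈ Finset.range n, G (X i)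

lemma pd_kde_eq_emp (hK : Regular K) (b : ℝ) (n : ℕ) (X : ℕ → Plane) (l : List (Fin 2))
    (hl : l.length ≤ 4) (x : Plane) : pd l (kde K b n X) x = emp X n (kern K b l x) := by
  rw [pd_kde hK b n X l hl, emp]
  simp only [kern]
  rw [← Finset.mul_sum, ← mul_assoc]
  congr 1
  rw [one_div, mul_inv, pow_add, inv_pow]
  ring

lemma integral_comp_inv_smul_sub {b : ℝ} (hb : 0 < b) (x : Plane) (φ : Plane → ℝ) :
    ∫ y, φ (b⁻¹ • (x - y)) = b ^ 2 * ∫ z, φ z := by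
  rw [integral_sub_left_eq_self (fun w => φ (b⁻¹ • w)) volume x]
  rw [Measure.integral_comp_inv_smul_of_nonneg _ _ hb.le]
  simp

/-- The mean of the estimated partial derivative is the smoothed partial derivative of the density:
the powers of b from the change of variables and the integrations by parts cancel the normalization.
-/
lemma integral_density_mul_kern (hK : BoundedKernel K c) {f : Plane → ℝ} (l : List (Fin 2))
    (hl : l.length ≤ 3) (hf : ContDiff ℝ 3 f) {b : ℝ} (hb : 0 < b) (x : Plane) :
    ∫ y, f y * kern K b l x y = smooth K b (pd l f) x := by
  have h1 : ∀ y, f y * kern K b l x y =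
      b⁻¹ ^ (2 + l.length) * (fun z => pd l K z * f (x - b • z)) (b⁻¹ • (x - y)) := by
    intro y
    simp only [kern]
    rw [smul_inv_smul₀ hb.ne', sub_sub_cancel]
    ring
  simp only [h1]
  rw [integral_const_mul, integral_comp_inv_smul_sub hb x fun z => pd l K z * f (x - b • z),
    integral_pd_kernel_mul hK l hl (hf.of_le (by exact_mod_cast hl)), pow_add, inv_pow, inv_pow]
  field_simp

lemma BoundedKernel.integrable (hK : BoundedKernel K c) : Integrable K := by
  simpa using hK.integrable_mul [] (by simp) (continuous_const (y := (1 : ℝ)))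

lemma abs_smooth_sub_le (hK : BoundedKernel K c) {φ : Plane → ℝ} (hφ : Continuous φ) {b D : ℝ}
    {x : Plane} (h : ∀ z : Plane, ‖z‖ ≤ 1 → |φ (x - b • z) - φ x| ≤ D) :
    |smooth K b φ x - φ x| ≤ D := by
  have hi1 : Integrable fun z => K z * φ (x - b • z) :=
    hK.integrable_mul [] (by simp) (hφ.comp (by fun_prop) : Continuous fun z => φ (x - b • z))
  have hi2 : Integrable fun z => K z * φ x := hK.integrable.mul_const _
  have e : smooth K b φ x - φ x = ∫ z, K z * (φ (x - b • z) - φ x) := by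
    simp only [mul_sub]
    rw [integral_sub hi1 hi2, integral_mul_const, hK.integral, one_mul, smooth]
  rw [e]
  have : ‖∫ z, K z * (φ (x - b • z) - φ x)‖ ≤ ∫ z, K z * D := by
    refine norm_integral_le_of_norm_le (hK.integrable.mul_const _) (Eventually.of_forall fun z => ?_)
    rw [norm_mul, Real.norm_eq_abs, Real.norm_eq_abs, abs_of_nonneg (hK.nonneg z)]
    by_cases hz : ‖z‖ ≤ 1
    · exact mul_le_mul_of_nonneg_left (h z hz) (hK.nonneg z)
    · have : K z = 0 := hK.zero [] z (not_le.1 hz)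
      simp [this]
  rwa [integral_mul_const, hK.integral, one_mul] at this

/-- First order bound on the bias. -/
lemma exists_bias_le (hK : BoundedKernel K c) (hf : Regular f) : ∃ C, 0 ≤ C ∧
    ∀ l : List (Fin 2), l.length ≤ 3 → ∀ b, 0 < b → ∀ x,
      |smooth K b (pd l f) x - pd l f x| ≤ C * b := by
  obtain ⟨C, hC0, hC⟩ := hf.lipschitz
  refine ⟨C, hC0, fun l hl b hb x => ?_⟩
  refine abs_smooth_sub_le hK (hf.continuous_pd l hl) fun z hz => (hC l hl _ _).trans ?_
  rw [sub_sub_cancel_left, norm_neg, norm_smul, Real.norm_eq_abs, abs_of_pos hb]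
  gcongr
  nlinarith

lemma integral_kernel_mul_odd (hK : BoundedKernel K c) (ℓ : Plane →L[ℝ] ℝ) :
    ∫ z, K z * ℓ z = 0 := by
  have h := integral_neg_eq_self (fun z => K z * ℓ z) (volume : Measure Plane)
  simp only [hK.symmetric, map_neg, mul_neg, integral_neg] at h
  linarith

/-- Second order bound on the bias. -/
lemma exists_bias_le_sq (hK : BoundedKernel K c) (hf : Regular f) : ∃ C, 0 ≤ C ∧
    ∀ l : List (Fin 2), l.length ≤ 2 → ∀ b, 0 < b → ∀ x,
      |smooth K b (pd l f) x - pd l f x| ≤ C * b ^ 2 := by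
  obtain ⟨C, hC0, hC⟩ := hf.lipschitz
  refine ⟨2 * C, by positivity, fun l hl b hb x => ?_⟩
  set φ := pd l f
  have hd : Differentiable ℝ φ := hf.differentiable l (by omega)
  have hφc : Continuous φ := hd.continuous
  have hlip : ∀ y, ‖fderiv ℝ φ y - fderiv ℝ φ x‖ ≤ 2 * C * ‖y - x‖ := by
    intro y
    refine ContinuousLinearMap.opNorm_le_bound _ (by positivity) fun v => ?_
    have e : (fderiv ℝ φ y - fderiv ℝ φ x) v = v 0 * (pd (0 :: l) f y - pd (0 :: l) f x) +
        v 1 * (pd (1 :: l) f y - pd (1 :: l) f x) := by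
      rw [sub_apply, fderiv_apply_eq, fderiv_apply_eq]
      simp only [pd_cons, φ]; ring
    rw [e, Real.norm_eq_abs]
    have h0 := hC (0 :: l) (by simp; omega) y x
    have h1 := hC (1 :: l) (by simp; omega) y x
    calc _ ≤ |v 0| * |pd (0 :: l) f y - pd (0 :: l) f x| +
          |v 1| * |pd (1 :: l) f y - pd (1 :: l) f x| := by
          rw [← abs_mul, ← abs_mul]; exact abs_add_le _ _
      _ ≤ ‖v‖ * (C * ‖y - x‖) + ‖v‖ * (C * ‖y - x‖) := by
          gcongr <;> exact abs_coord_le _ _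
      _ = _ := by ring
  have taylor : ∀ y, |φ y - φ x - fderiv ℝ φ x (y - x)| ≤ 2 * C * ‖y - x‖ ^ 2 := by
    intro y
    have := Convex.norm_image_sub_le_of_norm_hasFDerivWithin_le
      (f := fun y => φ y - fderiv ℝ φ x y) (f' := fun y => fderiv ℝ φ y - fderiv ℝ φ x)
      (s := Metric.closedBall x ‖y - x‖) (C := 2 * C * ‖y - x‖)
      (fun z _ => ((hd z).hasFDerivAt.sub (fderiv ℝ φ x).hasFDerivAt).hasFDerivWithinAt)
      (fun z hz => (hlip z).trans (by
        rw [mem_closedBall_iff_norm] at hz; gcongr))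
      (convex_closedBall _ _) (Metric.mem_closedBall_self (norm_nonneg _))
      (by rw [mem_closedBall_iff_norm])
    rw [Real.norm_eq_abs] at this
    refine le_trans (le_of_eq ?_) (this.trans (le_of_eq ?_))
    · congr 1; rw [map_sub]; ring
    · ring
  have hψc : Continuous fun y => φ y - fderiv ℝ φ x (y - x) := by fun_prop
  -- The bound is applied to φ minus its linear part at x. By symmetry of the kernel the linear part
  -- averages to zero, so the bias is unchanged.
  have h := abs_smooth_sub_le hK hψc (b := b) (x := x) (D := 2 * C * b ^ 2) fun z hz => by
    have h1 := taylor (x - b • z)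
    have h2 : ‖x - b • z - x‖ ≤ b := by
      rw [sub_sub_cancel_left, norm_neg, norm_smul, Real.norm_eq_abs, abs_of_pos hb]
      nlinarith
    have h3 : ‖x - b • z - x‖ ^ 2 ≤ b ^ 2 := by gcongr
    simp only [sub_self, map_zero, sub_zero]
    refine le_trans (le_of_eq ?_) (h1.trans (by gcongr))
    congr 1; ring
  have e : smooth K b (fun y => φ y - fderiv ℝ φ x (y - x)) x = smooth K b φ x := by
    simp only [smooth]
    have e1 : ∀ z, K z * (φ (x - b • z) - fderiv ℝ φ x (x - b • z - x)) =
        K z * φ (x - b • z) + b * (K z * fderiv ℝ φ x z) := by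
      intro z
      rw [sub_sub_cancel_left, map_neg, map_smul, smul_eq_mul]; ring
    simp only [e1]
    have hi1 : Integrable fun z => K z * φ (x - b • z) :=
      hK.integrable_mul [] (by simp) (hφc.comp (by fun_prop) : Continuous fun z => φ (x - b • z))
    have hi2 : Integrable fun z => K z * fderiv ℝ φ x z :=
      hK.integrable_mul [] (by simp) (fderiv ℝ φ x).continuous
    rw [integral_add hi1 (hi2.const_mul b), integral_const_mul, integral_kernel_mul_odd hK]
    ring
  rw [e] at h
  simpa using h

/-! ### Empirical means of an i.i.d. sample -/

/-- `X` is an i.i.d. sample from the density `f`. -/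
structure IsSample {Ω : Type*} [MeasurableSpace Ω] (P : Measure Ω) (f : Plane → ℝ)
    (X : ℕ → Ω → Plane) : Prop where
  indep : iIndepFun X P
  law : ∀ i, HasLaw (X i) (volume.withDensity fun x => ENNReal.ofReal (f x)) P

section Sample

variable {Ω : Type*} [MeasurableSpace Ω] {P : Measure Ω}
  {f : Plane → ℝ} {M : ℝ} {X : ℕ → Ω → Plane}

lemma IsSample.aemeasurable_comp (hX : IsSample P f X) {G : Plane → ℝ} (hG : Measurable G) (i : ℕ) :
    AEMeasurable (fun ω => G (X i ω)) P := hG.comp_aemeasurable (hX.law i).aemeasurable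

lemma IsSample.integral_comp (hX : IsSample P f X) (hf : BoundedDensity f M) {E : Type*}
    [NormedAddCommGroup E] [NormedSpace ℝ E] {G : Plane → E} (hG : StronglyMeasurable G) (i : ℕ) :
    ∫ ω, G (X i ω) ∂P = ∫ y, f y • G y := by
  have h := (hX.law i).integral_comp (f := G) hG.aestronglyMeasurable
  have hm : Measurable fun x => ENNReal.ofReal (f x) :=
    (hf.regular.contDiff.continuous.measurable).ennreal_ofReal
  rw [integral_withDensity_eq_integral_toReal_smul hm (by simp)] at h
  simp only [ENNReal.toReal_ofReal (hf.nonneg _)] at h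
  exact h

lemma IsSample.memLp_comp [IsFiniteMeasure P] (hX : IsSample P f X) {G : Plane → ℝ} (hG : Measurable G) {c : ℝ}
    (hc : ∀ y, |G y| ≤ c) (p : ENNReal) (i : ℕ) : MemLp (fun ω => G (X i ω)) p P :=
  MemLp.of_bound (hX.aemeasurable_comp hG i).aestronglyMeasurable c
    (Eventually.of_forall fun _ => hc _)

lemma IsSample.indep_comp (hX : IsSample P f X) {G : Plane → ℝ} (hG : Measurable G) :
    iIndepFun (fun i ω => G (X i ω)) P := hX.indep.comp (fun _ => G) fun _ => hG

lemma emp_sub_eq {n : ℕ} (hn : n ≠ 0) (x : ℕ → Plane) (G : Plane → ℝ) (m : ℝ) :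
    emp x n G - m = (n : ℝ)⁻¹ * ∑ i ∈ Finset.range n, (G (x i) - m) := by
  have : (n : ℝ) ≠ 0 := by exact_mod_cast hn
  rw [emp, Finset.sum_sub_distrib, Finset.sum_const, Finset.card_range, nsmul_eq_mul, mul_sub,
    inv_mul_cancel_left₀ this]

variable [IsProbabilityMeasure P]

/-- Mean square deviation of an empirical mean from its expectation. -/
lemma IsSample.meanSq_emp_le (hX : IsSample P f X) (hf : BoundedDensity f M) {G : Plane → ℝ}
    (hG : Measurable G) {c : ℝ} (hc : ∀ y, |G y| ≤ c) {n : ℕ} (hn : n ≠ 0) :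
    ∫ ω, (emp (fun i => X i ω) n G - ∫ y, f y * G y) ^ 2 ∂P ≤ (n : ℝ)⁻¹ * ∫ y, f y * G y ^ 2 := by
  have hmean : ∀ i, ∫ ω, G (X i ω) ∂P = ∫ y, f y * G y := fun i =>
    hX.integral_comp hf hG.stronglyMeasurable i
  have hn' : (n : ℝ) ≠ 0 := by exact_mod_cast hn
  have hL := fun i => hX.memLp_comp hG hc 2 i
  have hvar : ∀ i, variance (fun ω => G (X i ω)) P ≤ ∫ y, f y * G y ^ 2 := by
    intro i
    have h1 := variance_le_expectation_sq (hL i).1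
    have h2 := hX.integral_comp hf (hG.pow_const 2).stronglyMeasurable i
    simp only [smul_eq_mul] at h2
    rw [← h2]
    exact h1
  have hsum := IndepFun.variance_sum (s := Finset.range n) (fun i _ => hL i)
    (fun i _ j _ hij => (hX.indep_comp hG).indepFun hij)
  have hEsum : ∫ ω, (∑ i ∈ Finset.range n, fun ω => G (X i ω)) ω ∂P = n * ∫ y, f y * G y := by
    simp only [Finset.sum_apply]
    rw [integral_finsetSum _ fun i _ => (hL i).integrable (by norm_num)]
    simp [hmean]
  have hLs : MemLp (∑ i ∈ Finset.range n, fun ω => G (X i ω)) 2 P := memLp_finsetSum' _ fun i _ => hL i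
  have e : ∀ ω, (emp (fun i => X i ω) n G - ∫ y, f y * G y) ^ 2 = (n : ℝ)⁻¹ ^ 2 *
      ((∑ i ∈ Finset.range n, fun ω => G (X i ω)) ω -
        ∫ ω, (∑ i ∈ Finset.range n, fun ω => G (X i ω)) ω ∂P) ^ 2 := by
    intro ω
    rw [hEsum, emp, Finset.sum_apply, ← mul_pow, mul_sub, inv_mul_cancel_left₀ hn']
  simp only [e]
  rw [integral_const_mul, ← variance_eq_integral hLs.aemeasurable, hsum]
  calc _ ≤ (n : ℝ)⁻¹ ^ 2 * ∑ i ∈ Finset.range n, ∫ y, f y * G y ^ 2 := by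
        gcongr with i _
        exact hvar i
    _ = _ := by
        rw [Finset.sum_const, Finset.card_range, nsmul_eq_mul]
        field_simp

lemma IsSample.memLp_emp (hX : IsSample P f X) {G : Plane → ℝ} (hG : Measurable G) {c : ℝ}
    (hc : ∀ y, |G y| ≤ c) (p : ENNReal) (n : ℕ) :
    MemLp (fun ω => emp (fun i => X i ω) n G) p P := by
  have : MemLp (fun ω => ∑ i ∈ Finset.range n, G (X i ω)) p P :=
    memLp_finsetSum _ fun i _ => hX.memLp_comp hG hc p i
  exact this.const_mul _

/-! ### Exponential tail bounds for empirical means -/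

lemma exp_le_one_add_add_sq {x : ℝ} (hx : |x| ≤ 1) : Real.exp x ≤ 1 + x + x ^ 2 := by
  have := (abs_le.1 (Real.abs_exp_sub_one_sub_id_le hx)).2
  linarith

/-- Chernoff's method with e^z ≤ 1 + z + z², valid since 2cs ≤ 1 keeps s times a centred summand in
[−1, 1]. The parameter s stays free so that it can be tuned to the bandwidth. -/
lemma IsSample.tail_upper (hX : IsSample P f X) (hf : BoundedDensity f M) {G : Plane → ℝ}
    (hG : Measurable G) {c s : ℝ} (hc : ∀ y, |G y| ≤ c) (hs : 0 ≤ s) (hsc : 2 * c * s ≤ 1) {n : ℕ}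
    (hn : n ≠ 0) (δ : ℝ) :
    P.real {ω | δ ≤ emp (fun i => X i ω) n G - ∫ y, f y * G y} ≤
      Real.exp (-(n * (s * δ - s ^ 2 * ∫ y, f y * G y ^ 2))) := by
  set m := ∫ y, f y * G y
  set v := ∫ y, f y * G y ^ 2
  have hn' : (0 : ℝ) < n := by exact_mod_cast Nat.pos_of_ne_zero hn
  have hmean : ∀ i, ∫ ω, G (X i ω) ∂P = m := fun i => hX.integral_comp hf hG.stronglyMeasurable i
  have hL := fun i => hX.memLp_comp hG hc 2 i
  have hGint := fun i => (hL i).integrable (by norm_num : (1 : ENNReal) ≤ 2)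
  have hm : |m| ≤ c := by
    rw [← hmean 0]
    have h := norm_integral_le_of_norm_le_const (μ := P)
      (Eventually.of_forall fun ω => hc (X 0 ω) : ∀ᵐ ω ∂P, ‖G (X 0 ω)‖ ≤ c)
    simpa using h
  set Z : ℕ → Ω → ℝ := fun i ω => G (X i ω) - m
  have hZb : ∀ i ω, |s * Z i ω| ≤ 1 := by
    intro i ω
    rw [abs_mul, abs_of_nonneg hs]
    have : |Z i ω| ≤ 2 * c := (abs_sub _ _).trans (by linarith [hc (X i ω)])
    nlinarith
  have hZm : ∀ i, AEMeasurable (Z i) P := fun i => (hX.aemeasurable_comp hG i).sub_const _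
  have hZi : iIndepFun Z P := hX.indep.comp (fun _ y => G y - m) fun _ => hG.sub_const _
  have hmgf : ∀ i, mgf (Z i) P s ≤ Real.exp (s ^ 2 * v) := by
    intro i
    have hvar : ∫ ω, (Z i ω) ^ 2 ∂P ≤ v := by
      have h1 := variance_le_expectation_sq (hL i).1
      rw [variance_eq_integral (hL i).aemeasurable, hmean i] at h1
      have h2 := hX.integral_comp hf (hG.pow_const 2).stronglyMeasurable i
      simp only [smul_eq_mul] at h2
      simp only [v]
      rw [← h2]
      exact h1
    have hZ2 : Integrable (fun ω => (Z i ω) ^ 2) P := ((hL i).sub (memLp_const m)).integrable_sq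
    have hZ1 : Integrable (Z i) P := (hGint i).sub (integrable_const m)
    have hint : Integrable (fun ω => 1 + s * Z i ω + s ^ 2 * (Z i ω) ^ 2) P :=
      ((integrable_const 1).add (hZ1.const_mul s)).add (hZ2.const_mul _)
    calc mgf (Z i) P s ≤ ∫ ω, (1 + s * Z i ω + s ^ 2 * (Z i ω) ^ 2) ∂P := by
          rw [mgf]
          refine integral_mono_of_nonneg (Eventually.of_forall fun _ => (Real.exp_pos _).le) hint
            (Eventually.of_forall fun ω => ?_)
          have := exp_le_one_add_add_sq (hZb i ω)
          simp only [mul_pow] at this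
          exact this
      _ = 1 + s ^ 2 * ∫ ω, (Z i ω) ^ 2 ∂P := by
          rw [integral_add (f := fun ω => 1 + s * Z i ω)
            ((integrable_const 1).add (hZ1.const_mul s)) (hZ2.const_mul _),
            integral_add (integrable_const 1) (hZ1.const_mul s), integral_const_mul,
            integral_const_mul]
          have : ∫ ω, Z i ω ∂P = 0 := by
            simp only [Z]
            rw [integral_sub (hGint i) (integrable_const m), hmean i]
            simp
          simp [this]
      _ ≤ 1 + s ^ 2 * v := by gcongr
      _ ≤ _ := by linarith [Real.add_one_le_exp (s ^ 2 * v)]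
  have hmgfsum : mgf (∑ i ∈ Finset.range n, Z i) P s ≤ Real.exp (n * (s ^ 2 * v)) := by
    rw [hZi.mgf_sum₀ hZm]
    calc _ ≤ ∏ i ∈ Finset.range n, Real.exp (s ^ 2 * v) :=
          Finset.prod_le_prod (fun _ _ => mgf_nonneg) fun i _ => hmgf i
      _ = _ := by rw [Finset.prod_const, Finset.card_range, ← Real.exp_nat_mul]
  have hset : {ω | δ ≤ emp (fun i => X i ω) n G - m} =
      {ω | n * δ ≤ (∑ i ∈ Finset.range n, Z i) ω} := by
    ext ω
    simp only [Set.mem_ofPred_eq]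
    rw [emp_sub_eq hn, Finset.sum_apply, le_inv_mul_iff₀ hn']
  have hint : Integrable (fun ω => Real.exp (s * (∑ i ∈ Finset.range n, Z i) ω)) P := by
    refine Integrable.of_bound (C := Real.exp n) ?_ ?_
    · have : AEMeasurable (∑ i ∈ Finset.range n, Z i) P :=
        Finset.aemeasurable_sum _ fun i _ => hZm i
      exact (Real.measurable_exp.comp_aemeasurable (this.const_mul s)).aestronglyMeasurable
    · refine Eventually.of_forall fun ω => ?_
      rw [Real.norm_eq_abs, Real.abs_exp, Finset.sum_apply, Finset.mul_sum]
      gcongr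
      calc _ ≤ ∑ i ∈ Finset.range n, (1 : ℝ) :=
            Finset.sum_le_sum fun i _ => (le_abs_self _).trans (hZb i ω)
        _ = n := by simp
  rw [hset]
  refine (measure_ge_le_exp_mul_mgf _ hs hint).trans ?_
  calc _ ≤ Real.exp (-s * (n * δ)) * Real.exp (n * (s ^ 2 * v)) := by gcongr
    _ = _ := by rw [← Real.exp_add]; congr 1; ring

lemma IsSample.tail (hX : IsSample P f X) (hf : BoundedDensity f M) {G : Plane → ℝ}
    (hG : Measurable G) {c s : ℝ} (hc : ∀ y, |G y| ≤ c) (hs : 0 ≤ s) (hsc : 2 * c * s ≤ 1) {n : ℕ}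
    (hn : n ≠ 0) (δ : ℝ) :
    P.real {ω | δ ≤ |emp (fun i => X i ω) n G - ∫ y, f y * G y|} ≤
      2 * Real.exp (-(n * (s * δ - s ^ 2 * ∫ y, f y * G y ^ 2))) := by
  have h1 := hX.tail_upper hf hG hc hs hsc hn δ
  have h2 := hX.tail_upper hf (G := fun y => -G y) hG.neg (c := c) (fun y => by simpa using hc y) hs hsc hn δ
  have e1 : ∀ ω, emp (fun i => X i ω) n (fun y => -G y) - ∫ y, f y * -G y =
      -(emp (fun i => X i ω) n G - ∫ y, f y * G y) := by
    intro ω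
    simp only [emp, Finset.sum_neg_distrib, mul_neg, integral_neg]
    ring
  simp only [e1, neg_sq] at h2
  have hsub : {ω | δ ≤ |emp (fun i => X i ω) n G - ∫ y, f y * G y|} ⊆
      {ω | δ ≤ emp (fun i => X i ω) n G - ∫ y, f y * G y} ∪
      {ω | δ ≤ -(emp (fun i => X i ω) n G - ∫ y, f y * G y)} := by
    intro ω hω
    simp only [Set.mem_union, Set.mem_ofPred_eq] at hω ⊢
    exact le_abs.1 hω
  calc _ ≤ _ := measureReal_mono hsub
    _ ≤ _ := measureReal_union_le _ _
    _ ≤ _ := by linarith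

end Sample

/-! ### Moments of the summands of the estimator -/

section Kern

variable {K f : Plane → ℝ} {c M : ℝ}

lemma BoundedKernel.measurable_kern (hK : BoundedKernel K c) (b : ℝ) {l : List (Fin 2)}
    (hl : l.length ≤ 3) (x : Plane) : Measurable (kern K b l x) := by
  have := hK.regular.continuous_pd l hl
  have h2 : Continuous (kern K b l x) := by
    unfold kern
    exact continuous_const.mul (this.comp (by fun_prop))
  exact h2.measurable

lemma BoundedKernel.abs_kern_le (hK : BoundedKernel K c) {b : ℝ} (hb : 0 < b) {l : List (Fin 2)}
    (hl : l.length ≤ 3) (x y : Plane) : |kern K b l x y| ≤ c * b⁻¹ ^ (2 + l.length) := by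
  rw [kern, abs_mul, abs_of_nonneg (by positivity), mul_comm]
  gcongr
  exact hK.le l (by omega) _

/-- The volume of the unit disc. -/
def discVol : ℝ := (volume (Metric.closedBall (0 : Plane) 1)).toReal

lemma discVol_nonneg : 0 ≤ discVol := ENNReal.toReal_nonneg

lemma volume_closedBall_eq {b : ℝ} (hb : 0 ≤ b) (x : Plane) :
    (volume (Metric.closedBall x b)).toReal = b ^ 2 * discVol := by
  rw [Measure.addHaar_closedBall_center, ← mul_one b, Measure.addHaar_closedBall_mul _ _ hb zero_le_one,
    ENNReal.toReal_mul, ENNReal.toReal_ofReal (by positivity)]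
  simp [discVol]

lemma BoundedKernel.kern_eq_zero (hK : BoundedKernel K c) {b : ℝ} (hb : 0 < b) (l : List (Fin 2))
    {x y : Plane} (h : y ∉ Metric.closedBall x b) : kern K b l x y = 0 := by
  rw [kern, hK.zero l _ ?_, mul_zero]
  rw [Metric.mem_closedBall, not_le, dist_comm, dist_eq_norm] at h
  rw [norm_smul, norm_inv, Real.norm_eq_abs, abs_of_pos hb, inv_mul_eq_div, one_lt_div hb]
  exact h

/-- A function that vanishes off a disc and is bounded there by `A`. -/
lemma BoundedDensity.integral_mul_sq_le (hf : BoundedDensity f M) {G : Plane → ℝ} {A b : ℝ}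
    (hb : 0 ≤ b) (x : Plane) (hA : ∀ y, |G y| ≤ A) (h0 : ∀ y ∉ Metric.closedBall x b, G y = 0) :
    ∫ y, f y * G y ^ 2 ≤ M * A ^ 2 * (b ^ 2 * discVol) := by
  have h1 : ∫ y, f y * G y ^ 2 ≤ ∫ y, (Metric.closedBall x b).indicator (fun _ => M * A ^ 2) y := by
    refine integral_mono_of_nonneg (Eventually.of_forall fun y => ?_) ?_
      (Eventually.of_forall fun y => ?_)
    · exact mul_nonneg (hf.nonneg y) (sq_nonneg _)
    · exact (integrable_indicator_iff Metric.isClosed_closedBall.measurableSet).2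
        (integrableOn_const (isCompact_closedBall x b).measure_lt_top.ne)
    · by_cases hy : y ∈ Metric.closedBall x b
      · rw [Set.indicator_of_mem hy]
        refine mul_le_mul (hf.le y) ?_ (sq_nonneg _) hf.M_nonneg
        exact sq_le_sq' (abs_le.1 (hA y)).1 (abs_le.1 (hA y)).2
      · simp [Set.indicator_of_notMem hy, h0 y hy]
  refine h1.trans (le_of_eq ?_)
  rw [integral_indicator Metric.isClosed_closedBall.measurableSet, setIntegral_const,
    measureReal_def, volume_closedBall_eq hb, smul_eq_mul]
  ring

/-- The summand is of size b^(−2−k), with k the order of the derivative, and lives on a disc of area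
of order b². -/
lemma integral_density_mul_kern_sq_le (hK : BoundedKernel K c) (hf : BoundedDensity f M) {b : ℝ}
    (hb : 0 < b) {l : List (Fin 2)} (hl : l.length ≤ 3) (x : Plane) :
    ∫ y, f y * kern K b l x y ^ 2 ≤ M * c ^ 2 * discVol * b⁻¹ ^ (2 + 2 * l.length) := by
  refine (hf.integral_mul_sq_le hb.le x (hK.abs_kern_le hb hl x)
    (fun y hy => hK.kern_eq_zero hb l hy)).trans (le_of_eq ?_)
  have : (b⁻¹ ^ (2 + l.length)) ^ 2 * b ^ 2 = b⁻¹ ^ (2 + 2 * l.length) := by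
    rw [← pow_mul, show (2 + l.length) * 2 = (2 + 2 * l.length) + 2 by ring, pow_add _ _ 2, mul_assoc,
      ← mul_pow, inv_mul_cancel₀ hb.ne', one_pow, mul_one]
  rw [← this]
  ring

end Kern

/-! ### Consequences of the bandwidth assumptions -/

section Bandwidth

variable {h : ℕ → ℝ}

lemma BandwidthAssumptions.eventually_le_one (hh : BandwidthAssumptions h) :
    ∀ᶠ n in atTop, h n ≤ 1 :=
  (hh.tendsto_zero.eventually_lt_const one_pos).mono fun _ => le_of_lt

lemma tendsto_log_natCast : Tendsto (fun n : ℕ => Real.log n) atTop atTop :=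
  Real.tendsto_log_atTop.comp tendsto_natCast_atTop_atTop

/-- The factor 3 turns the tail exp(−κnh⁸) into at most n⁻³, which beats the n² points of the grid
in the union bound. -/
lemma BandwidthAssumptions.eventually_log_le (hh : BandwidthAssumptions h) {κ : ℝ} (hκ : 0 < κ) :
    ∀ᶠ n : ℕ in atTop, 3 * Real.log n ≤ κ * (n * h n ^ 8) := by
  filter_upwards [hh.lower.eventually_ge_atTop 1, tendsto_log_natCast.eventually_ge_atTop 1,
    tendsto_log_natCast.eventually_ge_atTop (3 / κ)] with n h1 h2 h3
  have hl : 0 < Real.log n := by linarith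
  rw [le_div_iff₀ (by positivity), one_mul] at h1
  rw [div_le_iff₀ hκ] at h3
  have h4 : Real.log n ^ 2 ≤ Real.log n ^ 3 := pow_le_pow_right₀ h2 (by norm_num)
  calc 3 * Real.log n ≤ Real.log n * κ * Real.log n := by gcongr
    _ = κ * Real.log n ^ 2 := by ring
    _ ≤ _ := by gcongr; linarith

lemma BandwidthAssumptions.tendsto_mul_pow (hh : BandwidthAssumptions h) {k : ℕ} (hk : k ≤ 8) :
    Tendsto (fun n : ℕ => (n : ℝ) * h n ^ k) atTop atTop := by
  have h8 : Tendsto (fun n : ℕ => 3 * Real.log n) atTop atTop :=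
    tendsto_log_natCast.const_mul_atTop (by norm_num)
  refine tendsto_atTop_mono' _ ?_ h8
  filter_upwards [hh.eventually_log_le one_pos, hh.eventually_le_one] with n h1 h2
  rw [one_mul] at h1
  refine h1.trans ?_
  gcongr ?_ * ?_
  exact pow_le_pow_of_le_one (hh.pos n).le h2 hk

/-- The square of the expression is nh⁹ · h, a convergent sequence times a null sequence. -/
lemma BandwidthAssumptions.tendsto_bias (hh : BandwidthAssumptions h) :
    Tendsto (fun n : ℕ => √((n : ℝ) * h n ^ 6) * h n ^ 2) atTop (𝓝 0) := by
  obtain ⟨β, -, hβ⟩ := hh.upper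
  have h1 : Tendsto (fun n : ℕ => √((n : ℝ) * h n ^ 9 * h n)) atTop (𝓝 (√(β * 0))) :=
    (Real.continuous_sqrt.tendsto _).comp (hβ.mul hh.tendsto_zero)
  rw [mul_zero, Real.sqrt_zero] at h1
  refine h1.congr fun n => ?_
  rw [← Real.sqrt_sq (by positivity : 0 ≤ h n ^ 2), ← Real.sqrt_mul (by have := hh.pos n; positivity)]
  congr 1; ring

end Bandwidth

/-! ### Uniform consistency of the derivatives of the estimator -/

lemma exists_grid (x₀ : Plane) {R : ℝ} (hR : 0 ≤ R) {n : ℕ} (hn : n ≠ 0) :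
    ∃ S : Finset Plane, (S.card : ℝ) ≤ ((2 * R + 5) * n) ^ 2 ∧
      ∀ x ∈ Metric.closedBall x₀ R, ∃ p ∈ S, ‖x - p‖ ≤ 2 * (n : ℝ)⁻¹ := by
  classical
  have hn' : (0 : ℝ) < n := by exact_mod_cast Nat.pos_of_ne_zero hn
  have hn1 : (1 : ℝ) ≤ n := by exact_mod_cast Nat.one_le_iff_ne_zero.2 hn
  set N : ℤ := ⌈R * n⌉ + 1
  have hN : (N : ℝ) ≤ R * n + 2 := by
    have := Int.ceil_lt_add_one (R * n)
    simp only [N]; push_cast; linarith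
  have hN0 : 0 ≤ N := by
    have : 0 ≤ ⌈R * n⌉ := Int.ceil_nonneg (by positivity)
    omega
  set pt : ℤ × ℤ → Plane := fun q => x₀ + !₂[(q.1 : ℝ) / n, (q.2 : ℝ) / n]
  refine ⟨(Finset.Icc (-N) N ×ˢ Finset.Icc (-N) N).image pt, ?_, fun x hx => ?_⟩
  · have h1 : (((Finset.Icc (-N) N ×ˢ Finset.Icc (-N) N).image pt).card : ℝ) ≤
        ((Finset.Icc (-N) N ×ˢ Finset.Icc (-N) N).card : ℝ) := by
      exact_mod_cast Finset.card_image_le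
    have h2 : ((Finset.Icc (-N) N).card : ℝ) = 2 * N + 1 := by
      rw [Int.card_Icc]
      have : (((N + 1 - -N).toNat : ℤ) : ℝ) = ((N + 1 - -N : ℤ) : ℝ) := by
        rw [Int.toNat_of_nonneg (by omega)]
      rw [Int.cast_natCast] at this
      rw [this]; push_cast; ring
    rw [Finset.card_product, Nat.cast_mul, h2, ← sq] at h1
    refine h1.trans ?_
    have : (0 : ℝ) ≤ N := by exact_mod_cast hN0
    gcongr
    nlinarith
  · rw [mem_closedBall_iff_norm] at hx
    have hcoord : ∀ i : Fin 2, ⌊(x - x₀) i * n⌋ ∈ Finset.Icc (-N) N := by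
      intro i
      have h1 := (abs_coord_le (x - x₀) i).trans hx
      rw [abs_le] at h1
      have h2 := Int.le_ceil (R * n)
      rw [Finset.mem_Icc]
      constructor
      · rw [Int.le_floor]
        simp only [N]; push_cast
        nlinarith [h1.1]
      · have h3 : ⌊(x - x₀) i * n⌋ ≤ ⌈R * n⌉ := by
          have : (⌊(x - x₀) i * n⌋ : ℝ) ≤ ⌈R * n⌉ :=
            (Int.floor_le _).trans (le_trans (by nlinarith [h1.2]) h2)
          exact_mod_cast this
        omega
    refine ⟨pt (⌊(x - x₀) 0 * n⌋, ⌊(x - x₀) 1 * n⌋), Finset.mem_image.2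
      ⟨_, Finset.mem_product.2 ⟨hcoord 0, hcoord 1⟩, rfl⟩, ?_⟩
    have hfl : ∀ t : ℝ, |t - (⌊t * n⌋ : ℝ) / n| ≤ (n : ℝ)⁻¹ := by
      intro t
      have e : t - (⌊t * n⌋ : ℝ) / n = (t * n - ⌊t * n⌋) * (n : ℝ)⁻¹ := by field_simp
      rw [e, abs_mul, abs_of_pos (inv_pos.2 hn'),
        abs_of_nonneg (by linarith [Int.floor_le (t * n)])]
      have := Int.lt_floor_add_one (t * n)
      have h3 := inv_pos.2 hn'
      nlinarith
    refine (norm_le_sum_abs _).trans ?_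
    rw [Fin.sum_univ_two]
    have h0 := hfl ((x - x₀) 0)
    have h1 := hfl ((x - x₀) 1)
    have e0 : (x - pt (⌊(x - x₀) 0 * n⌋, ⌊(x - x₀) 1 * n⌋)) 0 =
        (x - x₀) 0 - (⌊(x - x₀) 0 * n⌋ : ℝ) / n := by
      simp [pt]; ring
    have e1 : (x - pt (⌊(x - x₀) 0 * n⌋, ⌊(x - x₀) 1 * n⌋)) 1 =
        (x - x₀) 1 - (⌊(x - x₀) 1 * n⌋ : ℝ) / n := by
      simp [pt]; ring
    rw [e0, e1]
    linarith

section Uniform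

variable {Ω : Type*} [MeasurableSpace Ω] {P : Measure Ω} [IsProbabilityMeasure P]
  {K f : Plane → ℝ} {c M : ℝ} {X : ℕ → Ω → Plane} {h : ℕ → ℝ}

/-- Exponential inequality for the estimator of a partial derivative at a point. -/
lemma IsSample.exists_kern_tail (hX : IsSample P f X) (hf : BoundedDensity f M)
    (hK : BoundedKernel K c) {δ : ℝ} (hδ : 0 < δ) :
    ∃ κ > 0, ∀ l : List (Fin 2), l.length ≤ 3 → ∀ b, 0 < b → b ≤ 1 → ∀ n : ℕ, n ≠ 0 → ∀ x,
      P.real {ω | δ ≤ |emp (fun i => X i ω) n (kern K b l x) - ∫ y, f y * kern K b l x y|} ≤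
        2 * Real.exp (-(κ * (n * b ^ 8))) := by
  have hc := hK.c_nonneg
  set A := M * c ^ 2 * discVol
  have hA : 0 ≤ A := mul_nonneg (mul_nonneg hf.M_nonneg (sq_nonneg c)) discVol_nonneg
  -- The Chernoff parameter will be s₀b⁸. The first entry keeps the variance term below half of the
  -- linear term, the second keeps the summands in the range of the exponential bound. The powers
  -- b⁻⁸ and b⁻⁵ are the worst cases, attained at order three.
  set s₀ := min (δ / (2 * (A + 1))) (1 / (2 * (c + 1)))
  have hs₀ : 0 < s₀ := by positivity
  have hs₀A : s₀ * A ≤ δ / 2 := by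
    have : s₀ ≤ δ / (2 * (A + 1)) := min_le_left _ _
    rw [le_div_iff₀ (by positivity)] at this
    nlinarith
  have hs₀c : 2 * c * s₀ ≤ 1 := by
    have : s₀ ≤ 1 / (2 * (c + 1)) := min_le_right _ _
    rw [le_div_iff₀ (by positivity)] at this
    nlinarith
  refine ⟨s₀ * (δ / 2), by positivity, fun l hl b hb hb1 n hn x => ?_⟩
  have hbi : 1 ≤ b⁻¹ := (one_le_inv₀ hb).2 hb1
  have habs : ∀ y, |kern K b l x y| ≤ c * b⁻¹ ^ 5 := fun y =>
    (hK.abs_kern_le hb hl x y).trans (by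
      gcongr ?_ * ?_
      exact pow_le_pow_right₀ hbi (by omega))
  have hv : ∫ y, f y * kern K b l x y ^ 2 ≤ A * b⁻¹ ^ 8 :=
    (integral_density_mul_kern_sq_le hK hf hb hl x).trans (by
      gcongr ?_ * ?_
      exact pow_le_pow_right₀ hbi (by omega))
  have hsc : 2 * (c * b⁻¹ ^ 5) * (s₀ * b ^ 8) ≤ 1 := by
    have e : 2 * (c * b⁻¹ ^ 5) * (s₀ * b ^ 8) = 2 * c * s₀ * b ^ 3 := by field_simp
    rw [e]
    exact mul_le_one₀ hs₀c (by positivity) (pow_le_one₀ hb.le hb1)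
  refine (hX.tail hf (hK.measurable_kern b hl x) habs (by positivity) hsc hn δ).trans ?_
  gcongr 2 * Real.exp (-?_)
  have h1 : (s₀ * b ^ 8) ^ 2 * ∫ y, f y * kern K b l x y ^ 2 ≤ s₀ * b ^ 8 * (δ / 2) := by
    calc _ ≤ (s₀ * b ^ 8) ^ 2 * (A * b⁻¹ ^ 8) := by gcongr
      _ = s₀ * b ^ 8 * (s₀ * A) := by field_simp
      _ ≤ _ := by gcongr
  calc s₀ * (δ / 2) * (n * b ^ 8) = n * (s₀ * b ^ 8 * δ - s₀ * b ^ 8 * (δ / 2)) := by ring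
    _ ≤ _ := by gcongr

lemma BoundedKernel.exists_pd_kde_lipschitz (hK : BoundedKernel K c) : ∃ C, 0 ≤ C ∧
    ∀ l : List (Fin 2), l.length ≤ 3 → ∀ b, 0 < b → b ≤ 1 → ∀ (n : ℕ) (Y : ℕ → Plane) (x y : Plane),
      |pd l (kde K b n Y) x - pd l (kde K b n Y) y| ≤ C * b⁻¹ ^ 6 * ‖x - y‖ := by
  obtain ⟨C, hC0, hC⟩ := hK.regular.lipschitz
  refine ⟨C, hC0, fun l hl b hb hb1 n Y x y => ?_⟩
  have hbi : 1 ≤ b⁻¹ := (one_le_inv₀ hb).2 hb1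
  rw [pd_kde_eq_emp hK.regular b n Y l (by omega), pd_kde_eq_emp hK.regular b n Y l (by omega),
    emp, emp, ← mul_sub, ← Finset.sum_sub_distrib, abs_mul, abs_of_nonneg (by positivity)]
  have hterm : ∀ i, |kern K b l x (Y i) - kern K b l y (Y i)| ≤ C * b⁻¹ ^ 6 * ‖x - y‖ := by
    intro i
    rw [kern, kern, ← mul_sub, abs_mul, abs_of_nonneg (by positivity)]
    have h1 := hC l hl (b⁻¹ • (x - Y i)) (b⁻¹ • (y - Y i))
    rw [← smul_sub, sub_sub_sub_cancel_right, norm_smul, norm_inv, Real.norm_eq_abs,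
      abs_of_pos hb] at h1
    calc _ ≤ b⁻¹ ^ 5 * (C * (b⁻¹ * ‖x - y‖)) := by
          gcongr ?_ * ?_
          exact pow_le_pow_right₀ hbi (by omega)
      _ = _ := by ring
  rcases Nat.eq_zero_or_pos n with rfl | hn
  · simp; positivity
  · have hn' : (0 : ℝ) < n := by exact_mod_cast hn
    rw [inv_mul_le_iff₀ hn']
    refine (Finset.abs_sum_le_sum_abs _ _).trans ((Finset.sum_le_sum fun i _ => hterm i).trans ?_)
    simp

/-- The error at any point is compared with that at a grid point. Mesh 1/n costs a Lipschitz term of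
order 1/(nh⁶) and the bias is of order h, both eventually at most η/4. The rest is a union bound
over O(n²) points with tails 2n⁻³. -/
lemma IsSample.tendsto_uniform_pd (hX : IsSample P f X) (hf : BoundedDensity f M)
    (hK : BoundedKernel K c) (hh : BandwidthAssumptions h) {l : List (Fin 2)} (hl : l.length ≤ 3)
    (x₀ : Plane) {R η : ℝ} (hR : 0 ≤ R) (hη : 0 < η) :
    Tendsto (fun n => P.real {ω | ∃ x ∈ Metric.closedBall x₀ R,
      η < |pd l (kde K (h n) n fun i => X i ω) x - pd l f x|}) atTop (𝓝 0) := by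
  obtain ⟨κ, hκ, htail⟩ := hX.exists_kern_tail hf hK (half_pos hη)
  obtain ⟨C₁, hC₁0, hC₁⟩ := hK.exists_pd_kde_lipschitz
  obtain ⟨C₂, hC₂0, hC₂⟩ := hf.regular.lipschitz
  obtain ⟨C₃, hC₃0, hC₃⟩ := exists_bias_le hK hf.regular
  have hlim : Tendsto (fun n : ℕ => (2 * R + 5) ^ 2 * 2 * (n : ℝ)⁻¹) atTop (𝓝 0) := by
    have := (tendsto_inv_atTop_nhds_zero_nat (𝕜 := ℝ)).const_mul ((2 * R + 5) ^ 2 * 2)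
    rwa [mul_zero] at this
  have hbias : ∀ᶠ n in atTop, C₃ * h n ≤ η / 4 := by
    have : Tendsto (fun n => C₃ * h n) atTop (𝓝 0) := by simpa using hh.tendsto_zero.const_mul C₃
    exact (this.eventually_lt_const (by positivity)).mono fun _ => le_of_lt
  have hLip : ∀ᶠ n : ℕ in atTop, (C₁ + C₂) * 2 * ((n : ℝ) * h n ^ 6)⁻¹ ≤ η / 4 := by
    have : Tendsto (fun n : ℕ => (C₁ + C₂) * 2 * ((n : ℝ) * h n ^ 6)⁻¹) atTop (𝓝 0) := by
      simpa using (hh.tendsto_mul_pow (k := 6) (by norm_num)).inv_tendsto_atTop.const_mul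
        ((C₁ + C₂) * 2)
    exact (this.eventually_lt_const (by positivity)).mono fun _ => le_of_lt
  refine squeeze_zero' (Eventually.of_forall fun _ => measureReal_nonneg) ?_ hlim
  filter_upwards [hbias, hLip, hh.eventually_log_le hκ, hh.eventually_le_one,
    eventually_ne_atTop 0] with n h1 h2 h3 h4 hn
  set b := h n
  have hb : 0 < b := hh.pos n
  have hbi : 1 ≤ b⁻¹ := (one_le_inv₀ hb).2 h4
  have hn' : (0 : ℝ) < n := by exact_mod_cast Nat.pos_of_ne_zero hn
  obtain ⟨S, hScard, hS⟩ := exists_grid x₀ hR hn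
  have hsub : {ω | ∃ x ∈ Metric.closedBall x₀ R,
      η < |pd l (kde K b n fun i => X i ω) x - pd l f x|} ⊆
      ⋃ p ∈ S, {ω | η / 2 ≤ |emp (fun i => X i ω) n (kern K b l p) - ∫ y, f y * kern K b l p y|} := by
    intro ω hω
    simp only [Set.mem_ofPred_eq] at hω
    obtain ⟨x, hx, hxη⟩ := hω
    obtain ⟨p, hp, hxp⟩ := hS x hx
    simp only [Set.mem_iUnion, Set.mem_ofPred_eq]
    refine ⟨p, hp, ?_⟩
    rw [← pd_kde_eq_emp hK.regular b n _ l (by omega),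
      integral_density_mul_kern hK l hl hf.regular.contDiff hb]
    set g := kde K b n fun i => X i ω
    have e1 : |pd l g x - pd l g p| ≤ C₁ * b⁻¹ ^ 6 * ‖x - p‖ := hC₁ l hl b hb h4 n _ x p
    have e2 : |pd l f x - pd l f p| ≤ C₂ * ‖x - p‖ := hC₂ l hl x p
    have e3 := hC₃ l hl b hb p
    have e4 : C₁ * b⁻¹ ^ 6 * ‖x - p‖ + C₂ * ‖x - p‖ ≤ η / 4 := by
      refine le_trans ?_ h2
      have h6 : 1 ≤ b⁻¹ ^ 6 := one_le_pow₀ hbi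
      calc _ ≤ C₁ * b⁻¹ ^ 6 * ‖x - p‖ + C₂ * b⁻¹ ^ 6 * ‖x - p‖ := by
            gcongr; nlinarith
        _ = (C₁ + C₂) * b⁻¹ ^ 6 * ‖x - p‖ := by ring
        _ ≤ (C₁ + C₂) * b⁻¹ ^ 6 * (2 * (n : ℝ)⁻¹) := by gcongr
        _ = _ := by rw [mul_inv, inv_pow]; ring
    have tri : |pd l g x - pd l f x| ≤ |pd l g x - pd l g p| + |pd l g p - smooth K b (pd l f) p| +
        |smooth K b (pd l f) p - pd l f p| + |pd l f x - pd l f p| := by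
      have t1 := abs_sub_le (pd l g x) (pd l g p) (pd l f x)
      have t2 := abs_sub_le (pd l g p) (smooth K b (pd l f) p) (pd l f x)
      have t3 := abs_sub_le (smooth K b (pd l f) p) (pd l f p) (pd l f x)
      rw [abs_sub_comm (pd l f p)] at t3
      linarith
    linarith
  calc _ ≤ _ := measureReal_mono hsub (measure_ne_top _ _)
    _ ≤ ∑ p ∈ S, _ := measureReal_biUnion_finset_le _ _
    _ ≤ ∑ p ∈ S, 2 * Real.exp (-(3 * Real.log n)) := by
        refine Finset.sum_le_sum fun p _ => (htail l hl b hb h4 n hn p).trans ?_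
        gcongr
    _ = S.card * (2 * ((n : ℝ) ^ 3)⁻¹) := by
        rw [Finset.sum_const, nsmul_eq_mul, Real.exp_neg]
        congr 3
        rw [show (3 : ℝ) * Real.log n = Real.log ((n : ℝ) ^ 3) by rw [Real.log_pow]; norm_num,
          Real.exp_log (by positivity)]
    _ ≤ ((2 * R + 5) * n) ^ 2 * (2 * ((n : ℝ) ^ 3)⁻¹) := by gcongr
    _ = _ := by field_simp

/-- On compact sets the estimator is close to the density in `C³` with probability tending to one. -/
theorem IsSample.tendsto_closeAt (hX : IsSample P f X) (hf : BoundedDensity f M)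
    (hK : BoundedKernel K c) (hh : BandwidthAssumptions h) (x₀ : Plane) (R : ℝ) {η : ℝ}
    (hη : 0 < η) :
    Tendsto (fun n => P.real {ω | ¬ ∀ x ∈ Metric.closedBall x₀ R,
      CloseAt f (kde K (h n) n fun i => X i ω) η x}) atTop (𝓝 0) := by
  have hfin : {l : List (Fin 2) | l.length ≤ 3}.Finite := List.finite_length_le _ _
  set S := hfin.toFinset
  have hlim : Tendsto (fun n => ∑ l ∈ S, P.real {ω | ∃ x ∈ Metric.closedBall x₀ (max R 0),
      η < |pd l (kde K (h n) n fun i => X i ω) x - pd l f x|}) atTop (𝓝 0) := by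
    have := tendsto_finsetSum S fun l hl =>
      hX.tendsto_uniform_pd hf hK hh (hfin.mem_toFinset.1 hl) x₀ (le_max_right R 0) hη
    rwa [Finset.sum_const_zero] at this
  refine squeeze_zero (fun _ => measureReal_nonneg) (fun n => ?_) hlim
  refine le_trans (measureReal_mono ?_ (measure_ne_top _ _)) (measureReal_biUnion_finset_le _ _)
  intro ω hω
  simp only [Set.mem_ofPred_eq, not_forall] at hω
  obtain ⟨x, hx, hxc⟩ := hω
  simp only [CloseAt, not_forall, not_le] at hxc
  obtain ⟨l, -, hl3, hlη⟩ := hxc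
  simp only [Set.mem_iUnion, Set.mem_ofPred_eq]
  exact ⟨l, hfin.mem_toFinset.2 hl3, x, Metric.closedBall_subset_closedBall (le_max_left _ _) hx, hlη⟩

end Uniform

/-! ### Sequences of random variables that vanish in probability -/

section Negligible

variable {Ω : Type*} [MeasurableSpace Ω] {P : Measure Ω}

/-- `P (κ ≤ u n) → 0` for every `κ > 0`. -/
def Negligible (P : Measure Ω) (u : ℕ → Ω → ℝ) : Prop :=
  ∀ κ, 0 < κ → Tendsto (fun n => P.real {ω | κ ≤ u n ω}) atTop (𝓝 0)

lemma Negligible.mono [IsFiniteMeasure P] {u w : ℕ → Ω → ℝ} (hw : Negligible P w)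
    (h : ∀ᶠ n in atTop, ∀ ω, u n ω ≤ w n ω) : Negligible P u := by
  intro κ hκ
  refine squeeze_zero' (Eventually.of_forall fun _ => measureReal_nonneg) ?_ (hw κ hκ)
  filter_upwards [h] with n hn
  exact measureReal_mono fun ω (hω : κ ≤ u n ω) => hω.trans (hn ω)

lemma Negligible.add [IsFiniteMeasure P] {u w : ℕ → Ω → ℝ} (hu : Negligible P u)
    (hw : Negligible P w) : Negligible P fun n ω => u n ω + w n ω := by
  intro κ hκ
  have := (hu (κ / 2) (half_pos hκ)).add (hw (κ / 2) (half_pos hκ))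
  rw [add_zero] at this
  refine squeeze_zero (fun _ => measureReal_nonneg) (fun n => ?_) this
  refine le_trans (measureReal_mono ?_) (measureReal_union_le _ _)
  intro ω hω
  simp only [Set.mem_union, Set.mem_ofPred_eq] at hω ⊢
  by_contra! hc
  linarith [hc.1, hc.2]

lemma Negligible.const_mul {u : ℕ → Ω → ℝ} (hu : Negligible P u) {c : ℝ} (hc : 0 ≤ c) :
    Negligible P fun n ω => c * u n ω := by
  intro κ hκ
  rcases hc.eq_or_lt with rfl | hc
  · simp [hκ.not_ge]
  · refine (hu (κ / c) (div_pos hκ hc)).congr fun n => ?_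
    simp only [div_le_iff₀' hc]

lemma negligible_of_tendsto {e : ℕ → ℝ} (he : Tendsto e atTop (𝓝 0)) :
    Negligible P fun n _ => e n := by
  intro κ hκ
  refine tendsto_const_nhds.congr' ?_
  filter_upwards [he.eventually_lt_const hκ] with n hn
  simp [hn.not_ge]

lemma Negligible.sum [IsFiniteMeasure P] {ι : Type*} (s : Finset ι) {u : ι → ℕ → Ω → ℝ}
    (hu : ∀ i ∈ s, Negligible P (u i)) : Negligible P fun n ω => ∑ i ∈ s, u i n ω := by
  classical
  induction s using Finset.induction_on with
  | empty => simpa using negligible_of_tendsto (P := P) (tendsto_const_nhds (x := (0 : ℝ)))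
  | insert i s hi ih =>
    simp only [Finset.sum_insert hi]
    exact (hu i (by simp)).add (ih fun j hj => hu j (by simp [hj]))

/-- Designed for the inequality |s| ≤ κ + s²/κ, by which a bound on squares controls absolute values
up to an arbitrarily small constant. -/
lemma negligible_of_forall_le_add [IsFiniteMeasure P] {u : ℕ → Ω → ℝ}
    (h : ∀ κ, 0 < κ → ∃ w, Negligible P w ∧ ∀ᶠ n in atTop, ∀ ω, u n ω ≤ κ + w n ω) :
    Negligible P u := by
  intro κ hκ
  obtain ⟨w, hw, hle⟩ := h (κ / 2) (half_pos hκ)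
  refine squeeze_zero' (Eventually.of_forall fun _ => measureReal_nonneg) ?_
    (hw (κ / 2) (half_pos hκ))
  filter_upwards [hle] with n hn
  refine measureReal_mono fun ω (hω : κ ≤ u n ω) => ?_
  have := hn ω
  simp only [Set.mem_ofPred_eq]
  linarith

lemma negligible_of_lintegral_le [IsFiniteMeasure P] {u : ℕ → Ω → ℝ} {e : ℕ → ℝ}
    (hu : ∀ᶠ n in atTop, AEMeasurable (u n) P)
    (hle : ∀ᶠ n in atTop, ∫⁻ ω, ENNReal.ofReal (u n ω) ∂P ≤ ENNReal.ofReal (e n))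
    (he : Tendsto e atTop (𝓝 0)) : Negligible P u := by
  intro κ hκ
  have he' : Tendsto (fun n => κ⁻¹ * max (e n) 0) atTop (𝓝 0) := by
    have h1 : Tendsto (fun n => max (e n) 0) atTop (𝓝 (max 0 0)) := he.max tendsto_const_nhds
    simpa using h1.const_mul κ⁻¹
  refine squeeze_zero' (Eventually.of_forall fun _ => measureReal_nonneg) ?_ he'
  filter_upwards [hu, hle] with n hu hle
  have h1 := (mul_meas_ge_le_lintegral₀ hu.ennreal_ofReal (ENNReal.ofReal κ)).trans hle
  have h2 : {ω | ENNReal.ofReal κ ≤ ENNReal.ofReal (u n ω)} = {ω | κ ≤ u n ω} := by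
    ext ω
    simp only [Set.mem_ofPred_eq]
    rw [ENNReal.ofReal_le_ofReal_iff']
    constructor
    · rintro (h | h)
      · exact h
      · linarith
    · exact Or.inl
  rw [h2] at h1
  have h3 := ENNReal.toReal_mono ENNReal.ofReal_ne_top h1
  rw [ENNReal.toReal_mul, ENNReal.toReal_ofReal hκ.le, ENNReal.toReal_ofReal'] at h3
  rw [le_inv_mul_iff₀ hκ]
  exact h3

end Negligible

/-! ### Families of empirical means indexed by time -/

section Family

variable {Ω : Type*} [MeasurableSpace Ω] {P : Measure Ω} [IsProbabilityMeasure P]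
  {f : Plane → ℝ} {M : ℝ} {X : ℕ → Ω → Plane}

lemma BoundedDensity.continuous_integral_mul (hf : BoundedDensity f M) {G : ℝ → Plane → ℝ}
    (hG : Continuous (Function.uncurry G))
    (hc : ∀ T, ∃ c, ∀ r, |r| ≤ T → ∀ y, |G r y| ≤ c) :
    Continuous fun r => ∫ y, f y * G r y := by
  refine continuous_iff_continuousAt.2 fun r₀ => ?_
  obtain ⟨c, hc⟩ := hc (|r₀| + 1)
  have hfc := hf.regular.contDiff.continuous
  refine continuousAt_of_dominated (bound := fun y => f y * c) ?_ ?_ (hf.integrable.mul_const c) ?_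
  · refine Eventually.of_forall fun r => ?_
    exact (hfc.mul (hG.comp (by fun_prop : Continuous fun y : Plane => (r, y)))).aestronglyMeasurable
  · have : ∀ᶠ r : ℝ in 𝓝 r₀, |r| < |r₀| + 1 :=
      continuous_abs.continuousAt.eventually_lt_const (by linarith)
    filter_upwards [this] with r hr
    refine Eventually.of_forall fun y => ?_
    rw [norm_mul, Real.norm_eq_abs, Real.norm_eq_abs, abs_of_nonneg (hf.nonneg y)]
    exact mul_le_mul_of_nonneg_left (hc r hr.le y) (hf.nonneg y)
  · refine Eventually.of_forall fun y => ?_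
    exact (continuous_const.mul (hG.comp (by fun_prop : Continuous fun r : ℝ => (r, y)))).continuousAt

lemma continuous_emp (n : ℕ) {G : ℝ → Plane → ℝ} (hG : Continuous (Function.uncurry G)) :
    Continuous fun p : (ℕ → Plane) × ℝ => emp p.1 n (G p.2) := by
  unfold emp
  refine continuous_const.mul (continuous_finsetSum _ fun i _ => ?_)
  exact hG.comp (by fun_prop : Continuous fun p : (ℕ → Plane) × ℝ => (p.2, p.1 i))

/-- The expected time integral of the squared deviations of a family of empirical means. -/
lemma IsSample.lintegral_meanSq_le (hX : IsSample P f X) (hf : BoundedDensity f M)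
    {G : ℝ → Plane → ℝ} (hG : Continuous (Function.uncurry G))
    (hc : ∀ T, ∃ c, ∀ r, |r| ≤ T → ∀ y, |G r y| ≤ c) {n : ℕ} (hn : n ≠ 0) {T v : ℝ} (hT : 0 ≤ T)
    (hv : ∀ r, |r| ≤ T → ∫ y, f y * G r y ^ 2 ≤ v) :
    AEMeasurable (fun ω => ∫ r in -T..T,
      (emp (fun i => X i ω) n (G r) - ∫ y, f y * G r y) ^ 2) P ∧
    ∫⁻ ω, ENNReal.ofReal (∫ r in -T..T,
      (emp (fun i => X i ω) n (G r) - ∫ y, f y * G r y) ^ 2) ∂P ≤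
      ENNReal.ofReal ((n : ℝ)⁻¹ * v * (2 * T)) := by
  set F : (ℕ → Plane) × ℝ → ℝ := fun p => (emp p.1 n (G p.2) - ∫ y, f y * G p.2 y) ^ 2
  have hF : Continuous F := ((continuous_emp n hG).sub
    ((hf.continuous_integral_mul hG hc).comp continuous_snd)).pow 2
  have hXm : AEMeasurable (fun ω i => X i ω) P :=
    aemeasurable_pi_lambda _ fun i => (hX.law i).aemeasurable
  have hTT : -T ≤ T := by linarith
  constructor
  · have h1 : Continuous fun ξ : ℕ → Plane => ∫ r in -T..T, F (ξ, r) :=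
      intervalIntegral.continuous_parametric_intervalIntegral_of_continuous'
        (f := fun ξ r => F (ξ, r)) hF _ _
    exact h1.measurable.comp_aemeasurable hXm
  · have h1 : ∀ ω, ENNReal.ofReal (∫ r in -T..T, F ((fun i => X i ω), r)) =
        ∫⁻ r in Set.Ioc (-T) T, ENNReal.ofReal (F ((fun i => X i ω), r)) := by
      intro ω
      rw [intervalIntegral.integral_of_le hTT]
      refine ofReal_integral_eq_lintegral_ofReal ?_ (Eventually.of_forall fun r => sq_nonneg _)
      have : Continuous fun r => F ((fun i => X i ω), r) := hF.comp (by fun_prop)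
      exact (this.intervalIntegrable (-T) T).1
    have hmeas : AEMeasurable (fun p : Ω × ℝ => ENNReal.ofReal (F ((fun i => X i p.1), p.2)))
        (P.prod (volume.restrict (Set.Ioc (-T) T))) := by
      refine (hF.measurable.ennreal_ofReal).comp_aemeasurable ?_
      exact (hXm.comp_quasiMeasurePreserving Measure.quasiMeasurePreserving_fst).prodMk
        measurable_snd.aemeasurable
    calc _ = ∫⁻ ω, (∫⁻ r in Set.Ioc (-T) T, ENNReal.ofReal (F ((fun i => X i ω), r))) ∂P :=
          lintegral_congr h1
      -- Tonelli's theorem reduces the claim to the variance bound at each fixed time.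
      _ = ∫⁻ r in Set.Ioc (-T) T, (∫⁻ ω, ENNReal.ofReal (F ((fun i => X i ω), r)) ∂P) :=
          lintegral_lintegral_swap hmeas
      _ ≤ ∫⁻ r in Set.Ioc (-T) T, ENNReal.ofReal ((n : ℝ)⁻¹ * v) := by
          refine setLIntegral_mono measurable_const fun r hr => ?_
          have hr' : |r| ≤ T := abs_le.2 ⟨hr.1.le, hr.2⟩
          obtain ⟨c, hc⟩ := hc T
          have hGm : Measurable (G r) :=
            (hG.comp (by fun_prop : Continuous fun y : Plane => (r, y))).measurable
          have hint : Integrable (fun ω => F ((fun i => X i ω), r)) P :=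
            ((hX.memLp_emp hGm (hc r hr') 2 n).sub
              (memLp_const (∫ y, f y * G r y))).integrable_sq
          rw [← ofReal_integral_eq_lintegral_ofReal hint (Eventually.of_forall fun ω => sq_nonneg _)]
          refine ENNReal.ofReal_le_ofReal ((hX.meanSq_emp_le hf hGm (hc r hr') hn).trans ?_)
          exact mul_le_mul_of_nonneg_left (hv r hr') (by positivity)
      _ = _ := by
          rw [setLIntegral_const, Real.volume_Ioc]
          by_cases h0 : 0 ≤ (n : ℝ)⁻¹ * v
          · rw [← ENNReal.ofReal_mul h0]
            congr 1; ring
          · have h0' : (n : ℝ)⁻¹ * v ≤ 0 := by linarith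
            rw [ENNReal.ofReal_of_nonpos h0', ENNReal.ofReal_of_nonpos
              (mul_nonpos_of_nonpos_of_nonneg h0' (by linarith)), zero_mul]

end Family

/-! ### Sojourn times of a regular curve -/

section Overlap

variable {γ γ' : ℝ → Plane}

/-- With nonzero velocity the curve leaves a point at once, so the times spent at it are isolated
and form a null set. -/
lemma volume_level_eq_zero (hγ : ∀ t, HasDerivAt γ (γ' t) t) (h0 : ∀ t, γ' t ≠ 0) (x : Plane) :
    volume {t | γ t = x} = 0 := by
  refine measure_null_of_locally_null _ fun t ht => ⟨{t}, ?_, by simp⟩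
  have h := (hγ t).eventually_ne (c := x) (h0 t)
  rw [mem_nhdsWithin_iff_eventually]
  filter_upwards [eventually_nhdsWithin_iff.1 h] with s hs hsx
  by_contra hne
  exact hs hne hsx

/-- The set of pairs of times in `[-T, T]` at which the curve is at two points of distance at
most `δ`. -/
def closePairs (γ : ℝ → Plane) (T δ : ℝ) : Set (ℝ × ℝ) :=
  (Set.Icc (-T) T ×ˢ Set.Icc (-T) T) ∩ {p | dist (γ p.1) (γ p.2) ≤ δ}

lemma measurableSet_closePairs (hγ : Continuous γ) (T δ : ℝ) :
    MeasurableSet (closePairs γ T δ) :=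
  (measurableSet_Icc.prod measurableSet_Icc).inter (isClosed_le (by fun_prop) (by fun_prop)).measurableSet

lemma volume_closePairs_ne_top (T δ : ℝ) : volume (closePairs γ T δ) ≠ ⊤ :=
  ((measure_mono Set.inter_subset_left).trans_lt
    (isCompact_Icc.prod isCompact_Icc).measure_lt_top).ne

/-- In the limit only pairs with γ(r) = γ(s) remain. By Fubini these are null, since every time
slice is a level set; self-intersections and closed orbits do no harm. -/
lemma tendsto_volume_closePairs (hγ : ∀ t, HasDerivAt γ (γ' t) t) (h0 : ∀ t, γ' t ≠ 0) (T : ℝ)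
    {δ : ℕ → ℝ} (hδ : Tendsto δ atTop (𝓝 0)) :
    Tendsto (fun n => (volume (closePairs γ T (δ n))).toReal) atTop (𝓝 0) := by
  have hγc : Continuous γ := continuous_iff_continuousAt.2 fun t => (hγ t).continuousAt
  have hnull : volume {p : ℝ × ℝ | γ p.1 = γ p.2} = 0 := by
    rw [Measure.volume_eq_prod, Measure.measure_prod_null
      (isClosed_eq (by fun_prop) (by fun_prop)).measurableSet]
    refine Eventually.of_forall fun r => ?_
    have := volume_level_eq_zero hγ h0 (γ r)
    simp only [Pi.zero_apply]
    refine Eq.trans ?_ this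
    congr 1
    ext s
    simp [eq_comm]
  have hlim : Tendsto (fun n => volume (closePairs γ T (δ n))) atTop (𝓝 (volume (∅ : Set (ℝ × ℝ)))) := by
    refine tendsto_measure_of_ae_tendsto_indicator atTop MeasurableSet.empty
      (fun n => measurableSet_closePairs hγc T _) (isCompact_Icc.prod isCompact_Icc).measurableSet
      (isCompact_Icc.prod isCompact_Icc).measure_lt_top.ne
      (Eventually.of_forall fun n => Set.inter_subset_left) ?_
    have hae : ∀ᵐ p : ℝ × ℝ, γ p.1 ≠ γ p.2 := by
      rw [ae_iff]
      simpa using hnull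
    filter_upwards [hae] with p hp
    filter_upwards [hδ.eventually_lt_const (dist_pos.2 hp)] with n hn
    simp [closePairs, hn.not_ge]
  rw [measure_empty] at hlim
  exact (ENNReal.tendsto_toReal ENNReal.zero_ne_top).comp hlim

/-- Indicator of the pairs `(t, y)` with `y` in the disc of radius `b` around `γ t`. -/
def tube (γ : ℝ → Plane) (b : ℝ) : ℝ × Plane → ENNReal :=
  {q : ℝ × Plane | dist q.2 (γ q.1) ≤ b}.indicator 1

lemma measurable_tube (hγ : Continuous γ) (b : ℝ) : Measurable (tube γ b) :=
  measurable_one.indicator (isClosed_le (by fun_prop) (by fun_prop)).measurableSet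

/-- The time in `[-T, T]` that the curve spends in discs of radius `b` is small in mean square. -/
lemma lintegral_sojourn_sq_le (hγ : Continuous γ) (T : ℝ) {b : ℝ} (hb : 0 ≤ b) :
    ∫⁻ y, (∫⁻ r in Set.Icc (-T) T, tube γ b (r, y)) ^ 2 ≤
      ENNReal.ofReal (b ^ 2 * discVol) * volume (closePairs γ T (2 * b)) := by
  set ν : Measure ℝ := volume.restrict (Set.Icc (-T) T) with hν
  have hm := measurable_tube hγ b
  have hm1 : Measurable fun q : Plane × (ℝ × ℝ) => tube γ b (q.2.1, q.1) := by fun_prop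
  have hm2 : Measurable fun q : Plane × (ℝ × ℝ) => tube γ b (q.2.2, q.1) := by fun_prop
  have hD : MeasurableSet {p : ℝ × ℝ | dist (γ p.1) (γ p.2) ≤ 2 * b} :=
    (isClosed_le (by fun_prop) (by fun_prop)).measurableSet
  have hvol : ∀ x : Plane, volume (Metric.closedBall x b) = ENNReal.ofReal (b ^ 2 * discVol) := by
    intro x
    rw [← volume_closedBall_eq hb x, ENNReal.ofReal_toReal]
    exact (isCompact_closedBall x b).measure_lt_top.ne
  -- The square of the sojourn time is a double integral over pairs of times. If y is within b of
  -- both curve points, these are within 2b of each other, and for fixed times such y fill at most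
  -- one disc.
  calc _ = ∫⁻ y, (∫⁻ p, tube γ b (p.1, y) * tube γ b (p.2, y) ∂(ν.prod ν)) := by
        refine lintegral_congr fun y => ?_
        have hy : Measurable fun r => tube γ b (r, y) := by fun_prop
        rw [sq, lintegral_prod_mul hy.aemeasurable hy.aemeasurable]
    _ = ∫⁻ p, (∫⁻ y, tube γ b (p.1, y) * tube γ b (p.2, y)) ∂(ν.prod ν) :=
        lintegral_lintegral_swap (hm1.mul hm2).aemeasurable
    _ ≤ ∫⁻ p, {p : ℝ × ℝ | dist (γ p.1) (γ p.2) ≤ 2 * b}.indicator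
          (fun _ => ENNReal.ofReal (b ^ 2 * discVol)) p ∂(ν.prod ν) := by
        refine lintegral_mono fun p => ?_
        by_cases hp : dist (γ p.1) (γ p.2) ≤ 2 * b
        · rw [Set.indicator_of_mem (by exact hp), ← hvol (γ p.1),
            ← lintegral_indicator_one Metric.isClosed_closedBall.measurableSet]
          refine lintegral_mono fun y => ?_
          by_cases hy : dist y (γ p.1) ≤ b
          · rw [Set.indicator_of_mem (by exact hy)]
            have : ∀ q, tube γ b q ≤ 1 := fun q => Set.indicator_le_self _ _ q
            simpa using mul_le_mul' (this (p.1, y)) (this (p.2, y))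
          · simp [tube, hy]
        · rw [Set.indicator_of_notMem (by exact hp)]
          refine le_of_eq ((lintegral_congr fun y => ?_).trans lintegral_zero)
          by_cases hy : dist y (γ p.1) ≤ b
          · have : ¬ dist y (γ p.2) ≤ b := fun h => hp <|
              (dist_triangle_left _ _ y).trans (by linarith)
            simp [tube, this]
          · simp [tube, hy]
    _ = _ := by
        rw [lintegral_indicator_const hD, hν, Measure.prod_restrict, Measure.restrict_apply hD,
          ← Measure.volume_eq_prod, closePairs, Set.inter_comm]

end Overlap

/-! ### Time integrals of the estimation error along a curve -/

section TimeKern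

variable {K f : Plane → ℝ} {c M Λ : ℝ} {γ γ' : ℝ → Plane} {φ : ℝ → ℝ}

lemma BoundedKernel.continuous_kern (hK : BoundedKernel K c) (b : ℝ) {l : List (Fin 2)}
    (hl : l.length ≤ 3) : Continuous fun p : Plane × Plane => kern K b l p.1 p.2 := by
  have := hK.regular.continuous_pd l hl
  unfold kern
  exact continuous_const.mul (this.comp (by fun_prop))

/-- The integral over time of the kernel along a curve. -/
def timeKern (K : Plane → ℝ) (b : ℝ) (l : List (Fin 2)) (γ : ℝ → Plane) (φ : ℝ → ℝ) (t : ℝ)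
    (y : Plane) : ℝ := ∫ r in (0 : ℝ)..t, φ r * kern K b l (γ r) y

lemma BoundedKernel.continuous_timeKern (hK : BoundedKernel K c) (b : ℝ) {l : List (Fin 2)}
    (hl : l.length ≤ 3) (hγ : Continuous γ) (hφ : Continuous φ) :
    Continuous (Function.uncurry (timeKern K b l γ φ)) := by
  have hk := hK.continuous_kern b hl
  refine intervalIntegral.continuous_parametric_intervalIntegral_of_continuous
    (f := fun (p : ℝ × Plane) r => φ r * kern K b l (γ r) p.2) ?_ continuous_fst
  exact (hφ.comp continuous_snd).mul
    (hk.comp (by fun_prop : Continuous fun q : (ℝ × Plane) × ℝ => (γ q.2, q.1.2)))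

lemma BoundedKernel.abs_timeKern_le (hK : BoundedKernel K c) {b : ℝ} (hb : 0 < b)
    {l : List (Fin 2)} (hl : l.length ≤ 3) (hΛ : ∀ r, |φ r| ≤ Λ) (t : ℝ) (y : Plane) :
    |timeKern K b l γ φ t y| ≤ Λ * (c * b⁻¹ ^ (2 + l.length)) * |t| := by
  have h := intervalIntegral.norm_integral_le_of_norm_le_const (a := 0) (b := t)
    (f := fun r => φ r * kern K b l (γ r) y) (C := Λ * (c * b⁻¹ ^ (2 + l.length))) fun r _ => by
      rw [norm_mul]
      exact mul_le_mul (hΛ r) (hK.abs_kern_le hb hl _ _) (norm_nonneg _)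
        ((abs_nonneg _).trans (hΛ r))
  simpa [timeKern] using h

lemma enorm_timeKern_le (hK : BoundedKernel K c) {b : ℝ} (hb : 0 < b) {l : List (Fin 2)}
    (hl : l.length ≤ 3) (hγ : Continuous γ) (hΛ : ∀ r, |φ r| ≤ Λ) {t T : ℝ} (ht : |t| ≤ T)
    (y : Plane) :
    ‖timeKern K b l γ φ t y‖ₑ ≤ ENNReal.ofReal (Λ * (c * b⁻¹ ^ (2 + l.length))) *
      ∫⁻ r in Set.Icc (-T) T, tube γ b (r, y) := by
  have hsub : Set.uIoc 0 t ⊆ Set.Icc (-T) T := by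
    intro r hr
    have := abs_le.1 ht
    rcases Set.mem_uIoc.1 hr with h | h <;> constructor <;> linarith [h.1, h.2]
  have hm : Measurable fun r => tube γ b (r, y) := by
    have := measurable_tube hγ b
    fun_prop
  have h1 : ‖timeKern K b l γ φ t y‖ₑ = ‖∫ r in Set.uIoc 0 t, φ r * kern K b l (γ r) y‖ₑ := by
    rw [← ofReal_norm, ← ofReal_norm, timeKern, intervalIntegral.norm_intervalIntegral_eq]
  rw [h1, ← lintegral_const_mul _ hm]
  refine (enorm_integral_le_lintegral_enorm _).trans
    ((lintegral_mono_set hsub).trans (lintegral_mono fun r => ?_))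
  by_cases hr : dist y (γ r) ≤ b
  · have : tube γ b (r, y) = 1 := by simp [tube, hr]
    rw [this, mul_one, ← ofReal_norm, norm_mul]
    exact ENNReal.ofReal_le_ofReal (mul_le_mul (hΛ r) (hK.abs_kern_le hb hl _ _) (norm_nonneg _)
        ((abs_nonneg _).trans (hΛ r)))
  · rw [hK.kern_eq_zero hb l (by simpa using hr)]
    simp

/-- The weighted kernel integral is at most its supremum times the sojourn time near y. Compared
with the variance bound at a fixed point, the gain is the measure of the close pairs. -/
lemma integral_mul_timeKern_sq_le (hK : BoundedKernel K c) (hf : BoundedDensity f M) {b : ℝ}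
    (hb : 0 < b) {l : List (Fin 2)} (hl : l.length ≤ 3) (hγ : Continuous γ) (hφ : Continuous φ)
    (hΛ : ∀ r, |φ r| ≤ Λ) {t T : ℝ} (ht : |t| ≤ T) :
    ∫ y, f y * timeKern K b l γ φ t y ^ 2 ≤
      M * (Λ * (c * b⁻¹ ^ (2 + l.length))) ^ 2 * (b ^ 2 * discVol) *
        (volume (closePairs γ T (2 * b))).toReal := by
  have hM := hf.M_nonneg
  have hΛ0 : 0 ≤ Λ := (abs_nonneg _).trans (hΛ 0)
  have hc0 := hK.c_nonneg
  set A := Λ * (c * b⁻¹ ^ (2 + l.length))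
  have hA : 0 ≤ A := by positivity
  have hY : Continuous (timeKern K b l γ φ t) :=
    (hK.continuous_timeKern b hl hγ hφ).comp (by fun_prop : Continuous fun y : Plane => (t, y))
  have hfc := hf.regular.contDiff.continuous
  rw [integral_eq_lintegral_of_nonneg_ae
    (Eventually.of_forall fun y => mul_nonneg (hf.nonneg y) (sq_nonneg _))
    (hfc.mul (hY.pow 2)).aestronglyMeasurable]
  have hS := lintegral_sojourn_sq_le hγ T hb.le
  have hD := discVol_nonneg
  have hm : Measurable fun y => ∫⁻ r in Set.Icc (-T) T, tube γ b (r, y) :=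
    (measurable_tube hγ b).lintegral_prod_left'
  have key : ∫⁻ y, ENNReal.ofReal (f y * timeKern K b l γ φ t y ^ 2) ≤
      ENNReal.ofReal (M * A ^ 2) *
        (ENNReal.ofReal (b ^ 2 * discVol) * volume (closePairs γ T (2 * b))) := by
    refine le_trans ?_ (mul_le_mul_right hS _)
    rw [← lintegral_const_mul _ (hm.pow_const 2)]
    refine lintegral_mono fun y => ?_
    have h1 := enorm_timeKern_le hK hb hl hγ hΛ ht y
    calc ENNReal.ofReal (f y * timeKern K b l γ φ t y ^ 2)
        = ENNReal.ofReal (f y) * ‖timeKern K b l γ φ t y‖ₑ ^ 2 := by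
          rw [ENNReal.ofReal_mul (hf.nonneg y), ← ofReal_norm, ← ENNReal.ofReal_pow (norm_nonneg _),
            Real.norm_eq_abs, sq_abs]
      _ ≤ ENNReal.ofReal M * (ENNReal.ofReal A *
          ∫⁻ r in Set.Icc (-T) T, tube γ b (r, y)) ^ 2 := by
          gcongr
          exact hf.le y
      _ = _ := by
          rw [mul_pow, ENNReal.ofReal_mul hM, ENNReal.ofReal_pow hA, mul_assoc]
  refine (ENNReal.toReal_mono ?_ key).trans (le_of_eq ?_)
  · exact ENNReal.mul_ne_top ENNReal.ofReal_ne_top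
      (ENNReal.mul_ne_top ENNReal.ofReal_ne_top (volume_closePairs_ne_top T _))
  · rw [ENNReal.toReal_mul, ENNReal.toReal_mul, ENNReal.toReal_ofReal (by positivity),
      ENNReal.toReal_ofReal (by positivity)]
    ring

lemma continuous_smooth_pd_comp (hK : BoundedKernel K c) (hf : BoundedDensity f M) {b : ℝ}
    (hb : 0 < b) {l : List (Fin 2)} (hl : l.length ≤ 3) (hγ : Continuous γ) :
    Continuous fun r => smooth K b (pd l f) (γ r) := by
  have h := hf.continuous_integral_mul (G := fun r y => kern K b l (γ r) y)
    ((hK.continuous_kern b hl).comp (by fun_prop : Continuous fun p : ℝ × Plane => (γ p.1, p.2)))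
    fun T => ⟨_, fun r _ y => hK.abs_kern_le hb hl _ _⟩
  simpa only [integral_density_mul_kern hK l hl hf.regular.contDiff hb] using h

lemma integral_mul_timeKern (hK : BoundedKernel K c) (hf : BoundedDensity f M) {b : ℝ}
    (hb : 0 < b) {l : List (Fin 2)} (hl : l.length ≤ 3) (hγ : Continuous γ) (hφ : Continuous φ)
    (hΛ : ∀ r, |φ r| ≤ Λ) (t : ℝ) :
    ∫ y, f y * timeKern K b l γ φ t y =
      ∫ r in (0 : ℝ)..t, φ r * smooth K b (pd l f) (γ r) := by
  have hkc := hK.continuous_kern b hl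
  have hint : Integrable (Function.uncurry fun (r : ℝ) (y : Plane) =>
      φ r * (f y * kern K b l (γ r) y)) ((volume.restrict (Set.uIoc 0 t)).prod volume) := by
    have : IsFiniteMeasure (volume.restrict (Set.uIoc 0 t)) :=
      ⟨by rw [Measure.restrict_apply_univ, Set.uIoc]; exact measure_Ioc_lt_top⟩
    have hcst : Integrable (fun _ : ℝ => Λ * (c * b⁻¹ ^ (2 + l.length)))
      (volume.restrict (Set.uIoc 0 t)) := integrable_const _
    refine (hcst.mul_prod hf.integrable).mono' ?_ (Eventually.of_forall fun z => ?_)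
    · refine Continuous.aestronglyMeasurable ?_
      exact (hφ.comp continuous_fst).mul ((hf.regular.contDiff.continuous.comp continuous_snd).mul
        (hkc.comp (by fun_prop : Continuous fun p : ℝ × Plane => (γ p.1, p.2))))
    · simp only [Function.uncurry, norm_mul, Real.norm_eq_abs, abs_of_nonneg (hf.nonneg z.2)]
      calc _ = |φ z.1| * |kern K b l (γ z.1) z.2| * f z.2 := by ring
        _ ≤ _ := mul_le_mul_of_nonneg_right (mul_le_mul (hΛ _) (hK.abs_kern_le hb hl _ _)
          (abs_nonneg _) ((abs_nonneg _).trans (hΛ 0))) (hf.nonneg _)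
  calc _ = ∫ y, ∫ r in (0 : ℝ)..t, φ r * (f y * kern K b l (γ r) y) := by
        refine integral_congr_ae (Eventually.of_forall fun y => ?_)
        simp only [timeKern]
        rw [← intervalIntegral.integral_const_mul]
        exact intervalIntegral.integral_congr fun r _ => by ring
    _ = ∫ r in (0 : ℝ)..t, ∫ y, φ r * (f y * kern K b l (γ r) y) :=
        (intervalIntegral_integral_swap hint).symm
    _ = _ := by
        refine intervalIntegral.integral_congr fun r _ => ?_
        exact (integral_const_mul _ _).trans
          (congrArg (φ r * ·) (integral_density_mul_kern hK l hl hf.regular.contDiff hb (γ r)))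

lemma BoundedKernel.continuous_pd_kde_comp (hK : BoundedKernel K c) (b : ℝ) {l : List (Fin 2)}
    (hl : l.length ≤ 3) (hγ : Continuous γ) (n : ℕ) (x : ℕ → Plane) :
    Continuous fun r => pd l (kde K b n x) (γ r) :=
  ((hK.regular.kde b n x).continuous_pd l hl).comp hγ

lemma emp_timeKern (hK : BoundedKernel K c) (b : ℝ) {l : List (Fin 2)}
    (hl : l.length ≤ 3) (hγ : Continuous γ) (hφ : Continuous φ) (n : ℕ) (x : ℕ → Plane) (t : ℝ) :
    emp x n (timeKern K b l γ φ t) = ∫ r in (0 : ℝ)..t, φ r * pd l (kde K b n x) (γ r) := by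
  have hkc := hK.continuous_kern b hl
  have hk : ∀ y, Continuous fun r => φ r * kern K b l (γ r) y := fun y =>
    hφ.mul (hkc.comp (by fun_prop : Continuous fun r => (γ r, y)))
  simp only [pd_kde_eq_emp hK.regular b n x l (by omega), emp, timeKern]
  rw [← intervalIntegral.integral_finsetSum fun i _ => (hk (x i)).intervalIntegrable _ _,
    ← intervalIntegral.integral_const_mul]
  refine intervalIntegral.integral_congr fun r _ => ?_
  simp only [Finset.mul_sum]
  exact Finset.sum_congr rfl fun i _ => by ring

lemma emp_timeKern_sub (hK : BoundedKernel K c) (hf : BoundedDensity f M) {b : ℝ}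
    (hb : 0 < b) {l : List (Fin 2)} (hl : l.length ≤ 3) (hγ : Continuous γ) (hφ : Continuous φ)
    (hΛ : ∀ r, |φ r| ≤ Λ) (n : ℕ) (x : ℕ → Plane) (t : ℝ) :
    emp x n (timeKern K b l γ φ t) - ∫ y, f y * timeKern K b l γ φ t y =
      ∫ r in (0 : ℝ)..t, φ r * (pd l (kde K b n x) (γ r) - smooth K b (pd l f) (γ r)) := by
  rw [emp_timeKern hK b hl hγ hφ, integral_mul_timeKern hK hf hb hl hγ hφ hΛ]
  simp only [mul_sub]
  exact (intervalIntegral.integral_sub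
      ((hφ.mul (hK.continuous_pd_kde_comp b hl hγ n x)).intervalIntegrable _ _)
      ((hφ.mul (continuous_smooth_pd_comp hK hf hb hl hγ)).intervalIntegrable _ _)).symm

end TimeKern

/-! ### Elementary inequalities for absolute values -/

lemma abs_integral_le_integral_symm {g : ℝ → ℝ} (hg : Continuous g) (h0 : ∀ r, 0 ≤ g r) {t T : ℝ}
    (ht : |t| ≤ T) : |∫ r in (0 : ℝ)..t, g r| ≤ ∫ r in -T..T, g r := by
  have hT : -T ≤ T := by linarith [abs_nonneg t]
  have hsub : Set.uIoc 0 t ⊆ Set.Ioc (-T) T := by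
    intro r hr
    have := abs_le.1 ht
    rcases Set.mem_uIoc.1 hr with h | h <;> constructor <;> linarith [h.1, h.2]
  rw [intervalIntegral.abs_integral_eq_abs_integral_uIoc,
    abs_of_nonneg (integral_nonneg fun r => h0 r), intervalIntegral.integral_of_le hT]
  exact setIntegral_mono_set (hg.intervalIntegrable _ _).1 (Eventually.of_forall h0)
    (Eventually.of_forall hsub)

lemma abs_le_add_sq_div (s : ℝ) {κ : ℝ} (hκ : 0 < κ) : |s| ≤ κ + κ⁻¹ * s ^ 2 := by
  rw [← sq_abs s]
  have h : κ * |s| ≤ κ * (κ + κ⁻¹ * |s| ^ 2) := by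
    rw [mul_add, mul_inv_cancel_left₀ hκ.ne']
    nlinarith [sq_nonneg (κ - |s|), sq_nonneg (κ), sq_nonneg (|s|)]
  exact le_of_mul_le_mul_left h hκ

/-! ### The accumulated drift is negligible -/

section TimeErr

variable {Ω : Type*} [MeasurableSpace Ω] {P : Measure Ω} [IsProbabilityMeasure P]
  {K f : Plane → ℝ} {c M Λ : ℝ} {X : ℕ → Ω → Plane} {h : ℕ → ℝ} {γ γ' : ℝ → Plane} {φ : ℝ → ℝ}

/-- The weighted time integral of the error of a partial derivative along a curve. -/
def timeErr (g f : Plane → ℝ) (l : List (Fin 2)) (γ : ℝ → Plane) (φ : ℝ → ℝ) (t : ℝ) : ℝ :=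
  ∫ r in (0 : ℝ)..t, φ r * (pd l g (γ r) - pd l f (γ r))

lemma Regular.continuous_timeErr {g : Plane → ℝ} (hg : Regular g) (hf : Regular f)
    {l : List (Fin 2)} (hl : l.length ≤ 3) (hγ : Continuous γ) (hφ : Continuous φ) :
    Continuous (timeErr g f l γ φ) := by
  have hc : Continuous fun r => φ r * (pd l g (γ r) - pd l f (γ r)) :=
    hφ.mul (((hg.continuous_pd l hl).comp hγ).sub ((hf.continuous_pd l hl).comp hγ))
  exact intervalIntegral.continuous_primitive (fun _ _ => hc.intervalIntegrable _ _) 0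

lemma abs_timeErr_kde_le (hK : BoundedKernel K c) (hf : BoundedDensity f M) {b D : ℝ}
    (hb : 0 < b) {l : List (Fin 2)} (hl : l.length ≤ 3) (hγ : Continuous γ) (hφ : Continuous φ)
    (hΛ : ∀ r, |φ r| ≤ Λ) (hD : ∀ x, |smooth K b (pd l f) x - pd l f x| ≤ D) (n : ℕ)
    (x : ℕ → Plane) {t T : ℝ} (ht : |t| ≤ T) :
    |timeErr (kde K b n x) f l γ φ t| ≤
      |emp x n (timeKern K b l γ φ t) - ∫ y, f y * timeKern K b l γ φ t y| + Λ * D * T := by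
  have hs := continuous_smooth_pd_comp hK hf hb hl hγ
  have hp := hK.continuous_pd_kde_comp b hl hγ n x
  have hfp := (hf.regular.continuous_pd l hl).comp hγ
  have hΛ0 : 0 ≤ Λ := (abs_nonneg _).trans (hΛ 0)
  have hD0 : 0 ≤ D := (abs_nonneg _).trans (hD 0)
  have e : timeErr (kde K b n x) f l γ φ t =
      (emp x n (timeKern K b l γ φ t) - ∫ y, f y * timeKern K b l γ φ t y) +
      ∫ r in (0 : ℝ)..t, φ r * (smooth K b (pd l f) (γ r) - pd l f (γ r)) := by
    rw [emp_timeKern_sub hK hf hb hl hγ hφ hΛ]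
    refine Eq.trans ?_ (intervalIntegral.integral_add ((hφ.mul (hp.sub hs)).intervalIntegrable _ _)
      ((hφ.mul (hs.sub hfp)).intervalIntegrable _ _))
    refine intervalIntegral.integral_congr fun r _ => ?_
    ring
  have h2 : |∫ r in (0 : ℝ)..t, φ r * (smooth K b (pd l f) (γ r) - pd l f (γ r))| ≤ Λ * D * T := by
    have := intervalIntegral.norm_integral_le_of_norm_le_const (a := 0) (b := t)
      (f := fun r => φ r * (smooth K b (pd l f) (γ r) - pd l f (γ r))) (C := Λ * D) fun r _ => by
        rw [norm_mul]
        exact mul_le_mul (hΛ r) (hD _) (norm_nonneg _) hΛ0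
    rw [sub_zero, Real.norm_eq_abs] at this
    exact this.trans (by gcongr)
  rw [e]
  exact (abs_add_le _ _).trans (add_le_add_right h2 _)

/-- The rate at which the variance of the time integrals vanishes. -/
lemma tendsto_timeKern_variance (hγ : ∀ t, HasDerivAt γ (γ' t) t) (h0 : ∀ t, γ' t ≠ 0)
    (hh : BandwidthAssumptions h) (T B : ℝ) :
    Tendsto (fun n => B * (volume (closePairs γ T (2 * h n))).toReal) atTop (𝓝 0) := by
  have : Tendsto (fun n => 2 * h n) atTop (𝓝 0) := by simpa using hh.tendsto_zero.const_mul 2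
  simpa using (tendsto_volume_closePairs hγ h0 T this).const_mul B

/-- All powers of n and b cancel, so at the rate √(nb⁶) the variance of the time integral is
governed by v alone, the measure of the close pairs. -/
lemma timeKern_variance_eq {b v : ℝ} (hb : 0 < b) {n : ℕ} (hn : n ≠ 0) {l : List (Fin 2)}
    (hl : l.length = 2) :
    n * b ^ 6 * ((n : ℝ)⁻¹ * (M * (Λ * (c * b⁻¹ ^ (2 + l.length))) ^ 2 * (b ^ 2 * discVol) * v)) =
      M * (Λ * c) ^ 2 * discVol * v := by
  have hn' : (n : ℝ) ≠ 0 := by exact_mod_cast hn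
  rw [hl, show 2 + 2 = 4 from rfl]
  field_simp

/-- The error splits into a centred empirical mean of `timeKern`, whose scaled variance vanishes
with the measure of the close pairs, and the integrated bias, of order h². -/
lemma IsSample.negligible_timeErr (hX : IsSample P f X) (hf : BoundedDensity f M)
    (hK : BoundedKernel K c) (hh : BandwidthAssumptions h) (hγ : ∀ t, HasDerivAt γ (γ' t) t)
    (h0 : ∀ t, γ' t ≠ 0) (hφ : Continuous φ) (hΛ : ∀ r, |φ r| ≤ Λ) {l : List (Fin 2)}
    (hl : l.length = 2) (t : ℝ) :
    Negligible P fun n ω =>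
      √((n : ℝ) * h n ^ 6) * |timeErr (kde K (h n) n fun i => X i ω) f l γ φ t| := by
  have hγc : Continuous γ := continuous_iff_continuousAt.2 fun t => (hγ t).continuousAt
  obtain ⟨C, hC0, hC⟩ := exists_bias_le_sq hK hf.regular
  have hΛ0 : 0 ≤ Λ := (abs_nonneg _).trans (hΛ 0)
  set T := |t|
  set S : ℕ → Ω → ℝ := fun n ω => emp (fun i => X i ω) n (timeKern K (h n) l γ φ t) -
    ∫ y, f y * timeKern K (h n) l γ φ t y
  have hYm : ∀ n, Measurable (timeKern K (h n) l γ φ t) := fun n =>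
    ((hK.continuous_timeKern (h n) (by omega) hγc hφ).comp
      (by fun_prop : Continuous fun y : Plane => (t, y))).measurable
  have hYb := fun n => hK.abs_timeKern_le (l := l) (γ := γ) (hh.pos n) (by omega) hΛ t
  have hS : Negligible P fun n ω => n * h n ^ 6 * S n ω ^ 2 := by
    refine negligible_of_lintegral_le (e := fun n => M * (Λ * c) ^ 2 * discVol *
      (volume (closePairs γ T (2 * h n))).toReal) ?_ ?_ (tendsto_timeKern_variance hγ h0 hh T _)
    · refine Eventually.of_forall fun n => ?_
      exact ((((hX.memLp_emp (hYm n) (hYb n) 2 n).sub (memLp_const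
        (∫ y, f y * timeKern K (h n) l γ φ t y))).integrable_sq.const_mul _).aestronglyMeasurable).aemeasurable
    · filter_upwards [eventually_ne_atTop 0] with n hn
      have hb := hh.pos n
      rw [← timeKern_variance_eq hb hn hl]
      have hint : Integrable (fun ω => n * h n ^ 6 * S n ω ^ 2) P :=
        ((hX.memLp_emp (hYm n) (hYb n) 2 n).sub (memLp_const
        (∫ y, f y * timeKern K (h n) l γ φ t y))).integrable_sq.const_mul _
      rw [← ofReal_integral_eq_lintegral_ofReal hint
        (Eventually.of_forall fun ω => by positivity), integral_const_mul]
      gcongr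
      refine (hX.meanSq_emp_le hf (hYm n) (hYb n) hn).trans ?_
      gcongr
      exact integral_mul_timeKern_sq_le hK hf hb (by omega) hγc hφ hΛ le_rfl
  refine negligible_of_forall_le_add fun κ hκ =>
    ⟨_, (hS.const_mul (inv_nonneg.2 hκ.le)).add (negligible_of_tendsto
      (by simpa using hh.tendsto_bias.const_mul (Λ * C * T) :
        Tendsto (fun n : ℕ => Λ * C * T * (√((n : ℝ) * h n ^ 6) * h n ^ 2)) atTop (𝓝 0))),
      Eventually.of_forall fun n ω => ?_⟩
  have hb := hh.pos n
  have h1 := abs_timeErr_kde_le hK hf hb (by omega : l.length ≤ 3) hγc hφ hΛ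
    (hC l (by omega) (h n) hb) n (fun i => X i ω) (le_refl T)
  have h2 := abs_le_add_sq_div (√((n : ℝ) * h n ^ 6) * S n ω) hκ
  rw [abs_mul, abs_of_nonneg (Real.sqrt_nonneg _), mul_pow, Real.sq_sqrt (by positivity)] at h2
  have h3 := mul_le_mul_of_nonneg_left h1 (Real.sqrt_nonneg ((n : ℝ) * h n ^ 6))
  simp only [S] at h2 ⊢
  linarith

/-- The Grönwall bound also contains the time integral of the drift. The mean square argument is
repeated after integration over time. -/
lemma IsSample.negligible_integral_timeErr (hX : IsSample P f X) (hf : BoundedDensity f M)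
    (hK : BoundedKernel K c) (hh : BandwidthAssumptions h) (hγ : ∀ t, HasDerivAt γ (γ' t) t)
    (h0 : ∀ t, γ' t ≠ 0) (hφ : Continuous φ) (hΛ : ∀ r, |φ r| ≤ Λ) {l : List (Fin 2)}
    (hl : l.length = 2) {T : ℝ} (hT : 0 ≤ T) :
    Negligible P fun n ω => √((n : ℝ) * h n ^ 6) *
      ∫ t in -T..T, |timeErr (kde K (h n) n fun i => X i ω) f l γ φ t| := by
  have hγc : Continuous γ := continuous_iff_continuousAt.2 fun t => (hγ t).continuousAt
  obtain ⟨C, hC0, hC⟩ := exists_bias_le_sq hK hf.regular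
  have hΛ0 : 0 ≤ Λ := (abs_nonneg _).trans (hΛ 0)
  have hc0 := hK.c_nonneg
  set S : ℕ → Ω → ℝ → ℝ := fun n ω t => emp (fun i => X i ω) n (timeKern K (h n) l γ φ t) -
    ∫ y, f y * timeKern K (h n) l γ φ t y
  have hYc := fun n => hK.continuous_timeKern (h n) (by omega : l.length ≤ 3) hγc hφ
  have hYb : ∀ n T', ∃ c', ∀ r, |r| ≤ T' → ∀ y, |timeKern K (h n) l γ φ r y| ≤ c' := fun n T' =>
    ⟨Λ * (c * (h n)⁻¹ ^ (2 + l.length)) * T', fun r hr y => by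
      have hb := hh.pos n
      exact (hK.abs_timeKern_le hb (by omega) hΛ r y).trans (by gcongr)⟩
  have hSc : ∀ n ω, Continuous (S n ω) := fun n ω =>
    ((continuous_emp n (hYc n)).comp (by fun_prop : Continuous fun r : ℝ => ((fun i => X i ω), r))).sub
      (hf.continuous_integral_mul (hYc n) (hYb n))
  have hTT : -T ≤ T := by linarith
  have hS : Negligible P fun n ω => n * h n ^ 6 * ∫ t in -T..T, S n ω t ^ 2 := by
    refine negligible_of_lintegral_le (e := fun n => (M * (Λ * c) ^ 2 * discVol * (2 * T)) *
      (volume (closePairs γ T (2 * h n))).toReal) ?_ ?_ (tendsto_timeKern_variance hγ h0 hh T _)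
    · filter_upwards [eventually_ne_atTop 0] with n hn
      exact (hX.lintegral_meanSq_le hf (hYc n) (hYb n) hn hT fun r hr =>
        integral_mul_timeKern_sq_le hK hf (hh.pos n) (by omega) hγc hφ hΛ hr).1.const_mul _
    · filter_upwards [eventually_ne_atTop 0] with n hn
      have hb := hh.pos n
      have h1 := (hX.lintegral_meanSq_le hf (hYc n) (hYb n) hn hT fun r hr =>
        integral_mul_timeKern_sq_le hK hf (hh.pos n) (by omega) hγc hφ hΛ hr).2
      simp only [ENNReal.ofReal_mul (by positivity : (0 : ℝ) ≤ n * h n ^ 6)]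
      rw [lintegral_const_mul' _ _ ENNReal.ofReal_ne_top]
      refine (mul_le_mul_right h1 _).trans (le_of_eq ?_)
      rw [← ENNReal.ofReal_mul (by positivity), ← mul_assoc, timeKern_variance_eq hb hn hl]
      congr 1; ring
  refine negligible_of_forall_le_add fun κ hκ => ?_
  -- Integrated over [−T, T], the constant κ' contributes at most κ.
  set κ' := κ / (2 * T + 1)
  have hκ' : 0 < κ' := by positivity
  refine ⟨_, (hS.const_mul (inv_nonneg.2 hκ'.le)).add (negligible_of_tendsto
      (by simpa using hh.tendsto_bias.const_mul (Λ * C * T * (2 * T)) :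
        Tendsto (fun n : ℕ => Λ * C * T * (2 * T) * (√((n : ℝ) * h n ^ 6) * h n ^ 2)) atTop (𝓝 0))),
      Eventually.of_forall fun n ω => ?_⟩
  have hb := hh.pos n
  have hpt : ∀ t ∈ Set.Icc (-T) T,
      √((n : ℝ) * h n ^ 6) * |timeErr (kde K (h n) n fun i => X i ω) f l γ φ t| ≤
      κ' + κ'⁻¹ * (n * h n ^ 6) * S n ω t ^ 2 +
        √((n : ℝ) * h n ^ 6) * (Λ * (C * h n ^ 2) * T) := by
    intro t ht
    have h1 := abs_timeErr_kde_le hK hf hb (by omega : l.length ≤ 3) hγc hφ hΛ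
      (hC l (by omega) (h n) hb) n (fun i => X i ω) (abs_le.2 ht)
    have h2 := abs_le_add_sq_div (√((n : ℝ) * h n ^ 6) * S n ω t) hκ'
    rw [abs_mul, abs_of_nonneg (Real.sqrt_nonneg _), mul_pow, Real.sq_sqrt (by positivity)] at h2
    have h3 := mul_le_mul_of_nonneg_left h1 (Real.sqrt_nonneg ((n : ℝ) * h n ^ 6))
    simp only [S] at h2 ⊢
    linarith
  have hEc := (hK.regular.kde (h n) n fun i => X i ω).continuous_timeErr hf.regular
    (by omega : l.length ≤ 3) hγc hφ
  have hS2 := hSc n ω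
  rw [← intervalIntegral.integral_const_mul]
  refine (intervalIntegral.integral_mono_on hTT
    ((continuous_const.mul hEc.abs).intervalIntegrable _ _)
    (Continuous.intervalIntegrable (by fun_prop) _ _) hpt).trans ?_
  rw [intervalIntegral.integral_add (Continuous.intervalIntegrable (by fun_prop) _ _)
      (Continuous.intervalIntegrable (by fun_prop) _ _),
    intervalIntegral.integral_add (Continuous.intervalIntegrable (by fun_prop) _ _)
      (Continuous.intervalIntegrable (by fun_prop) _ _),
    intervalIntegral.integral_const_mul, intervalIntegral.integral_const,
    intervalIntegral.integral_const, smul_eq_mul, smul_eq_mul]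
  have hκT : (T - -T) * κ' ≤ κ := by
    simp only [κ']
    rw [mul_div_assoc', div_le_iff₀ (by positivity)]
    nlinarith
  have e1 : (T - -T) * (√((n : ℝ) * h n ^ 6) * (Λ * (C * h n ^ 2) * T)) =
    Λ * C * T * (2 * T) * (√((n : ℝ) * h n ^ 6) * h n ^ 2) := by ring
  rw [e1]
  linarith

/-- Squared errors of the second derivatives along a curve. -/
lemma IsSample.negligible_integral_sq (hX : IsSample P f X) (hf : BoundedDensity f M)
    (hK : BoundedKernel K c) (hh : BandwidthAssumptions h) (hγ : Continuous γ) {l : List (Fin 2)}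
    (hl : l.length = 2) {T : ℝ} (hT : 0 ≤ T) :
    Negligible P fun n ω => √((n : ℝ) * h n ^ 6) *
      ∫ t in -T..T, (pd l (kde K (h n) n fun i => X i ω) (γ t) - pd l f (γ t)) ^ 2 := by
  obtain ⟨C, hC0, hC⟩ := exists_bias_le_sq hK hf.regular
  set S : ℕ → Ω → ℝ → ℝ := fun n ω t => emp (fun i => X i ω) n (kern K (h n) l (γ t)) -
    ∫ y, f y * kern K (h n) l (γ t) y
  have hYc : ∀ n, Continuous (Function.uncurry fun t => kern K (h n) l (γ t)) := fun n =>
    (hK.continuous_kern (h n) (by omega : l.length ≤ 3)).comp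
      (by fun_prop : Continuous fun p : ℝ × Plane => (γ p.1, p.2))
  have hYb : ∀ n T', ∃ c', ∀ r, |r| ≤ T' → ∀ y, |kern K (h n) l (γ r) y| ≤ c' := fun n T' =>
    ⟨_, fun r _ y => hK.abs_kern_le (hh.pos n) (by omega) _ y⟩
  have hSc : ∀ n ω, Continuous (S n ω) := fun n ω =>
    ((continuous_emp n (hYc n)).comp (by fun_prop : Continuous fun r : ℝ => ((fun i => X i ω), r))).sub
      (hf.continuous_integral_mul (hYc n) (hYb n))
  have hTT : -T ≤ T := by linarith
  have hN := hh.tendsto_mul_pow (k := 6) (by norm_num)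
  have hS : Negligible P fun n ω => √((n : ℝ) * h n ^ 6) * ∫ t in -T..T, S n ω t ^ 2 := by
    -- The integrated variance is of order (nh⁶)⁻¹, so one factor √(nh⁶) still leaves a null
    -- sequence.
    have hlim : Tendsto (fun n : ℕ => M * c ^ 2 * discVol * (2 * T) * (√((n : ℝ) * h n ^ 6))⁻¹) atTop (𝓝 0) := by
      simpa using ((Real.tendsto_sqrt_atTop.comp hN).inv_tendsto_atTop).const_mul
        (M * c ^ 2 * discVol * (2 * T))
    have hv : ∀ n, ∀ r, |r| ≤ T → ∫ y, f y * kern K (h n) l (γ r) y ^ 2 ≤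
        M * c ^ 2 * discVol * (h n)⁻¹ ^ (2 + 2 * l.length) := fun n r _ =>
      integral_density_mul_kern_sq_le hK hf (hh.pos n) (by omega) (γ r)
    refine negligible_of_lintegral_le ?_ ?_ hlim
    · filter_upwards [eventually_ne_atTop 0] with n hn
      exact (hX.lintegral_meanSq_le hf (hYc n) (hYb n) hn hT (hv n)).1.const_mul _
    · filter_upwards [eventually_ne_atTop 0] with n hn
      have hb := hh.pos n
      have h1 := (hX.lintegral_meanSq_le hf (hYc n) (hYb n) hn hT (hv n)).2
      simp only [ENNReal.ofReal_mul (Real.sqrt_nonneg _)]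
      rw [lintegral_const_mul' _ _ ENNReal.ofReal_ne_top]
      refine (mul_le_mul_right h1 _).trans (le_of_eq ?_)
      rw [← ENNReal.ofReal_mul (Real.sqrt_nonneg _)]
      congr 1
      have hn' : (0 : ℝ) < n := by exact_mod_cast Nat.pos_of_ne_zero hn
      have e : (√((n : ℝ) * h n ^ 6))⁻¹ = √((n : ℝ) * h n ^ 6) * ((n : ℝ) * h n ^ 6)⁻¹ := by
        have hs : 0 < √((n : ℝ) * h n ^ 6) := by positivity
        rw [eq_mul_inv_iff_mul_eq₀ (by positivity), inv_mul_eq_iff_eq_mul₀ hs.ne', Real.mul_self_sqrt (by positivity)]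
      rw [e, hl, mul_inv, inv_pow]
      ring
  refine ((hS.const_mul (by norm_num : (0 : ℝ) ≤ 2)).add (negligible_of_tendsto (e := fun n : ℕ =>
    2 * C ^ 2 * (2 * T) * (√((n : ℝ) * h n ^ 6) * h n ^ 2 * h n ^ 2)) ?_)).mono
      (Eventually.of_forall fun n ω => ?_)
  · simpa using (hh.tendsto_bias.mul (hh.tendsto_zero.pow 2)).const_mul (2 * C ^ 2 * (2 * T))
  have hb := hh.pos n
  have hS2 := hSc n ω
  have hpt : ∀ t ∈ Set.Icc (-T) T,
      (pd l (kde K (h n) n fun i => X i ω) (γ t) - pd l f (γ t)) ^ 2 ≤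
      2 * S n ω t ^ 2 + 2 * (C * h n ^ 2) ^ 2 := by
    intro t _
    have h1 := hC l (by omega) (h n) hb (γ t)
    have h2 : |smooth K (h n) (pd l f) (γ t) - pd l f (γ t)| ^ 2 ≤ (C * h n ^ 2) ^ 2 := by gcongr
    rw [sq_abs] at h2
    simp only [S, integral_density_mul_kern hK l (by omega) hf.regular.contDiff hb,
      ← pd_kde_eq_emp hK.regular (h n) n _ l (by omega)]
    nlinarith [sq_nonneg (pd l (kde K (h n) n fun i => X i ω) (γ t) - smooth K (h n) (pd l f) (γ t) -
      (smooth K (h n) (pd l f) (γ t) - pd l f (γ t)))]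
  have hpc := (hK.continuous_pd_kde_comp (h n) (by omega : l.length ≤ 3) hγ n fun i => X i ω).sub
    ((hf.regular.continuous_pd l (by omega)).comp hγ)
  have h1 := intervalIntegral.integral_mono_on (μ := volume) hTT ((hpc.pow 2).intervalIntegrable _ _)
    (Continuous.intervalIntegrable (by fun_prop) _ _) hpt
  rw [intervalIntegral.integral_add (Continuous.intervalIntegrable (by fun_prop) _ _)
      (Continuous.intervalIntegrable (by fun_prop) _ _),
    intervalIntegral.integral_const_mul, intervalIntegral.integral_const, smul_eq_mul] at h1
  have h2 := mul_le_mul_of_nonneg_left h1 (Real.sqrt_nonneg ((n : ℝ) * h n ^ 6))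
  refine h2.trans (le_of_eq ?_)
  ring

end TimeErr

/-! ### Linearization of the drift -/

section DriftBound

variable {f g : Plane → ℝ} {γ : ℝ → Plane}

/-- The partial derivatives of the eigenvector map along a curve. -/
def eigVecCoeff (f : Plane → ℝ) (γ : ℝ → Plane) (j : Fin 2) (k : Fin 3) (r : ℝ) : ℝ :=
  eigVecDeriv (d2 f (γ r)) (EuclideanSpace.single k 1) j

lemma continuous_eigVecDeriv_comp (hf : Regular f) (hγ : Continuous γ)
    (hgap : ∀ r, gapMap (d2 f (γ r)) ≠ 0) : Continuous fun r => eigVecDeriv (d2 f (γ r)) :=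
  continuous_iff_continuousAt.2 fun r =>
    (continuousAt_eigVecDeriv (hgap r)).comp (f := fun r => d2 f (γ r))
      (hf.continuous_d2.comp hγ).continuousAt

lemma continuous_eigVecCoeff (hf : Regular f) (hγ : Continuous γ)
    (hgap : ∀ r, gapMap (d2 f (γ r)) ≠ 0) (j : Fin 2) (k : Fin 3) :
    Continuous (eigVecCoeff f γ j k) := by
  have h := continuous_eigVecDeriv_comp hf hγ hgap
  unfold eigVecCoeff
  fun_prop

lemma abs_eigVecCoeff_le (f : Plane → ℝ) (γ : ℝ → Plane) (j : Fin 2) (k : Fin 3) (r : ℝ) :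
    |eigVecCoeff f γ j k r| ≤ eigVecLip := by
  refine (PiLp.norm_apply_le (eigVecDeriv (d2 f (γ r)) (EuclideanSpace.single k 1)) j).trans ?_
  refine (ContinuousLinearMap.le_opNorm _ _).trans ?_
  simpa using norm_eigVecDeriv_le (d2 f (γ r))

lemma eigVecDeriv_apply_eq_sum (f : Plane → ℝ) (γ : ℝ → Plane) (r : ℝ)
    (s : EuclideanSpace ℝ (Fin 3)) (j : Fin 2) :
    eigVecDeriv (d2 f (γ r)) s j = ∑ k, eigVecCoeff f γ j k r * s k := by
  have hs : s = ∑ k, s k • EuclideanSpace.single k (1 : ℝ) := by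
    ext i
    fin_cases i <;> simp [Fin.sum_univ_three]
  conv_lhs => rw [hs]
  rw [map_sum]
  simp [eigVecCoeff, Fin.sum_univ_three, mul_comm]

/-- Along the curve the field error is the derivative of the eigenvector map applied to the error of
d², plus a quadratic remainder. The linear part gives weighted time integrals of errors; `Q` is the
remainder constant over the compact time range, finite because the gap does not vanish there. -/
lemma exists_norm_drift_le (hf : Regular f) (hγ : Continuous γ)
    (hgap : ∀ r, gapMap (d2 f (γ r)) ≠ 0) (T : ℝ) : ∃ Q : ℝ, 0 ≤ Q ∧ ∀ g, Regular g →
      ∀ t, |t| ≤ T → ‖drift (eigVec g) (eigVec f) γ t‖ ≤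
        ∑ j, ∑ k, |timeErr g f (d2Index k) γ (eigVecCoeff f γ j k) t| +
        Q * ∑ k, ∫ r in -T..T, (pd (d2Index k) g (γ r) - pd (d2Index k) f (γ r)) ^ 2 := by
  have hgc : Continuous fun r => eigVecRem * ‖gapMap (d2 f (γ r))‖⁻¹ := by
    refine continuous_const.mul (Continuous.inv₀ ?_ fun r => norm_ne_zero_iff.2 (hgap r))
    exact (gapMap.continuous.comp (hf.continuous_d2.comp hγ)).norm
  obtain ⟨Q, hQ⟩ := (isCompact_Icc (a := -T) (b := T)).exists_bound_of_continuousOn hgc.continuousOn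
  refine ⟨max Q 0, le_max_right _ _, fun g hg t ht => ?_⟩
  have hT : -T ≤ T := by linarith [abs_nonneg t]
  set ξ : ℝ → EuclideanSpace ℝ (Fin 3) := fun r => d2 g (γ r) - d2 f (γ r)
  have hξ : Continuous ξ := (hg.continuous_d2.comp hγ).sub (hf.continuous_d2.comp hγ)
  have hξk : ∀ r k, ξ r k = pd (d2Index k) g (γ r) - pd (d2Index k) f (γ r) := by
    intro r k
    simp only [ξ, PiLp.sub_apply, d2_apply]
  set A : ℝ → Plane := fun r => eigVecDeriv (d2 f (γ r)) (ξ r)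
  have hA : Continuous A := (continuous_eigVecDeriv_comp hf hγ hgap).clm_apply hξ
  set B : ℝ → Plane := fun r => eigVec g (γ r) - eigVec f (γ r) - A r
  have hB : Continuous B :=
    ((hg.continuous_eigVec.comp hγ).sub (hf.continuous_eigVec.comp hγ)).sub hA
  have hBle : ∀ r ∈ Set.Icc (-T) T, ‖B r‖ ≤ max Q 0 * ∑ k, ξ r k ^ 2 := by
    intro r hr
    have h1 := norm_eigVecMap_add_sub_le (hgap r) (ξ r)
    have e : d2 f (γ r) + ξ r = d2 g (γ r) := by simp [ξ]
    rw [e] at h1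
    refine h1.trans ?_
    rw [EuclideanSpace.real_norm_sq_eq]
    gcongr
    exact (le_abs_self _).trans ((hQ r hr).trans (le_max_left _ _))
  have hsplit : drift (eigVec g) (eigVec f) γ t = (∫ r in (0 : ℝ)..t, A r) +
      ∫ r in (0 : ℝ)..t, B r := by
    rw [← intervalIntegral.integral_add (hA.intervalIntegrable _ _) (hB.intervalIntegrable _ _)]
    simp [drift, B]
  have hAj : ∀ j, (∫ r in (0 : ℝ)..t, A r) j =
      ∑ k, timeErr g f (d2Index k) γ (eigVecCoeff f γ j k) t := by
    intro j
    have h1 := (EuclideanSpace.proj j : Plane →L[ℝ] ℝ).intervalIntegral_comp_comm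
      (hA.intervalIntegrable (μ := volume) 0 t)
    refine h1.symm.trans ?_
    simp only [timeErr]
    rw [← intervalIntegral.integral_finsetSum]
    · refine intervalIntegral.integral_congr fun r _ => ?_
      simp only [← hξk]
      exact eigVecDeriv_apply_eq_sum f γ r (ξ r) j
    · intro k _
      have := continuous_eigVecCoeff hf hγ hgap j k
      have h3 : Continuous fun r => ξ r k := by fun_prop
      simp only [← hξk]
      exact (this.mul h3).intervalIntegrable _ _
  have hBint : ‖∫ r in (0 : ℝ)..t, B r‖ ≤
      max Q 0 * ∑ k, ∫ r in -T..T, (pd (d2Index k) g (γ r) - pd (d2Index k) f (γ r)) ^ 2 := by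
    calc _ ≤ |∫ r in (0 : ℝ)..t, ‖B r‖| := intervalIntegral.norm_integral_le_abs_integral_norm
      _ ≤ ∫ r in -T..T, ‖B r‖ := abs_integral_le_integral_symm hB.norm (fun _ => norm_nonneg _) ht
      _ ≤ ∫ r in -T..T, max Q 0 * ∑ k, ξ r k ^ 2 :=
          intervalIntegral.integral_mono_on hT (hB.norm.intervalIntegrable _ _)
            (Continuous.intervalIntegrable (by fun_prop) _ _) hBle
      _ = _ := by
          rw [intervalIntegral.integral_const_mul, intervalIntegral.integral_finsetSum
            fun k _ => Continuous.intervalIntegrable (by fun_prop) _ _]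
          simp only [hξk]
  rw [hsplit]
  refine (norm_add_le _ _).trans (add_le_add ((norm_le_sum_abs _).trans ?_) hBint)
  refine Finset.sum_le_sum fun j _ => ?_
  rw [hAj]
  exact Finset.abs_sum_le_sum_abs _ _

end DriftBound

/-! ### Negligibility of the accumulated drift -/

section DriftNegligible

variable {Ω : Type*} [MeasurableSpace Ω] {P : Measure Ω} [IsProbabilityMeasure P]
  {K f : Plane → ℝ} {c M : ℝ} {X : ℕ → Ω → Plane} {h : ℕ → ℝ}

/-- The accumulated drift along the curve is negligible at the rate `√(n h⁶)`. -/
theorem IsSample.negligible_driftSize (hX : IsSample P f X) (hf : BoundedDensity f M)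
    (hK : BoundedKernel K c) (hh : BandwidthAssumptions h) {x₀ : Plane} {s : ℝ}
    (hs : eigVec f (curve f x₀ s) ≠ 0) (θ : ℝ) :
    Negligible P fun n ω => √((n : ℝ) * h n ^ 6) *
      driftSize (eigVec (kde K (h n) n fun i => X i ω)) (eigVec f) (curve f x₀) θ := by
  set γ := curve f x₀
  have hcur := hf.regular.isCurveFrom x₀
  have hγ : Continuous γ := hcur.continuous
  have hne : ∀ t, eigVec f (γ t) ≠ 0 := eigVec_curve_ne_zero hf.regular hs
  have hgap : ∀ r, gapMap (d2 f (γ r)) ≠ 0 := fun r => gapMap_ne_zero_of_eigVecMap_ne_zero (hne r)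
  set T := |θ|
  have hT : 0 ≤ T := abs_nonneg θ
  have hTT : -T ≤ T := by linarith
  obtain ⟨Q, hQ0, hQ⟩ := exists_norm_drift_le hf.regular hγ hgap T
  have h1 : Negligible P fun n ω => ∑ j : Fin 2, ∑ k : Fin 3, √((n : ℝ) * h n ^ 6) *
      |timeErr (kde K (h n) n fun i => X i ω) f (d2Index k) γ (eigVecCoeff f γ j k) θ| :=
    Negligible.sum _ fun j _ => Negligible.sum _ fun k _ =>
      hX.negligible_timeErr hf hK hh hcur.2 hne (continuous_eigVecCoeff hf.regular hγ hgap j k)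
        (abs_eigVecCoeff_le f γ j k) (length_d2Index k) θ
  have h2 : Negligible P fun n ω => ∑ j : Fin 2, ∑ k : Fin 3, √((n : ℝ) * h n ^ 6) *
      ∫ t in -T..T,
        |timeErr (kde K (h n) n fun i => X i ω) f (d2Index k) γ (eigVecCoeff f γ j k) t| :=
    Negligible.sum _ fun j _ => Negligible.sum _ fun k _ =>
      hX.negligible_integral_timeErr hf hK hh hcur.2 hne
        (continuous_eigVecCoeff hf.regular hγ hgap j k)
        (abs_eigVecCoeff_le f γ j k) (length_d2Index k) hT
  have h3 : Negligible P fun n ω => ∑ k : Fin 3, √((n : ℝ) * h n ^ 6) * ∫ t in -T..T,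
      (pd (d2Index k) (kde K (h n) n fun i => X i ω) (γ t) - pd (d2Index k) f (γ t)) ^ 2 :=
    Negligible.sum _ fun k _ =>
      hX.negligible_integral_sq hf hK hh hγ (length_d2Index k) hT
  refine ((h1.add h2).add (h3.const_mul (by positivity : 0 ≤ (1 + 2 * T) * Q))).mono
    (Eventually.of_forall fun n ω => ?_)
  have hg : Regular (kde K (h n) n fun i => X i ω) := hK.regular.kde _ _ _
  set g := kde K (h n) n fun i => X i ω
  have hDc : Continuous (drift (eigVec g) (eigVec f) γ) :=
    continuous_drift hg.continuous_eigVec hf.regular.continuous_eigVec hγ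
  have hEc : ∀ j k, Continuous (timeErr g f (d2Index k) γ (eigVecCoeff f γ j k)) := fun j k =>
    hg.continuous_timeErr hf.regular (by simp [length_d2Index]) hγ
      (continuous_eigVecCoeff hf.regular hγ hgap j k)
  set N := ∑ k, ∫ r in -T..T, (pd (d2Index k) g (γ r) - pd (d2Index k) f (γ r)) ^ 2
  have e1 := hQ g hg θ le_rfl
  have e2 : |∫ r in (0 : ℝ)..θ, ‖drift (eigVec g) (eigVec f) γ r‖| ≤
      ∑ j, ∑ k, (∫ t in -T..T, |timeErr g f (d2Index k) γ (eigVecCoeff f γ j k) t|) +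
        2 * T * (Q * N) := by
    calc _ ≤ ∫ r in -T..T, ‖drift (eigVec g) (eigVec f) γ r‖ :=
          abs_integral_le_integral_symm hDc.norm (fun _ => norm_nonneg _) le_rfl
      _ ≤ ∫ r in -T..T, (∑ j, ∑ k, |timeErr g f (d2Index k) γ (eigVecCoeff f γ j k) r| + Q * N) :=
          intervalIntegral.integral_mono_on hTT (hDc.norm.intervalIntegrable _ _)
            (Continuous.intervalIntegrable (by fun_prop) _ _)
            fun r hr => hQ g hg r (abs_le.2 hr)
      _ = _ := by
          rw [intervalIntegral.integral_add (Continuous.intervalIntegrable (by fun_prop) _ _)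
            (Continuous.intervalIntegrable (by fun_prop) _ _), intervalIntegral.integral_const,
            intervalIntegral.integral_finsetSum
              fun j _ => Continuous.intervalIntegrable (by fun_prop) _ _, smul_eq_mul]
          congr 1
          · refine Finset.sum_congr rfl fun j _ => ?_
            exact intervalIntegral.integral_finsetSum
              fun k _ => Continuous.intervalIntegrable (by fun_prop) _ _
          · ring
  have e3 : driftSize (eigVec g) (eigVec f) γ θ ≤
      ∑ j, ∑ k, |timeErr g f (d2Index k) γ (eigVecCoeff f γ j k) θ| +
      ∑ j, ∑ k, (∫ t in -T..T, |timeErr g f (d2Index k) γ (eigVecCoeff f γ j k) t|) +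
      (1 + 2 * T) * Q * N := by
    simp only [driftSize]
    linarith
  refine (mul_le_mul_of_nonneg_left e3 (Real.sqrt_nonneg _)).trans (le_of_eq ?_)
  simp only [← Finset.mul_sum]
  ring

end DriftNegligible

/-! ### Errors at a fixed point -/

section Pointwise

variable {Ω : Type*} [MeasurableSpace Ω] {P : Measure Ω} [IsProbabilityMeasure P]
  {K f : Plane → ℝ} {c M : ℝ} {X : ℕ → Ω → Plane} {h : ℕ → ℝ}

lemma IsSample.memLp_kern (hX : IsSample P f X) (hK : BoundedKernel K c) {b : ℝ}
    (hb : 0 < b) {l : List (Fin 2)} (hl : l.length ≤ 3) (n : ℕ) (x : Plane) :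
    MemLp (fun ω => emp (fun i => X i ω) n (kern K b l x) - ∫ y, f y * kern K b l x y) 2 P :=
  (hX.memLp_emp (hK.measurable_kern b hl x) (hK.abs_kern_le hb hl x) 2 n).sub (memLp_const _)

lemma IsSample.integral_kern_sq_le (hX : IsSample P f X) (hf : BoundedDensity f M)
    (hK : BoundedKernel K c) {b : ℝ} (hb : 0 < b) {l : List (Fin 2)} (hl : l.length ≤ 3) {n : ℕ}
    (hn : n ≠ 0) (x : Plane) :
    ∫ ω, (emp (fun i => X i ω) n (kern K b l x) - ∫ y, f y * kern K b l x y) ^ 2 ∂P ≤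
      (n : ℝ)⁻¹ * (M * c ^ 2 * discVol * b⁻¹ ^ (2 + 2 * l.length)) :=
  (hX.meanSq_emp_le hf (hK.measurable_kern b hl x) (hK.abs_kern_le hb hl x) hn).trans
    (mul_le_mul_of_nonneg_left (integral_density_mul_kern_sq_le hK hf hb hl x) (by positivity))

lemma abs_pd_kde_sub_le (hK : BoundedKernel K c) (hf : BoundedDensity f M) {b D : ℝ} (hb : 0 < b)
    {l : List (Fin 2)} (hl : l.length ≤ 3) {x : Plane} (hD : |smooth K b (pd l f) x - pd l f x| ≤ D)
    (n : ℕ) (ξ : ℕ → Plane) : |pd l (kde K b n ξ) x - pd l f x| ≤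
      |emp ξ n (kern K b l x) - ∫ y, f y * kern K b l x y| + D := by
  rw [pd_kde_eq_emp hK.regular b n ξ l (by omega),
    integral_density_mul_kern hK l hl hf.regular.contDiff hb]
  exact (abs_sub_le _ (smooth K b (pd l f) x) _).trans (by gcongr)

/-- First derivatives have variance of order 1/(nh⁴), so multiplication by nh⁶ leaves h²; the bias
is absorbed as before. -/
lemma IsSample.negligible_gradient (hX : IsSample P f X) (hf : BoundedDensity f M)
    (hK : BoundedKernel K c) (hh : BandwidthAssumptions h) (x : Plane) :
    Negligible P fun n ω => √((n : ℝ) * h n ^ 6) *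
      ‖gradient (kde K (h n) n fun i => X i ω) x - gradient f x‖ := by
  obtain ⟨C, hC0, hC⟩ := exists_bias_le_sq hK hf.regular
  have hone : ∀ i : Fin 2, Negligible P fun n ω => √((n : ℝ) * h n ^ 6) *
      |pd [i] (kde K (h n) n fun i => X i ω) x - pd [i] f x| := by
    intro i
    have hl : [i].length ≤ 3 := by simp
    set S : ℕ → Ω → ℝ := fun n ω => emp (fun i => X i ω) n (kern K (h n) [i] x) -
      ∫ y, f y * kern K (h n) [i] x y
    have hint : ∀ n, Integrable (fun ω => n * h n ^ 6 * S n ω ^ 2) P := fun n =>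
      (hX.memLp_kern hK (hh.pos n) hl n x).integrable_sq.const_mul _
    have hS : Negligible P fun n ω => n * h n ^ 6 * S n ω ^ 2 := by
      refine negligible_of_lintegral_le (e := fun n => M * c ^ 2 * discVol * h n ^ 2)
        (Eventually.of_forall fun n => (hint n).aestronglyMeasurable.aemeasurable) ?_ ?_
      · filter_upwards [eventually_ne_atTop 0] with n hn
        have hb := hh.pos n
        rw [← ofReal_integral_eq_lintegral_ofReal (hint n)
          (Eventually.of_forall fun ω => by positivity), integral_const_mul]
        refine ENNReal.ofReal_le_ofReal ((mul_le_mul_of_nonneg_left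
          (hX.integral_kern_sq_le hf hK hb hl hn x) (by positivity)).trans (le_of_eq ?_))
        have hn' : (n : ℝ) ≠ 0 := by exact_mod_cast hn
        rw [List.length_singleton, show 2 + 2 * 1 = 4 from rfl]
        field_simp
      · simpa using (hh.tendsto_zero.pow 2).const_mul (M * c ^ 2 * discVol)
    refine negligible_of_forall_le_add fun κ hκ =>
      ⟨_, (hS.const_mul (inv_nonneg.2 hκ.le)).add (negligible_of_tendsto
        (by simpa using hh.tendsto_bias.const_mul C :
          Tendsto (fun n : ℕ => C * (√((n : ℝ) * h n ^ 6) * h n ^ 2)) atTop (𝓝 0))),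
        Eventually.of_forall fun n ω => ?_⟩
    have hb := hh.pos n
    have h1 := abs_pd_kde_sub_le hK hf hb hl (hC [i] (by simp) (h n) hb x) n (fun i => X i ω)
    have h2 := abs_le_add_sq_div (√((n : ℝ) * h n ^ 6) * S n ω) hκ
    rw [abs_mul, abs_of_nonneg (Real.sqrt_nonneg _), mul_pow, Real.sq_sqrt (by positivity)] at h2
    have h3 := mul_le_mul_of_nonneg_left h1 (Real.sqrt_nonneg ((n : ℝ) * h n ^ 6))
    simp only [S] at h2 ⊢
    linarith
  refine (Negligible.sum Finset.univ fun i _ => hone i).mono (Eventually.of_forall fun n ω => ?_)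
  rw [← Finset.mul_sum]
  gcongr
  refine (norm_le_sum_abs _).trans (le_of_eq ?_)
  rw [gradient_eq, gradient_eq]
  simp [Fin.sum_univ_two]

/-- The scaled errors of the second derivatives are bounded in mean square. -/
lemma IsSample.exists_prob_d2_le (hX : IsSample P f X) (hf : BoundedDensity f M)
    (hK : BoundedKernel K c) (hh : BandwidthAssumptions h) (x : Plane) :
    ∃ B : ℝ, 0 ≤ B ∧ ∀ᶠ n : ℕ in atTop, ∀ s, 0 < s →
      P.real {ω | s ≤ √((n : ℝ) * h n ^ 6) * ‖d2 (kde K (h n) n fun i => X i ω) x - d2 f x‖} ≤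
        B / s ^ 2 := by
  obtain ⟨C, hC0, hC⟩ := exists_bias_le_sq hK hf.regular
  have hM := hf.M_nonneg
  have hD := discVol_nonneg
  refine ⟨∑ k : Fin 3, (2 * (M * c ^ 2 * discVol) + 2 * C ^ 2), by positivity, ?_⟩
  have hb1 : ∀ᶠ n : ℕ in atTop, √((n : ℝ) * h n ^ 6) * h n ^ 2 ≤ 1 :=
    (hh.tendsto_bias.eventually_lt_const one_pos).mono fun _ => le_of_lt
  filter_upwards [eventually_ne_atTop 0, hb1] with n hn hb1 s hs
  have hb := hh.pos n
  have hn' : (n : ℝ) ≠ 0 := by exact_mod_cast hn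
  have hl : ∀ k, (d2Index k).length ≤ 3 := fun k => by simp [length_d2Index]
  set S : Fin 3 → Ω → ℝ := fun k ω => emp (fun i => X i ω) n (kern K (h n) (d2Index k) x) -
    ∫ y, f y * kern K (h n) (d2Index k) x y
  set Z : Ω → ℝ := fun ω => ∑ k, (2 * ((n : ℝ) * h n ^ 6) * S k ω ^ 2 + 2 * C ^ 2)
  have hSi : ∀ k, Integrable (fun ω => 2 * ((n : ℝ) * h n ^ 6) * S k ω ^ 2) P := fun k =>
    (hX.memLp_kern hK hb (hl k) n x).integrable_sq.const_mul _
  have hSi' : ∀ k, Integrable (fun ω => 2 * ((n : ℝ) * h n ^ 6) * S k ω ^ 2 + 2 * C ^ 2) P :=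
    fun k => (hSi k).add (integrable_const _)
  have hZi : Integrable Z P := integrable_finsetSum _ fun k _ => hSi' k
  have hZ : ∫ ω, Z ω ∂P ≤ ∑ k : Fin 3, (2 * (M * c ^ 2 * discVol) + 2 * C ^ 2) := by
    simp only [Z]
    rw [integral_finsetSum _ fun k _ => hSi' k]
    refine Finset.sum_le_sum fun k _ => ?_
    rw [integral_add (hSi k) (integrable_const _), integral_const_mul]
    simp only [integral_const, probReal_univ, smul_eq_mul, one_mul]
    gcongr ?_ + _
    refine (mul_le_mul_of_nonneg_left (hX.integral_kern_sq_le hf hK hb (hl k) hn x)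
      (by positivity)).trans (le_of_eq ?_)
    rw [length_d2Index, show 2 + 2 * 2 = 6 from rfl]
    field_simp
  have hsub : {ω | s ≤ √((n : ℝ) * h n ^ 6) * ‖d2 (kde K (h n) n fun i => X i ω) x - d2 f x‖} ⊆
      {ω | s ^ 2 ≤ Z ω} := by
    intro ω hω
    simp only [Set.mem_ofPred_eq] at hω ⊢
    calc s ^ 2 ≤ (√((n : ℝ) * h n ^ 6) * ‖d2 (kde K (h n) n fun i => X i ω) x - d2 f x‖) ^ 2 := by
          gcongr
      _ = ∑ k, (√((n : ℝ) * h n ^ 6) *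
            |pd (d2Index k) (kde K (h n) n fun i => X i ω) x - pd (d2Index k) f x|) ^ 2 := by
          rw [mul_pow, EuclideanSpace.real_norm_sq_eq, Finset.mul_sum]
          simp only [PiLp.sub_apply, d2_apply, mul_pow, sq_abs]
      _ ≤ _ := by
          refine Finset.sum_le_sum fun k _ => ?_
          have h1 := abs_pd_kde_sub_le hK hf hb (hl k)
            (hC (d2Index k) (by simp [length_d2Index]) (h n) hb x) n (fun i => X i ω)
          have h2 : √((n : ℝ) * h n ^ 6) *
              |pd (d2Index k) (kde K (h n) n fun i => X i ω) x - pd (d2Index k) f x| ≤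
              √((n : ℝ) * h n ^ 6) * |S k ω| + C := by
            refine (mul_le_mul_of_nonneg_left h1 (Real.sqrt_nonneg _)).trans ?_
            simp only [S]
            nlinarith
          have h3 : (√((n : ℝ) * h n ^ 6) * |S k ω|) ^ 2 = (n : ℝ) * h n ^ 6 * S k ω ^ 2 := by
            rw [mul_pow, Real.sq_sqrt (by positivity), sq_abs]
          calc _ ≤ (√((n : ℝ) * h n ^ 6) * |S k ω| + C) ^ 2 := by gcongr
            _ ≤ _ := by nlinarith [sq_nonneg (√((n : ℝ) * h n ^ 6) * |S k ω| - C)]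
  have hmk := mul_meas_ge_le_integral_of_nonneg (μ := P)
    (Eventually.of_forall fun ω => Finset.sum_nonneg fun k _ => by positivity) hZi (s ^ 2)
  rw [le_div_iff₀ (by positivity), mul_comm]
  exact (mul_le_mul_of_nonneg_left (measureReal_mono hsub) (by positivity)).trans (hmk.trans hZ)

end Pointwise

/-! ### Central limit theorem for row sums of bounded functions of the sample -/

lemma norm_exp_mul_I_sub_le {u : ℝ} (hu : |u| ≤ 1) :
    ‖Complex.exp (u * Complex.I) - (1 + u * Complex.I - u ^ 2 / 2)‖ ≤ |u| ^ 3 := by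
  have hx : ‖(u * Complex.I : ℂ)‖ = |u| := by simp
  have h := Complex.exp_bound (x := u * Complex.I) (by rw [hx]; exact hu) (n := 3) (by norm_num)
  have e : ∑ m ∈ Finset.range 3, (u * Complex.I : ℂ) ^ m / m.factorial =
      1 + u * Complex.I - u ^ 2 / 2 := by
    simp [Finset.sum_range_succ, mul_pow]
    ring
  rw [e, hx] at h
  refine h.trans ?_
  have : 0 ≤ |u| ^ 3 := by positivity
  norm_num [Nat.factorial]
  linarith

section RowSum

variable {Ω : Type*} [MeasurableSpace Ω] {P : Measure Ω}
  {f : Plane → ℝ} {M : ℝ} {X : ℕ → Ω → Plane}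

lemma IsSample.identDistrib_comp (hX : IsSample P f X) {G : Plane → ℝ} (hG : Measurable G) (i : ℕ) :
    P.map (fun ω => G (X i ω)) = P.map fun ω => G (X 0 ω) := by
  have e : ∀ j, P.map (fun ω => G (X j ω)) =
      (volume.withDensity fun x => ENNReal.ofReal (f x)).map G := by
    intro j
    rw [← (hX.law j).map_eq, AEMeasurable.map_map_of_aemeasurable hG.aemeasurable
      (hX.law j).aemeasurable]
    rfl
  rw [e, e]

lemma IsSample.charFun_sum (hX : IsSample P f X) {G : Plane → ℝ} (hG : Measurable G) (n : ℕ)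
    (t : ℝ) : charFun (P.map fun ω => ∑ i ∈ Finset.range n, G (X i ω)) t =
      charFun (P.map fun ω => G (X 0 ω)) t ^ n := by
  have h := ((hX.indep_comp hG).restrict _).charFun_map_fun_finsetSum_eq_prod
    (s := Finset.range n) (fun i _ => hX.aemeasurable_comp hG i)
  rw [h]
  simp [hX.identDistrib_comp hG]

variable [IsProbabilityMeasure P]

/-- Third order expansion of the exponential: the linear term integrates to zero, and the cubic
error |tY|³ is at most |t|³cY² for a summand bounded by c. -/
lemma IsSample.norm_charFun_sub_le (hX : IsSample P f X) (hf : BoundedDensity f M)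
    {G : Plane → ℝ} (hG : Measurable G) {c t : ℝ} (hc : ∀ y, |G y| ≤ c) (h0 : ∫ y, f y * G y = 0)
    (ht : |t| * c ≤ 1) :
    ‖charFun (P.map fun ω => G (X 0 ω)) t - (1 - (t ^ 2 * (∫ y, f y * G y ^ 2) / 2 : ℝ))‖ ≤
      |t| ^ 3 * c * ∫ y, f y * G y ^ 2 := by
  set Y : Ω → ℝ := fun ω => G (X 0 ω)
  have hY : AEMeasurable Y P := hX.aemeasurable_comp hG 0
  have hYb : ∀ ω, |Y ω| ≤ c := fun ω => hc _
  have hL : MemLp Y 2 P := hX.memLp_comp hG hc 2 0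
  have hYi : Integrable Y P := hL.integrable (by norm_num)
  have hY2 : Integrable (fun ω => Y ω ^ 2) P := hL.integrable_sq
  have hmean : ∫ ω, Y ω ∂P = 0 := (hX.integral_comp hf hG.stronglyMeasurable 0).trans h0
  have hvar : ∫ ω, Y ω ^ 2 ∂P = ∫ y, f y * G y ^ 2 :=
    hX.integral_comp hf (hG.pow_const 2).stronglyMeasurable 0
  have hchar : charFun (P.map Y) t = ∫ ω, Complex.exp ((t * Y ω : ℝ) * Complex.I) ∂P := by
    rw [charFun_apply_real, integral_map hY (by fun_prop)]
    push_cast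
    rfl
  have hexp : Integrable (fun ω => Complex.exp ((t * Y ω : ℝ) * Complex.I)) P := by
    refine Integrable.of_bound (C := 1) ?_ (Eventually.of_forall fun ω => ?_)
    · refine AEMeasurable.aestronglyMeasurable ?_
      fun_prop
    · exact (Complex.norm_exp_ofReal_mul_I _).le
  have hpi : Integrable (fun ω => (1 + (t * Y ω : ℝ) * Complex.I - ((t * Y ω : ℝ) : ℂ) ^ 2 / 2)) P := by
    have h1 : Integrable (fun ω => ((t * Y ω : ℝ) : ℂ)) P := (hYi.const_mul t).ofReal
    have h2 : Integrable (fun ω => (((t * Y ω) ^ 2 : ℝ) : ℂ)) P := by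
      simp only [mul_pow]
      exact (hY2.const_mul (t ^ 2)).ofReal
    push_cast at h1 h2 ⊢
    exact ((integrable_const 1).add (h1.mul_const _)).sub (h2.div_const 2)
  have hpoly : ∫ ω, (1 + (t * Y ω : ℝ) * Complex.I - ((t * Y ω : ℝ) : ℂ) ^ 2 / 2) ∂P =
      (1 - ((t ^ 2 * (∫ y, f y * G y ^ 2) / 2 : ℝ) : ℂ) : ℂ) := by
    have h1 : Integrable (fun ω => ((t * Y ω : ℝ) : ℂ) * Complex.I) P :=
      ((hYi.const_mul t).ofReal).mul_const _
    have h2 : Integrable (fun ω => ((t * Y ω : ℝ) : ℂ) ^ 2 / 2) P := by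
      have : Integrable (fun ω => (((t * Y ω) ^ 2 : ℝ) : ℂ)) P := by
        simp only [mul_pow]
        exact (hY2.const_mul (t ^ 2)).ofReal
      push_cast at this ⊢
      exact this.div_const 2
    rw [integral_sub (f := fun ω => 1 + ((t * Y ω : ℝ) : ℂ) * Complex.I)
      ((integrable_const 1).add h1) h2, integral_add (integrable_const 1) h1, integral_mul_const,
      integral_div]
    have e1 : ∫ ω, ((t * Y ω : ℝ) : ℂ) ∂P = (0 : ℂ) := by
      rw [integral_complex_ofReal, integral_const_mul, hmean]; simp
    have e2 : ∫ ω, ((t * Y ω : ℝ) : ℂ) ^ 2 ∂P = ((t ^ 2 * ∫ y, f y * G y ^ 2 : ℝ) : ℂ) := by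
      rw [← hvar, ← integral_const_mul, ← integral_complex_ofReal]
      simp only [mul_pow, Complex.ofReal_mul, Complex.ofReal_pow]
    rw [e1, e2]
    simp
  rw [hchar, ← hpoly, ← integral_sub hexp hpi]
  calc _ ≤ ∫ ω, |t| ^ 3 * c * Y ω ^ 2 ∂P := by
        refine norm_integral_le_of_norm_le (hY2.const_mul _) (Eventually.of_forall fun ω => ?_)
        have hu : |t * Y ω| ≤ 1 := by
          rw [abs_mul]
          exact (mul_le_mul_of_nonneg_left (hYb ω) (abs_nonneg t)).trans ht
        refine (norm_exp_mul_I_sub_le hu).trans ?_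
        rw [abs_mul, mul_pow, mul_assoc]
        gcongr
        rw [pow_succ, sq_abs, mul_comm]
        gcongr
        exact hYb ω
    _ = _ := by rw [integral_const_mul, hvar]

/-- Row sums of centred, uniformly small functions of the sample are asymptotically normal. -/
theorem IsSample.tendstoInDistribution_sum (hX : IsSample P f X) (hf : BoundedDensity f M)
    {G : ℕ → Plane → ℝ} (hG : ∀ n, Measurable (G n)) {c : ℕ → ℝ} (hc : ∀ n y, |G n y| ≤ c n)
    (hc0 : Tendsto c atTop (𝓝 0)) (h0 : ∀ n, ∫ y, f y * G n y = 0) {v : NNReal}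
    (hv : Tendsto (fun n : ℕ => (n : ℝ) * ∫ y, f y * G n y ^ 2) atTop (𝓝 v)) :
    TendstoInDistribution (fun n ω => ∑ i ∈ Finset.range n, G n (X i ω)) atTop
      (id : ℝ → ℝ) (fun _ => P) (gaussianReal 0 v) where
  forall_aemeasurable n := Finset.aemeasurable_fun_sum _ fun i _ => hX.aemeasurable_comp (hG n) i
  tendsto := by
    refine ProbabilityMeasure.tendsto_iff_tendsto_charFun.2 fun t => ?_
    simp only [ProbabilityMeasure.coe_mk, Measure.map_id, hX.charFun_sum (hG _),
      charFun_gaussianReal]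
    set φ : ℕ → ℂ := fun n => charFun (P.map fun ω => G n (X 0 ω)) t
    -- It suffices that n(φₙ − 1) → −t²v/2, since then φₙⁿ = (1 + (φₙ − 1))ⁿ converges to the
    -- exponential of this limit. The error is at most |t|³cₙ times the row variance.
    have key : Tendsto (fun n : ℕ => (n : ℂ) * (φ n - 1)) atTop (𝓝 (-(t ^ 2 * v / 2 : ℝ))) := by
      have h1 : Tendsto (fun n : ℕ => |t| ^ 3 * c n * ((n : ℝ) * ∫ y, f y * G n y ^ 2)) atTop
          (𝓝 0) := by
        simpa using (hc0.const_mul (|t| ^ 3)).mul hv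
      have ht : ∀ᶠ n in atTop, |t| * c n ≤ 1 := by
        have : Tendsto (fun n => |t| * c n) atTop (𝓝 0) := by simpa using hc0.const_mul |t|
        exact (this.eventually_lt_const one_pos).mono fun _ => le_of_lt
      have h2 : Tendsto (fun n : ℕ => (n : ℂ) * (φ n - 1) +
          ((t ^ 2 * ((n : ℝ) * ∫ y, f y * G n y ^ 2) / 2 : ℝ) : ℂ)) atTop (𝓝 0) := by
        refine squeeze_zero_norm' ?_ h1
        filter_upwards [ht] with n hn
        have h3 := hX.norm_charFun_sub_le hf (hG n) (hc n) (h0 n) hn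
        calc _ = ‖(n : ℂ)‖ * ‖φ n - (1 - (t ^ 2 * (∫ y, f y * G n y ^ 2) / 2 : ℝ))‖ := by
              rw [← norm_mul]
              congr 1
              push_cast
              ring
          _ ≤ n * (|t| ^ 3 * c n * ∫ y, f y * G n y ^ 2) := by
              rw [Complex.norm_natCast]
              gcongr
          _ = _ := by ring
      have h4 : Tendsto (fun n : ℕ => ((t ^ 2 * ((n : ℝ) * ∫ y, f y * G n y ^ 2) / 2 : ℝ) : ℂ)) atTop
          (𝓝 ((t ^ 2 * v / 2 : ℝ) : ℂ)) :=
        (Complex.continuous_ofReal.tendsto _).comp ((hv.const_mul (t ^ 2)).div_const 2)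
      have h5 := h2.sub h4
      simpa using h5
    have h6 := Complex.tendsto_one_add_pow_exp_of_tendsto key
    have e : ∀ n, (1 + (φ n - 1)) ^ n = φ n ^ n := fun n => by ring_nf
    simp only [e] at h6
    convert h6 using 2
    push_cast
    congr 1
    ring

end RowSum

/-! ### Asymptotic normality of the second derivatives at a point -/

section Normality

variable {K f : Plane → ℝ} {c M : ℝ}

/-- The linear combination `∑ₖ wₖ ∂ₖK` of the second derivatives of the kernel. -/
def d2Comb (K : Plane → ℝ) (w : EuclideanSpace ℝ (Fin 3)) (z : Plane) : ℝ :=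
  ∑ k, w k * pd (d2Index k) K z

lemma BoundedKernel.continuous_d2Comb (hK : BoundedKernel K c) (w : EuclideanSpace ℝ (Fin 3)) :
    Continuous (d2Comb K w) :=
  continuous_finsetSum _ fun k _ =>
    continuous_const.mul (hK.regular.continuous_pd _ (by simp [length_d2Index]))

lemma BoundedKernel.abs_d2Comb_le (hK : BoundedKernel K c) (w : EuclideanSpace ℝ (Fin 3))
    (z : Plane) : |d2Comb K w z| ≤ (∑ k, |w k|) * c := by
  rw [d2Comb, Finset.sum_mul]
  refine (Finset.abs_sum_le_sum_abs _ _).trans (Finset.sum_le_sum fun k _ => ?_)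
  rw [abs_mul]
  exact mul_le_mul_of_nonneg_left (hK.le _ (by simp [length_d2Index]) z) (abs_nonneg _)

lemma BoundedKernel.integrable_d2Comb_sq (hK : BoundedKernel K c)
    (w : EuclideanSpace ℝ (Fin 3)) : Integrable fun z => d2Comb K w z ^ 2 := by
  refine ((hK.continuous_d2Comb w).pow 2).integrable_of_hasCompactSupport ?_
  refine HasCompactSupport.intro (isCompact_closedBall (0 : Plane) 1) fun z hz => ?_
  have h0 : ∀ k, pd (d2Index k) K z = 0 := fun k => hK.zero _ z (by simpa using hz)
  simp [d2Comb, h0]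

lemma BoundedKernel.integral_d2Comb_sq (hK : BoundedKernel K c)
    (w : EuclideanSpace ℝ (Fin 3)) : ∫ z, d2Comb K w z ^ 2 = quadForm (roughness K) w := by
  have hint : ∀ i j, Integrable fun z => w i * w j * (pd (d2Index i) K z * pd (d2Index j) K z) :=
    fun i j => (hK.integrable_mul (d2Index i) (by simp [length_d2Index])
      (hK.regular.continuous_pd (d2Index j) (by simp [length_d2Index]))).const_mul _
  have e : ∀ z, d2Comb K w z ^ 2 =
      ∑ i, ∑ j, w i * w j * (pd (d2Index i) K z * pd (d2Index j) K z) := by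
    intro z
    rw [d2Comb, sq, Finset.sum_mul_sum]
    exact Finset.sum_congr rfl fun i _ => Finset.sum_congr rfl fun j _ => by ring
  simp only [e]
  rw [integral_finsetSum _ fun i _ => integrable_finsetSum _ fun j _ => hint i j]
  simp only [quadForm, dotProduct, Matrix.mulVec, Finset.mul_sum]
  refine Finset.sum_congr rfl fun i _ => ?_
  rw [integral_finsetSum _ fun j _ => hint i j]
  refine Finset.sum_congr rfl fun j _ => ?_
  rw [integral_const_mul]
  simp only [roughness, Matrix.of_apply, d2_apply]
  ring

/-- The corresponding summand of the estimator. -/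
def combKern (K : Plane → ℝ) (b : ℝ) (w : EuclideanSpace ℝ (Fin 3)) (x y : Plane) : ℝ :=
  ∑ k, w k * kern K b (d2Index k) x y

lemma combKern_eq (K : Plane → ℝ) (b : ℝ) (w : EuclideanSpace ℝ (Fin 3)) (x y : Plane) :
    combKern K b w x y = b⁻¹ ^ 4 * d2Comb K w (b⁻¹ • (x - y)) := by
  simp only [combKern, d2Comb, kern, length_d2Index, Finset.mul_sum]
  exact Finset.sum_congr rfl fun k _ => by ring

lemma BoundedKernel.measurable_combKern (hK : BoundedKernel K c) (b : ℝ)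
    (w : EuclideanSpace ℝ (Fin 3)) (x : Plane) : Measurable (combKern K b w x) :=
  Finset.measurable_sum _ fun k _ =>
    (hK.measurable_kern b (by simp [length_d2Index]) x).const_mul _

lemma BoundedKernel.abs_combKern_le (hK : BoundedKernel K c) {b : ℝ} (hb : 0 < b)
    (w : EuclideanSpace ℝ (Fin 3)) (x y : Plane) :
    |combKern K b w x y| ≤ b⁻¹ ^ 4 * ((∑ k, |w k|) * c) := by
  rw [combKern_eq, abs_mul, abs_of_pos (by positivity)]
  gcongr
  exact hK.abs_d2Comb_le w _

lemma BoundedDensity.integrable_mul (hf : BoundedDensity f M) {G : Plane → ℝ} (hG : Measurable G)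
    {A : ℝ} (hA : ∀ y, |G y| ≤ A) : Integrable fun y => f y * G y :=
  hf.integrable.mul_bdd hG.aestronglyMeasurable (Eventually.of_forall hA)

lemma emp_combKern (K : Plane → ℝ) (b : ℝ) (w : EuclideanSpace ℝ (Fin 3)) (x : Plane) (n : ℕ)
    (ξ : ℕ → Plane) : emp ξ n (combKern K b w x) = ∑ k, w k * emp ξ n (kern K b (d2Index k) x) := by
  simp only [emp, combKern, Finset.mul_sum]
  rw [Finset.sum_comm]
  exact Finset.sum_congr rfl fun k _ => Finset.sum_congr rfl fun i _ => by ring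

lemma integral_mul_combKern (hK : BoundedKernel K c) (hf : BoundedDensity f M) {b : ℝ}
    (hb : 0 < b) (w : EuclideanSpace ℝ (Fin 3)) (x : Plane) :
    ∫ y, f y * combKern K b w x y = ∑ k, w k * smooth K b (pd (d2Index k) f) x := by
  have hl : ∀ k, (d2Index k).length ≤ 3 := fun k => by simp [length_d2Index]
  have hint : ∀ k, Integrable fun y => w k * (f y * kern K b (d2Index k) x y) := fun k =>
    (hf.integrable_mul (hK.measurable_kern b (hl k) x) (hK.abs_kern_le hb (hl k) x)).const_mul _
  have e : ∀ y, f y * combKern K b w x y = ∑ k, w k * (f y * kern K b (d2Index k) x y) := by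
    intro y
    rw [combKern, Finset.mul_sum]
    exact Finset.sum_congr rfl fun k _ => by ring
  simp only [e]
  rw [integral_finsetSum _ fun k _ => hint k]
  refine Finset.sum_congr rfl fun k _ => ?_
  rw [integral_const_mul, integral_density_mul_kern hK _ (hl k) hf.regular.contDiff hb]

lemma integral_mul_combKern_sq (K f : Plane → ℝ) {b : ℝ}
    (hb : 0 < b) (w : EuclideanSpace ℝ (Fin 3)) (x : Plane) :
    b ^ 6 * ∫ y, f y * combKern K b w x y ^ 2 = ∫ z, f (x - b • z) * d2Comb K w z ^ 2 := by
  have e : ∀ y, f y * combKern K b w x y ^ 2 =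
      b⁻¹ ^ 8 * (fun z => f (x - b • z) * d2Comb K w z ^ 2) (b⁻¹ • (x - y)) := by
    intro y
    simp only [combKern_eq]
    rw [smul_inv_smul₀ hb.ne', sub_sub_cancel]
    ring
  simp only [e]
  rw [integral_const_mul, integral_comp_inv_smul_sub hb x
    (fun z => f (x - b • z) * d2Comb K w z ^ 2)]
  field_simp

/-- After rescaling, the density is evaluated at x − hz, which tends to x; dominated convergence
pulls f(x) out and leaves the quadratic form of the roughness matrix. -/
lemma tendsto_integral_mul_combKern_sq (hK : BoundedKernel K c) (hf : BoundedDensity f M)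
    {h : ℕ → ℝ} (hh : BandwidthAssumptions h) (w : EuclideanSpace ℝ (Fin 3)) (x : Plane) :
    Tendsto (fun n => h n ^ 6 * ∫ y, f y * combKern K (h n) w x y ^ 2) atTop
      (𝓝 (f x * quadForm (roughness K) w)) := by
  have hfc := hf.regular.contDiff.continuous
  have hqc := hK.continuous_d2Comb w
  rw [← hK.integral_d2Comb_sq w, ← integral_const_mul]
  refine Tendsto.congr (fun n => (integral_mul_combKern_sq K f (hh.pos n) w x).symm) ?_
  refine tendsto_integral_filter_of_dominated_convergence (fun z => M * d2Comb K w z ^ 2) ?_ ?_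
    ((hK.integrable_d2Comb_sq w).const_mul M) ?_
  · exact Eventually.of_forall fun n => Continuous.aestronglyMeasurable (by fun_prop)
  · refine Eventually.of_forall fun n => Eventually.of_forall fun z => ?_
    rw [norm_mul, Real.norm_eq_abs, Real.norm_eq_abs, abs_of_nonneg (hf.nonneg _),
      abs_of_nonneg (sq_nonneg _)]
    gcongr
    exact hf.le _
  · refine Eventually.of_forall fun z => Tendsto.mul_const _ ?_
    have h1 : Tendsto (fun n => x - h n • z) atTop (𝓝 (x - (0 : ℝ) • z)) :=
      tendsto_const_nhds.sub (hh.tendsto_zero.smul_const z)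
    rw [zero_smul, sub_zero] at h1
    exact (hfc.tendsto x).comp h1

lemma quadForm_roughness_nonneg (hK : BoundedKernel K c) (w : EuclideanSpace ℝ (Fin 3)) :
    0 ≤ quadForm (roughness K) w := by
  rw [← hK.integral_d2Comb_sq w]
  exact integral_nonneg fun _ => sq_nonneg _

variable {Ω : Type*} [MeasurableSpace Ω] {P : Measure Ω} [IsProbabilityMeasure P]
  {X : ℕ → Ω → Plane} {h : ℕ → ℝ}

/-- Asymptotic normality of the linear combinations of the second derivatives of the estimator. -/
theorem IsSample.tendstoInDistribution_combKern (hX : IsSample P f X) (hf : BoundedDensity f M)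
    (hK : BoundedKernel K c) (hh : BandwidthAssumptions h) (w : EuclideanSpace ℝ (Fin 3))
    (x : Plane) {v : NNReal} (hv : (v : ℝ) = f x * quadForm (roughness K) w) :
    TendstoInDistribution (fun (n : ℕ) ω => -(√((n : ℝ) * h n ^ 6) *
      (emp (fun i => X i ω) n (combKern K (h n) w x) - ∫ y, f y * combKern K (h n) w x y))) atTop
      (id : ℝ → ℝ) (fun _ => P) (gaussianReal 0 v) := by
  set m : ℕ → ℝ := fun n => ∫ y, f y * combKern K (h n) w x y
  set a : ℕ → ℝ := fun n => √((n : ℝ) * h n ^ 6) * (n : ℝ)⁻¹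
  set B := (∑ k, |w k|) * c
  have hB : 0 ≤ B := mul_nonneg (Finset.sum_nonneg fun _ _ => abs_nonneg _) hK.c_nonneg
  have ha : ∀ n, 0 ≤ a n := fun n => by positivity
  have hqm := fun n => hK.measurable_combKern (h n) w x
  have hqb := fun n => hK.abs_combKern_le (hh.pos n) w x
  have hmb : ∀ n, |m n| ≤ (h n)⁻¹ ^ 4 * B := by
    intro n
    have h1 : ‖∫ y, f y * combKern K (h n) w x y‖ ≤ ∫ y, f y * ((h n)⁻¹ ^ 4 * B) := by
      refine norm_integral_le_of_norm_le (hf.integrable.mul_const _) (Eventually.of_forall fun y => ?_)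
      rw [norm_mul, Real.norm_eq_abs, Real.norm_eq_abs, abs_of_nonneg (hf.nonneg y)]
      exact mul_le_mul_of_nonneg_left (hqb n y) (hf.nonneg y)
    rwa [integral_mul_const, hf.integral, one_mul] at h1
  -- The summands carry the minus sign of the expansion −⟨W, ξ⟩V, so the limit theorem can be used
  -- as it stands.
  set G : ℕ → Plane → ℝ := fun n y => -(a n) * (combKern K (h n) w x y - m n)
  have hsum : ∀ (n : ℕ) ω, ∑ i ∈ Finset.range n, G n (X i ω) = -(√((n : ℝ) * h n ^ 6) *
      (emp (fun i => X i ω) n (combKern K (h n) w x) - m n)) := by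
    intro n ω
    rcases eq_or_ne n 0 with rfl | hn
    · simp
    · rw [emp_sub_eq hn, ← Finset.mul_sum]
      simp only [a]
      ring
  have hfun : (fun (n : ℕ) ω => -(√((n : ℝ) * h n ^ 6) *
      (emp (fun i => X i ω) n (combKern K (h n) w x) - ∫ y, f y * combKern K (h n) w x y))) =
      fun n ω => ∑ i ∈ Finset.range n, G n (X i ω) :=
    funext fun n => funext fun ω => (hsum n ω).symm
  rw [hfun]
  have hqi : ∀ n, Integrable fun y => f y * combKern K (h n) w x y := fun n =>
    hf.integrable_mul (hqm n) (hqb n)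
  have hq2i : ∀ n, Integrable fun y => f y * combKern K (h n) w x y ^ 2 := fun n =>
    hf.integrable_mul ((hqm n).pow_const 2) (A := ((h n)⁻¹ ^ 4 * B) ^ 2) fun y => by
      rw [abs_pow]
      exact pow_le_pow_left₀ (abs_nonneg _) (hqb n y) 2
  refine hX.tendstoInDistribution_sum hf (c := fun n => a n * (2 * ((h n)⁻¹ ^ 4 * B)))
    (fun n => ((hqm n).sub_const _).const_mul _) (fun n y => ?_) ?_ (fun n => ?_) ?_
  · rw [abs_mul, abs_neg, abs_of_nonneg (ha n)]
    gcongr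
    exact (abs_sub _ _).trans (by linarith [hqb n y, hmb n])
  -- The uniform bound on a summand is of order √(nh⁶)·n⁻¹·h⁻⁴ = (nh²)^(-1/2).
  · have h1 : Tendsto (fun n : ℕ => 2 * B * (√((n : ℝ) * h n ^ 2))⁻¹) atTop (𝓝 0) := by
      simpa using ((Real.tendsto_sqrt_atTop.comp
        (hh.tendsto_mul_pow (k := 2) (by norm_num))).inv_tendsto_atTop).const_mul (2 * B)
    refine h1.congr' ?_
    filter_upwards [eventually_ne_atTop 0] with n hn
    have hb := hh.pos n
    have hn' : (0 : ℝ) < n := by exact_mod_cast Nat.pos_of_ne_zero hn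
    have e1 : √((n : ℝ) * h n ^ 6) = √n * h n ^ 3 := by
      rw [Real.sqrt_mul hn'.le, show h n ^ 6 = (h n ^ 3) ^ 2 by ring, Real.sqrt_sq (by positivity)]
    have e2 : √((n : ℝ) * h n ^ 2) = √n * h n := by
      rw [Real.sqrt_mul hn'.le, Real.sqrt_sq hb.le]
    have e3 : (n : ℝ) = √n * √n := (Real.mul_self_sqrt hn'.le).symm
    have hs : 0 < √(n : ℝ) := Real.sqrt_pos.2 hn'
    simp only [a, e1, e2]
    rw [show ((n : ℝ))⁻¹ = (√n * √n)⁻¹ by rw [← e3]]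
    field_simp
  · have e : ∀ y, f y * G n y = -(a n) * (f y * combKern K (h n) w x y - m n * f y) := fun y => by
      simp only [G]; ring
    refine (integral_congr_ae (Eventually.of_forall e)).trans ?_
    rw [integral_const_mul, integral_sub (hqi n) (hf.integrable.const_mul _), integral_const_mul,
      hf.integral, mul_one, sub_self, mul_zero]
  -- The means converge, so centring changes the scaled second moment only by h⁶ times a bounded
  -- quantity.
  · have hmlim : Tendsto m atTop (𝓝 (∑ k, w k * pd (d2Index k) f x)) := by
      obtain ⟨C, hC0, hC⟩ := exists_bias_le hK hf.regular
      simp only [m, integral_mul_combKern hK hf (hh.pos _)]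
      refine tendsto_finsetSum _ fun k _ => Tendsto.const_mul _ ?_
      rw [tendsto_iff_norm_sub_tendsto_zero]
      have h1 : Tendsto (fun n => C * h n) atTop (𝓝 0) := by simpa using hh.tendsto_zero.const_mul C
      exact squeeze_zero (fun _ => norm_nonneg _)
        (fun n => hC _ (by simp [length_d2Index]) (h n) (hh.pos n) x) h1
    have h1 := (tendsto_integral_mul_combKern_sq hK hf hh w x).sub
      ((hh.tendsto_zero.pow 6).mul (hmlim.pow 2))
    rw [hv]
    rw [zero_pow (by norm_num), zero_mul, sub_zero] at h1
    refine h1.congr' ?_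
    filter_upwards [eventually_ne_atTop 0] with n hn
    have hb := hh.pos n
    have hn' : (n : ℝ) ≠ 0 := by exact_mod_cast hn
    have e : ∀ y, f y * G n y ^ 2 = a n ^ 2 * (f y * combKern K (h n) w x y ^ 2 -
        2 * m n * (f y * combKern K (h n) w x y) + m n ^ 2 * f y) := fun y => by
      simp only [G]; ring
    have ha2 : (n : ℝ) * a n ^ 2 = h n ^ 6 := by
      simp only [a]
      rw [mul_pow, Real.sq_sqrt (by positivity)]
      field_simp
    have hi : ∫ y, f y * G n y ^ 2 = a n ^ 2 * ((∫ y, f y * combKern K (h n) w x y ^ 2) - m n ^ 2) := by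
      simp only [e]
      rw [integral_const_mul, integral_add
        (f := fun y => f y * combKern K (h n) w x y ^ 2 - 2 * m n * (f y * combKern K (h n) w x y))
        ((hq2i n).sub ((hqi n).const_mul _)) (hf.integrable.const_mul _),
        integral_sub (hq2i n) ((hqi n).const_mul _), integral_const_mul, integral_const_mul,
        hf.integral]
      congr 1
      simp only [m]
      ring
    rw [hi, ← mul_assoc, ha2, mul_sub]

end Normality

/-! ### Assembly -/

/-- The hit from a starting point lies in L by the assumed description of L, and transversality is
assumed there. -/
lemma FilamentModel.firstHitModel {f : Plane → ℝ} {H L : Set Plane} {a : ℝ}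
    (hf : FilamentModel f H L a) {x₀ : Plane} (hx₀ : x₀ ∈ startSet f L a)
    (hdeg : ∀ t : ℝ, |t| ≤ |firstHit f x₀| →
      ¬ (eigVal f (curve f x₀ t) = 0 ∧ slope f (curve f x₀ t) = 0)) :
    FirstHitModel f x₀ (firstHit f x₀) := by
  obtain ⟨t, ht, huniq⟩ := hf.unique_hit x₀ hx₀
  have hfirst : IsFirstHit f x₀ (firstHit f x₀) := by
    have h : ∃ t, IsFirstHit f x₀ t := ⟨t, ht⟩
    rw [firstHit, dif_pos h]
    exact h.choose_spec
  refine ⟨hf.regular, hfirst, fun s hs => (huniq s hs).trans (huniq _ hfirst).symm, hdeg,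
    slopeDeriv_ne_zero_of_transversal hf.regular (hf.transversal _ ?_)⟩
  rw [hf.L_eq]
  exact ⟨x₀, hx₀, rfl⟩

section Main

variable {Ω : Type*} [MeasurableSpace Ω] {P : Measure Ω} [IsProbabilityMeasure P]
  {K f : Plane → ℝ} {c M : ℝ} {X : ℕ → Ω → Plane} {h : ℕ → ℝ}

lemma Negligible.tendstoInMeasure {E : Type*} [NormedAddCommGroup E] {Y : ℕ → Ω → E}
    (hY : Negligible P fun n ω => ‖Y n ω‖) : TendstoInMeasure P Y atTop 0 := by
  rw [tendstoInMeasure_iff_norm]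
  intro ε hε
  have h1 := hY ε hε
  simp only [Pi.zero_apply, sub_zero]
  exact (ENNReal.tendsto_toReal_iff (fun n => measure_ne_top P _) ENNReal.zero_ne_top).1 h1

/-- The linearization error of the estimated first filament point is negligible. -/
theorem FirstHitModel.negligible_remainder {x₀ : Plane} {θ : ℝ} (hm : FirstHitModel f x₀ θ)
    (hX : IsSample P f X) (hf : BoundedDensity f M) (hK : BoundedKernel K c)
    (hh : BandwidthAssumptions h) {θhat : ℕ → Ω → ℝ}
    (hθ : ∀ n ω, IsHitEstimate (kde K (h n) n fun i => X i ω) x₀ (θhat n ω)) :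
    Negligible P fun n ω => √((n : ℝ) * h n ^ 6) *
      ‖curve (kde K (h n) n fun i => X i ω) x₀ (θhat n ω) - curve f x₀ θ +
        inner ℝ (weight f (curve f x₀ θ)) (d2 (kde K (h n) n fun i => X i ω) (curve f x₀ θ) -
          d2 f (curve f x₀ θ)) • eigVec f (curve f x₀ θ)‖ := by
  obtain ⟨R, C, -, hC0, hexp⟩ := hm.exists_expansion
  set x := curve f x₀ θ
  obtain ⟨B, hB0, hB⟩ := hX.exists_prob_d2_le hf hK hh x
  have hN := ((hX.negligible_gradient hf hK hh x).add (hX.negligible_driftSize hf hK hh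
    (eigVec_ne_zero_of_slopeDeriv hm.transversal) θ)).const_mul hC0
  intro κ hκ
  rw [Metric.tendsto_atTop']
  suffices H : ∀ δ > 0, ∀ᶠ n : ℕ in atTop, P.real {ω | κ ≤ √((n : ℝ) * h n ^ 6) *
      ‖curve (kde K (h n) n fun i => X i ω) x₀ (θhat n ω) - x +
        inner ℝ (weight f x) (d2 (kde K (h n) n fun i => X i ω) x - d2 f x) • eigVec f x‖} < δ by
    intro δ hδ
    obtain ⟨N, hN⟩ := eventually_atTop.1 (H δ hδ)
    refine ⟨N, fun n hn => ?_⟩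
    rw [Real.dist_0_eq_abs, abs_of_nonneg measureReal_nonneg]
    exact hN n hn.le
  intro δ hδ
  -- The level s is chosen first, so that the scaled error of d² exceeds it with probability below
  -- δ/3. Only then is the factor ε = κ/(2s) of the expansion fixed, which makes the linear
  -- remainder smaller than κ/2 off that event.
  set s := √(3 * (B + 1) / δ)
  have hs : 0 < s := Real.sqrt_pos.2 (by positivity)
  have hBs : B / s ^ 2 < δ / 3 := by
    rw [Real.sq_sqrt (by positivity), div_lt_div_iff₀ (by positivity) (by norm_num)]
    rw [mul_div_assoc', lt_div_iff₀ hδ]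
    nlinarith
  obtain ⟨η, hη, hexp⟩ := hexp (κ / (2 * s)) (by positivity)
  filter_upwards [hB, (hX.tendsto_closeAt hf hK hh x₀ R hη).eventually_lt_const
    (by positivity : 0 < δ / 3), (hN (κ / 2) (half_pos hκ)).eventually_lt_const
    (by positivity : 0 < δ / 3)] with n h1 h2 h3
  have hsub : {ω | κ ≤ √((n : ℝ) * h n ^ 6) *
      ‖curve (kde K (h n) n fun i => X i ω) x₀ (θhat n ω) - x +
        inner ℝ (weight f x) (d2 (kde K (h n) n fun i => X i ω) x - d2 f x) • eigVec f x‖} ⊆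
      ({ω | ¬ ∀ x ∈ Metric.closedBall x₀ R, CloseAt f (kde K (h n) n fun i => X i ω) η x} ∪
      {ω | s ≤ √((n : ℝ) * h n ^ 6) * ‖d2 (kde K (h n) n fun i => X i ω) x - d2 f x‖}) ∪
      {ω | κ / 2 ≤ C * (√((n : ℝ) * h n ^ 6) *
        ‖gradient (kde K (h n) n fun i => X i ω) x - gradient f x‖ + √((n : ℝ) * h n ^ 6) *
        driftSize (eigVec (kde K (h n) n fun i => X i ω)) (eigVec f) (curve f x₀) θ)} := by
    intro ω hω
    simp only [Set.mem_union, Set.mem_ofPred_eq] at hω ⊢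
    by_contra! hcon
    obtain ⟨⟨hc, hd⟩, hg⟩ := hcon
    have he := hexp _ (hK.regular.kde (h n) n fun i => X i ω) hc _ (hθ n ω)
    have he' := mul_le_mul_of_nonneg_left he (Real.sqrt_nonneg ((n : ℝ) * h n ^ 6))
    have hd' : κ / (2 * s) * (√((n : ℝ) * h n ^ 6) *
        ‖d2 (kde K (h n) n fun i => X i ω) x - d2 f x‖) < κ / 2 := by
      calc _ < κ / (2 * s) * s := by gcongr
        _ = κ / 2 := by field_simp
    linarith
  calc _ ≤ _ := measureReal_mono hsub
    _ ≤ _ := (measureReal_union_le _ _).trans (add_le_add_left (measureReal_union_le _ _) _)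
    _ < δ := by linarith [h1 s hs]

/-- Asymptotic normality of the estimated first filament point. -/
theorem FirstHitModel.tendstoInDistribution {x₀ : Plane} {θ : ℝ} (hm : FirstHitModel f x₀ θ)
    (hX : IsSample P f X) (hf : BoundedDensity f M) (hK : BoundedKernel K c)
    (hh : BandwidthAssumptions h) {θhat : ℕ → Ω → ℝ} (hθm : ∀ n, AEMeasurable (θhat n) P)
    (hθ : ∀ n ω, IsHitEstimate (kde K (h n) n fun i => X i ω) x₀ (θhat n ω)) {v : NNReal}
    (hv : (v : ℝ) = f (curve f x₀ θ) * quadForm (roughness K) (weight f (curve f x₀ θ))) :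
    TendstoInDistribution (fun (n : ℕ) ω => √((n : ℝ) * h n ^ 6) •
      (curve (kde K (h n) n fun i => X i ω) x₀ (θhat n ω) - curve f x₀ θ)) atTop
      (fun z : ℝ => z • eigVec f (curve f x₀ θ)) (fun _ => P) (gaussianReal 0 v) := by
  set x := curve f x₀ θ
  set w := weight f x
  set V := eigVec f x
  obtain ⟨C, hC0, hC⟩ := exists_bias_le_sq hK hf.regular
  have hclt := (hX.tendstoInDistribution_combKern hf hK hh w x hv).continuous_comp
    (g := fun z : ℝ => z • V) (by fun_prop)
  -- Slutsky's argument: the difference from the asymptotically normal term is the linearization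
  -- error plus a bias term, both negligible.
  refine tendstoInDistribution_of_tendstoInMeasure_sub _ _ hclt (Negligible.tendstoInMeasure ?_)
    fun n => ((aemeasurable_curve_kde hK.regular (h n) n x₀ (fun i => (hX.law i).aemeasurable)
      (hθm n)).sub_const x).fun_const_smul (√((n : ℝ) * h n ^ 6))
  refine ((hm.negligible_remainder hX hf hK hh hθ).add (negligible_of_tendsto
    (by simpa using hh.tendsto_bias.const_mul ((∑ k, |w k|) * C * ‖V‖) :
      Tendsto (fun n : ℕ => (∑ k, |w k|) * C * ‖V‖ * (√((n : ℝ) * h n ^ 6) * h n ^ 2))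
        atTop (𝓝 0)))).mono (Eventually.of_forall fun n ω => ?_)
  have hb := hh.pos n
  set g := kde K (h n) n fun i => X i ω with hg
  set ρ := √((n : ℝ) * h n ^ 6)
  have hρ : 0 ≤ ρ := Real.sqrt_nonneg _
  -- The limit theorem centres at the mean of the estimator and the expansion at the density; D is
  -- the bias between the two.
  set D := ∑ k, w k * (pd (d2Index k) f x - smooth K (h n) (pd (d2Index k) f) x)
  have hD : |D| ≤ (∑ k, |w k|) * (C * h n ^ 2) := by
    rw [Finset.sum_mul]
    refine (Finset.abs_sum_le_sum_abs _ _).trans (Finset.sum_le_sum fun k _ => ?_)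
    rw [abs_mul, abs_sub_comm]
    exact mul_le_mul_of_nonneg_left (hC _ (by simp [length_d2Index]) (h n) hb x) (abs_nonneg _)
  have hlin : emp (fun i => X i ω) n (combKern K (h n) w x) - ∫ y, f y * combKern K (h n) w x y =
      inner ℝ w (d2 g x - d2 f x) + D := by
    rw [emp_combKern, integral_mul_combKern hK hf hb, ← Finset.sum_sub_distrib, PiLp.inner_apply,
      ← Finset.sum_add_distrib]
    refine Finset.sum_congr rfl fun k _ => ?_
    rw [← pd_kde_eq_emp hK.regular (h n) n _ (d2Index k) (by simp [length_d2Index]), ← hg,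
      PiLp.sub_apply, d2_apply, d2_apply]
    simp
    ring
  have e : ρ • (curve g x₀ (θhat n ω) - x) -
      (-(ρ * (emp (fun i => X i ω) n (combKern K (h n) w x) -
        ∫ y, f y * combKern K (h n) w x y))) • V =
      ρ • (curve g x₀ (θhat n ω) - x + inner ℝ w (d2 g x - d2 f x) • V) + (ρ * D) • V := by
    rw [hlin]
    module
  simp only [Pi.sub_apply, Function.comp_apply]
  rw [e]
  refine (norm_add_le _ _).trans ?_
  rw [norm_smul, norm_smul, Real.norm_eq_abs, Real.norm_eq_abs, abs_mul, abs_of_nonneg hρ]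
  refine add_le_add le_rfl ?_
  calc ρ * |D| * ‖V‖ ≤ ρ * ((∑ k, |w k|) * (C * h n ^ 2)) * ‖V‖ := by gcongr
    _ = _ := by ring

end Main

end Ridge

end

theorem corollary3p1
    {Ω : Type*} [MeasurableSpace Ω] (P : Measure Ω) [IsProbabilityMeasure P]
    (f : Ridge.Plane → ℝ) (H L : Set Ridge.Plane) (a : ℝ) (hf : Ridge.FilamentModel f H L a)
    (K : Ridge.Plane → ℝ) (hK : Ridge.KernelAssumptions K)
    (h : ℕ → ℝ) (hh : Ridge.BandwidthAssumptions h)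
    -- an i.i.d. sample from the density `f`
    (X : ℕ → Ω → Ridge.Plane) (hX_indep : iIndepFun X P)
    (hX_law : ∀ i, HasLaw (X i) (volume.withDensity fun x => ENNReal.ofReal (f x)) P)
    (x₀ : Ridge.Plane) (hx₀ : x₀ ∈ Ridge.startSet f L a)
    -- no degenerate point within the time range searched for the first filament point
    (hdeg : ∀ t : ℝ, |t| ≤ |Ridge.firstHit f x₀| →
      ¬ (Ridge.eigVal f (Ridge.curve f x₀ t) = 0 ∧ Ridge.slope f (Ridge.curve f x₀ t) = 0))
    -- the estimated time, any (measurable) choice of the minimizer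
    (θhat : ℕ → Ω → ℝ) (hθ_meas : ∀ n, AEMeasurable (θhat n) P)
    (hθ : ∀ n ω,
      Ridge.IsHitEstimate (Ridge.kde K (h n) n fun i => X i ω) x₀ (θhat n ω)) :
    ∃ v : NNReal,
      (v : ℝ) = f (Ridge.curve f x₀ (Ridge.firstHit f x₀)) *
        Ridge.quadForm (Ridge.roughness K)
          (Ridge.weight f (Ridge.curve f x₀ (Ridge.firstHit f x₀))) ∧
      TendstoInDistribution
        (fun (n : ℕ) (ω : Ω) => √((n : ℝ) * h n ^ 6) •
          (Ridge.curve (Ridge.kde K (h n) n fun i => X i ω) x₀ (θhat n ω) -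
            Ridge.curve f x₀ (Ridge.firstHit f x₀)))
        atTop
        (fun z : ℝ => z • Ridge.eigVec f (Ridge.curve f x₀ (Ridge.firstHit f x₀)))
        (fun _ => P) (gaussianReal 0 v) := by
  have hm := hf.firstHitModel hx₀ hdeg
  obtain ⟨M, hfM⟩ := Ridge.exists_boundedDensity hf.regular hf.density
  obtain ⟨c, hKc⟩ := Ridge.exists_boundedKernel hK
  exact ⟨⟨_, mul_nonneg (hfM.nonneg _) (Ridge.quadForm_roughness_nonneg hKc _)⟩, rfl,
    hm.tendstoInDistribution ⟨hX_indep, hX_law⟩ hfM hKc hh hθ_meas hθ rfl⟩
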